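/- **Convergence of DRGTA.** Let $n\ge 2$, let $\mathrm{St}(d,r)=\{x\in\mathbb R^{d\times r}: x^\top x=I_r\}$, and let $\|\cdot\|_F,\|\cdot\|_2$ be the Frobenius and spectral norms. *Functions.* Let $f_1,\dots,f_n:\mathbb R^{d\times r}\to\mathbb R$ be differentiable with $\|\nabla f_i(x)-\nabla f_i(y)\|_F\le L\|x-y\|_F$, $L>0$. Put $f=\frac1n\sum_i f_i$ and $f^*=\min_{\mathrm{St}(d,r)}f$. Let $\mathcal P_{T_x}(z)=z-\frac12x(x^\top z+z^\top x)$ and $\mathrm{grad} f_i(x)=\mathcal P_{T_x}(\nabla f_i(x))$. Let $L_n,D$ satisfy $\|\nabla f_i(x)\|_2\le L_n$ and $\|\mathrm{grad} f_i(x)\|_F\le D$ for all $i$ and all $x\in\mathrm{St}(d,r)$, and put $L_G=L+2L_n$. *Network.* Let $W\in\mathbb R^{n\times n}$ be symmetric, entrywise nonnegative, with row sums $1$ and all eigenvalues in $(-1,1]$, such that $W_{ij}>0$ ($i\ne j$) exactly on the edges of a connected graph. Let $\sigma_2$ be its second largest singular value, and let $t\ge1$ be an integer with $t\ge\lceil\log_{\sigma_2}\frac1{2\sqrt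 n}\rceil$ (no condition beyond $t\ge 1$ if $\sigma_2=0$). Put $L_t=1-\lambda_n(W^t)$, $\mu_t=1-\lambda_2(W^t)$, with eigenvalues $\lambda_1\ge\dots\ge\lambda_n$ of $W^t$. *Region.* For $\mathbf x=(x_1,\dots,x_n)\in \mathrm{St}(d,r)^n$ let $\bar x\in\arg\min_{y\in\mathrm{St}(d,r)}\sum_i\|y-x_i\|_F^2$, and write $\|\mathbf x-\bar{\mathbf x}\|_F^2=\sum_i\|x_i-\bar x\|_F^2$. Fix $\delta_1>0$ and $\delta_2$ with $\delta_1\le\frac{\delta_2}{5\sqrt r}$, $\delta_2\le\frac16$. Let $\mathcal N$ be the set of $\mathbf x\in \mathrm{St}(d,r)^n$ with $\|\mathbf x-\bar{\mathbf x}\|_F^2\le n\delta_1^2$ and $\max_i\|x_i-\bar x\|_F\le\delta_2$. *Algorithm.* Let $\varphi^t(\mathbf x)=\frac14\sum_{i,j}(W^t)_{ij}\|x_i-x_j\|_F^2$, let $\mathrm{grad}\varphi^t_i$ be its Riemannian gradient in the $i$-th block, and let $\mathcal R_x(\xi)=(x+\xi)(I_r+\xi^\top\xi)^{-1/2}$.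 Starting from $\mathbf x_0\in\mathcal N$ and $y_{i,0}=\mathrm{grad} f_i(x_{i,0})$, set $$x_{i,k+1}=\mathcal R_{x_{i,k}}\big(-\alpha\,\mathrm{grad}\varphi^t_i(\mathbf x_k)-\beta\,\mathcal P_{T_{x_{i,k}}}y_{i,k}\big),\qquad y_{i,k+1}=\sum_j (W^t)_{ij}y_{j,k}+\mathrm{grad} f_i(x_{i,k+1})-\mathrm{grad} f_i(x_{i,k}),$$ with $0<\alpha\le\min\{\frac{2-\delta_2^2}{2L_t},1\}$ and constant $\beta>0$. *Constants.* Put $\gamma_t=(1-4r\delta_1^2)(1-\frac{\delta_2^2}2)\mu_t$, $\rho_t=\sqrt{1-\gamma_t\alpha}$, $\hat g_0=\frac1n\sum_i\mathrm{grad} f_i(x_{i,0})$, and for a number $c>0$ put $C_1=\frac{c}{(1-\rho_t)^2}$ and $$\tilde C_0=\tfrac2{(1-\rho_t)^2},\quad \tilde C_1=\tfrac{2}{1-\rho_t^2}\tfrac1n\|\mathbf x_0-\bar{\mathbf x}_0\|_F^2,\quad \tilde C_2=\tfrac2{(1-\sigma_2^t)^2},\quad \tilde C_3=\tfrac2{1-\sigma_2^{2t}}\tfrac1n\sum_i\|y_{i,0}-\hat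 g_0\|_F^2,$$ $$\tilde C_4=\tfrac\beta2\big(8\alpha^2\tilde C_1\tilde C_2L_G^2+\tilde C_3\big),\quad \mathcal G_0=\tfrac{4r(L_G+2D)^2C_1}{L_G^2},\quad \mathcal G_1=1+\mathcal G_0+\tfrac{2D\alpha+8D\alpha^2}{L_G}+13C_1\delta_1^2\alpha^4,$$ $$\mathcal G_2=\tfrac{2D}{L_G}+\tfrac{\delta_1^2}2+5,\quad \mathcal G_3=(\mathcal G_0+\mathcal G_1)\tilde C_0+\mathcal G_2,\quad \mathcal G_4=\tfrac{\mathcal G_0\tilde C_0\delta_1^2\alpha^2}{25}+\tilde C_1(\mathcal G_1+4rC_1).$$ *Claim.* There is an absolute constant $c>0$ such that in every such situation, if $$\beta\le\min\Big\{\frac{(1-\rho_t)\delta_1}{L_G+2D},\ \frac{\alpha\delta_1}{5(L_G+2D)},\ \frac1{8L_G},\ \frac1{4L_G\big(2\mathcal G_3+(8\tilde C_0+\frac12\tilde C_2)\alpha\delta_1\big)}\Big\},$$ then for every integer $K\ge1$ $$\min_{0\le k\le K}\|\mathrm{grad} f(\bar x_k)\|_F^2\le\frac{(16+\alpha^2\delta_1^2\tilde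 C_0)\big(f(\bar x_0)-f^*+\tilde C_4+\mathcal G_4L_G\big)+\tilde C_1L_G}{\beta K},$$ $$\min_{0\le k\le K}\frac1n\|\mathbf x_k-\bar{\mathbf x}_k\|_F^2\le\frac{8\beta\,\tilde C_0\big(f(\bar x_0)-f^*+\tilde C_4+\mathcal G_4L_G\big)+\tilde C_1}{K}.$$ -/

import Mathlib

open scoped Matrix MatrixOrder

/- On matrices, `‖·‖` is the Frobenius norm. -/
attribute [local instance] Matrix.frobeniusNormedAddCommGroup Matrix.frobeniusNormedSpace

noncomputable section

namespace DRGTA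

/-- Real `d × r` matrices. -/
abbrev Mat (d r : ℕ) : Type := Matrix (Fin d) (Fin r) ℝ

/-! ### The Stiefel manifold, Riemannian gradients and the polar retraction -/

/-- The Stiefel manifold `St(d,r)`. -/
def stiefel (d r : ℕ) : Set (Mat d r) := {x | xᵀ * x = 1}

/-- The Euclidean gradient of a function of a matrix: the matrix of its partial derivatives. -/
def egrad {d r : ℕ} (f : Mat d r → ℝ) (x : Mat d r) : Mat d r :=
  Matrix.of fun i j => fderiv ℝ f x (Matrix.single i j 1)

/-- The orthogonal projection `z ↦ z - x (xᵀ z + zᵀ x) / 2` onto the tangent space of the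
Stiefel manifold at `x`. -/
def tangentProj {d r : ℕ} (x z : Mat d r) : Mat d r :=
  z - (1 / 2 : ℝ) • (x * (xᵀ * z + zᵀ * x))

/-- The Riemannian gradient on the Stiefel manifold (embedded metric). -/
def rgrad {d r : ℕ} (f : Mat d r → ℝ) (x : Mat d r) : Mat d r :=
  tangentProj x (egrad f x)

/-- The polar retraction `R_x(ξ) = (x + ξ) (I + ξᵀ ξ)^(-1/2)`. -/
def polarRetraction {d r : ℕ} (x ξ : Mat d r) : Mat d r :=
  (x + ξ) * (CFC.sqrt (1 + ξᵀ * ξ))⁻¹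

/-- The spectral norm, i.e. the operator norm for the Euclidean norms. -/
def specNorm {d r : ℕ} (A : Mat d r) : ℝ :=
  ‖LinearMap.toContinuousLinearMap (Matrix.toEuclideanLin A)‖

/-! ### Averages of `n` points -/

/-- The arithmetic mean of `n` matrices. -/
def mean {n d r : ℕ} (x : Fin n → Mat d r) : Mat d r := (1 / (n : ℝ)) • ∑ i, x i

/-- `‖x - 1 ⊗ y‖_F²`. -/
def sqDist {n d r : ℕ} (x : Fin n → Mat d r) (y : Mat d r) : ℝ := ∑ i, ‖x i - y‖ ^ 2

/-- `y` is an induced arithmetic mean of `x₁, …, xₙ` on the Stiefel manifold: a minimizer over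
the manifold of the sum of the squared Frobenius distances to the `xᵢ`. -/
def IsIAM {n d r : ℕ} (x : Fin n → Mat d r) (y : Mat d r) : Prop :=
  y ∈ stiefel d r ∧ ∀ z ∈ stiefel d r, sqDist x y ≤ sqDist x z

/-- Membership of `x ∈ St(d,r)ⁿ`, with induced arithmetic mean `xbar`, in the local region
`𝒩 = 𝒩₁ ∩ 𝒩₂`, where `𝒩₁ : ‖x - x̄‖_F² ≤ n δ₁²` and `𝒩₂ : max_i ‖x_i - x̄‖_F ≤ δ₂`. -/
def InRegion {n d r : ℕ} (δ₁ δ₂ : ℝ) (x : Fin n → Mat d r) (xbar : Mat d r) : Prop :=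
  (∀ i, x i ∈ stiefel d r) ∧ sqDist x xbar ≤ n * δ₁ ^ 2 ∧ ∀ i, ‖x i - xbar‖ ≤ δ₂

/-! ### The network -/

/-- The `k`-th largest eigenvalue (`k = 0, 1, …`, with multiplicity) of a real symmetric matrix;
`0` outside the meaningful range. -/
def sortedEigenvalue {n : ℕ} (A : Matrix (Fin n) (Fin n) ℝ) (k : ℕ) : ℝ :=
  if h : A.IsHermitian ∧ k < Fintype.card (Fin n) then h.1.eigenvalues₀ ⟨k, h.2⟩ else 0

/-- The second largest singular value. -/
def sigma₂ {n : ℕ} (W : Matrix (Fin n) (Fin n) ℝ) : ℝ := √(sortedEigenvalue (Wᵀ * W) 1)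

/-- `W` is a symmetric doubly stochastic mixing matrix of the connected undirected graph `G`,
with eigenvalues in `(-1, 1]` (the upper bound is automatic). -/
structure IsMixingMatrix {n : ℕ} (G : SimpleGraph (Fin n)) (W : Matrix (Fin n) (Fin n) ℝ) :
    Prop where
  connected : G.Connected
  symm : W.IsSymm
  nonneg : ∀ i j, 0 ≤ W i j
  row_sum : ∀ i, ∑ j, W i j = 1
  pos_iff_adj : ∀ i j, i ≠ j → (0 < W i j ↔ G.Adj i j)
  eigenvalue_gt : ∀ μ : ℝ, Module.End.HasEigenvalue (Matrix.toLin' W) μ → -1 < μ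

/-- The consensus potential `φᵗ(x) = (1/4) ∑ᵢ ∑ⱼ (Wᵗ)ᵢⱼ ‖xᵢ - xⱼ‖²`. -/
def consensusPotential {n d r : ℕ} (W : Matrix (Fin n) (Fin n) ℝ) (t : ℕ)
    (x : Fin n → Mat d r) : ℝ :=
  (1 / 4) * ∑ i, ∑ j, (W ^ t) i j * ‖x i - x j‖ ^ 2

/-- The Riemannian gradient of `φᵗ` with respect to its `i`-th block. -/
def consensusGrad {n d r : ℕ} (W : Matrix (Fin n) (Fin n) ℝ) (t : ℕ)
    (x : Fin n → Mat d r) (i : Fin n) : Mat d r :=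
  rgrad (fun z => consensusPotential W t (Function.update x i z)) (x i)

/-! ### The algorithm -/

/-- One iteration of the decentralized Riemannian gradient tracking algorithm, from
`(x_k, y_k)` to `(x_{k+1}, y_{k+1})`. -/
def step {n d r : ℕ} (W : Matrix (Fin n) (Fin n) ℝ) (t : ℕ) (α β : ℝ)
    (f : Fin n → Mat d r → ℝ) (s : (Fin n → Mat d r) × (Fin n → Mat d r)) :
    (Fin n → Mat d r) × (Fin n → Mat d r) :=
  let xnew : Fin n → Mat d r := fun i =>
    polarRetraction (s.1 i)
      (-(α • consensusGrad W t s.1 i) - β • tangentProj (s.1 i) (s.2 i))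
  (xnew, fun i =>
    ∑ j, (W ^ t) i j • s.2 j + rgrad (f i) (xnew i) - rgrad (f i) (s.1 i))

/-- The iterates `(x_k, y_k)`, started from `x_0` and `y_{i,0} = grad f_i(x_{i,0})`. -/
def iterate {n d r : ℕ} (W : Matrix (Fin n) (Fin n) ℝ) (t : ℕ) (α β : ℝ)
    (f : Fin n → Mat d r → ℝ) (x₀ : Fin n → Mat d r) :
    ℕ → (Fin n → Mat d r) × (Fin n → Mat d r)
  | 0 => (x₀, fun i => rgrad (f i) (x₀ i))
  | k + 1 => step W t α β f (iterate W t α β f x₀ k)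

/-- The global objective `f = (1/n) ∑ᵢ fᵢ`. -/
def objective {n d r : ℕ} (f : Fin n → Mat d r → ℝ) (x : Mat d r) : ℝ :=
  (1 / (n : ℝ)) * ∑ i, f i x

/-- `f* = min_{St(d,r)} f`. -/
def optValue {n d r : ℕ} (f : Fin n → Mat d r → ℝ) : ℝ :=
  sInf (objective f '' stiefel d r)

/-! ### Constants (the second-order constant of the polar retraction is `M = 1`) -/

/-- `L_t = 1 - λ_n(Wᵗ)`. -/
def Lt {n : ℕ} (W : Matrix (Fin n) (Fin n) ℝ) (t : ℕ) : ℝ :=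
  1 - sortedEigenvalue (W ^ t) (n - 1)

/-- `Φ = 2 - δ₂²`. -/
def Phi (δ₂ : ℝ) : ℝ := 2 - δ₂ ^ 2

/-- `γ_t = (1 - 4 r δ₁²) (1 - δ₂²/2) μ_t`, where `μ_t = 1 - λ₂(Wᵗ)`. -/
def gammaT {n : ℕ} (W : Matrix (Fin n) (Fin n) ℝ) (t r : ℕ) (δ₁ δ₂ : ℝ) : ℝ :=
  (1 - 4 * r * δ₁ ^ 2) * (1 - δ₂ ^ 2 / 2) * (1 - sortedEigenvalue (W ^ t) 1)

/-- `ρ_t = √(1 - γ_t α)`. -/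
def rhoT {n : ℕ} (W : Matrix (Fin n) (Fin n) ℝ) (t r : ℕ) (δ₁ δ₂ α : ℝ) : ℝ :=
  √(1 - gammaT W t r δ₁ δ₂ * α)

/-- `C̃₀`, as a function of `ρ = ρ_t`. -/
def Ct₀ (ρ : ℝ) : ℝ := 2 / (1 - ρ) ^ 2

/-- `C̃₁`, as a function of `ρ = ρ_t` and `e = (1/n) ‖x_0 - x̄_0‖²`. -/
def Ct₁ (ρ e : ℝ) : ℝ := 2 / (1 - ρ ^ 2) * e

/-- `C̃₂`, as a function of `s = σ₂ᵗ`. -/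
def Ct₂ (s : ℝ) : ℝ := 2 / (1 - s) ^ 2

/-- `C̃₃`, as a function of `s = σ₂ᵗ` and `q = (1/n) ‖y_0 - 1 ⊗ ĝ_0‖²`. -/
def Ct₃ (s q : ℝ) : ℝ := 2 / (1 - s ^ 2) * q

/-- `C̃₄`. -/
def Ct₄ (ρ s e q α β LG : ℝ) : ℝ :=
  (8 * α ^ 2 * Ct₁ ρ e * Ct₂ s * LG ^ 2 + Ct₃ s q) * (β / 2)

/-- `𝒢₀`. -/
def G₀ (r : ℕ) (LG D C₁ : ℝ) : ℝ := 4 * r * (LG + 2 * D) ^ 2 * C₁ / LG ^ 2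

/-- `𝒢₁`. -/
def G₁ (r : ℕ) (LG D C₁ α δ₁ : ℝ) : ℝ :=
  1 + G₀ r LG D C₁ + (2 * D * α + 8 * D * α ^ 2) / LG + 13 * C₁ * δ₁ ^ 2 * α ^ 4

/-- `𝒢₂`. -/
def G₂ (LG D δ₁ : ℝ) : ℝ := 2 * D / LG + δ₁ ^ 2 / 2 + 5

/-- `𝒢₃`. -/
def G₃ (r : ℕ) (LG D C₁ α δ₁ ρ : ℝ) : ℝ :=
  G₁ r LG D C₁ α δ₁ * Ct₀ ρ + G₀ r LG D C₁ * Ct₀ ρ + G₂ LG D δ₁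

/-- `𝒢₄`. -/
def G₄ (r : ℕ) (LG D C₁ α δ₁ ρ e : ℝ) : ℝ :=
  G₀ r LG D C₁ * Ct₀ ρ * δ₁ ^ 2 * α ^ 2 / 25
    + Ct₁ ρ e * (G₁ r LG D C₁ α δ₁ + 4 * r * C₁)

/-- The upper bound on the stepsize `β`. -/
def betaMax (r : ℕ) (LG D C₁ α δ₁ ρ s : ℝ) : ℝ :=
  min (min ((1 - ρ) * δ₁ / (LG + 2 * D)) (α * δ₁ / (5 * (LG + 2 * D))))
    (min (1 / (8 * LG))
      (1 / (4 * LG * (2 * G₃ r LG D C₁ α δ₁ ρ + (8 * Ct₀ ρ + 1 / 2 * Ct₂ s) * α * δ₁))))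

end DRGTA

end

/-!
The consensus error `E = (1/n) ∑ᵢ ‖xᵢ - x̄‖²`, the tracking error `Q = (1/n) ∑ᵢ ‖yᵢ - ŷ‖²` and the
objective `f(x̄)` satisfy a coupled system of recursions driven by `Y = (1/n) ∑ᵢ ‖yᵢ‖²`; summing it,
the negative multiple of `Y` in the descent of `f` absorbs every feedback term. The constant `c = 1`
suffices.

*Geometry.* For a tangent vector `ξ` the polar retraction is nonexpansive towards the Stiefel
manifold, `‖R_x(ξ) - z‖ ≤ ‖x + ξ - z‖` (`norm_polarRetraction_sub_le`), and agrees with `x + ξ` to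
second order (`norm_polarRetraction_sub_add_le`). Testing the minimality of an induced mean `x̄`
against a retraction shows that the Euclidean mean has no tangential component at `x̄`
(`tangentProj_mean_eq_zero`). Hence the Euclidean mean is `x̄ H` with `H` symmetric and close to the
identity, so that it is at distance `O(E)` from `x̄` (`norm_mean_sub_iam_le`), and `x̄` is a
Lipschitz function of it (`norm_iam_sub_le`).

*Contraction.* On the local region the consensus potential satisfies a restricted secant inequality
(`le_sum_inner_consensusDir`), from which a consensus step contracts by the factor `ρ` towards `x̄`
(`consensus_contraction`); mixing contracts the deviations of the trackers by `s = σ₂ᵗ`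
(`sum_norm_mix_pow_sq_le`). Young's inequality with weights `ρ`, `1 - ρ` and `s`, `1 - s` turns
these into `E⁺ ≤ ρ E + β² Y / (1 - ρ)` and a similar recursion for `Q`, with no square roots
(`meanSqDist_nextPoint_le`, `tracking_le`).

*Invariance.* Since `s ≤ 1 / (2 √n)`, every mixed deviation is at most half the quadratic mean of
the deviations (`norm_mix_dev_le`). With the bounds on `β` this keeps the points in the local region
and the trackers bounded by `LG + 2 D` (`invariant_next`), so the one-step estimates apply
throughout.

*Descent.* The induced mean moves along `-β ŷ` up to terms of second order, and
`⟨g, ŷ⟩ = (‖g‖² + ‖ŷ‖² - ‖g - ŷ‖²) / 2` with `‖ŷ‖² = Y - Q` gives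
`f(x̄⁺) ≤ f(x̄) - β/2 ‖g‖² - β/2 Y + β/2 Q + O(E + E⁺ + β² Y)`, where `g = grad f(x̄)`
(`objective_le`). Summation with the above recursions, under the remaining conditions on `β`, leaves
`β/2 ∑ ‖g‖² + β/4 ∑ Y` bounded by a constant (`summed_descent`), and the smallest term of a sum is
at most its average.
-/

noncomputable section

namespace DRGTA

/-! ### The Frobenius inner product -/

/-- The inner product `⟨A, B⟩ = tr (Aᵀ B)` inducing the Frobenius norm. -/
@[reducible]
def frobeniusInner (m n : ℕ) : InnerProductSpace ℝ (Matrix (Fin m) (Fin n) ℝ) where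
  inner A B := (Aᵀ * B).trace
  norm_sq_eq_re_inner A := by
    rw [Matrix.frobenius_norm_def, ← Real.sqrt_eq_rpow, Real.sq_sqrt (by positivity)]
    simp only [Matrix.trace, Matrix.diag, Matrix.mul_apply, Matrix.transpose_apply]
    rw [Finset.sum_comm]
    simp [sq]
  conj_inner_symm A B := by
    simp only [conj_trivial]
    rw [← Matrix.trace_transpose, Matrix.transpose_mul, Matrix.transpose_transpose]
  add_left A B C := by simp [Matrix.add_mul]
  smul_left A B c := by simp

attribute [local instance] frobeniusInner

section Frobenius

variable {m n p : ℕ}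

lemma inner_eq_trace (A B : Matrix (Fin m) (Fin n) ℝ) : inner ℝ A B = (Aᵀ * B).trace := rfl

lemma inner_mul_left (X : Matrix (Fin m) (Fin n) ℝ) (S : Matrix (Fin n) (Fin p) ℝ)
    (B : Matrix (Fin m) (Fin p) ℝ) : inner ℝ (X * S) B = inner ℝ S (Xᵀ * B) := by
  simp only [inner_eq_trace, Matrix.transpose_mul, Matrix.mul_assoc]

lemma inner_mul_right (X : Matrix (Fin m) (Fin n) ℝ) (S : Matrix (Fin n) (Fin p) ℝ)
    (B : Matrix (Fin m) (Fin p) ℝ) : inner ℝ (X * S) B = inner ℝ X (B * Sᵀ) := by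
  simp only [inner_eq_trace, Matrix.transpose_mul]
  rw [Matrix.mul_assoc, Matrix.trace_mul_comm, Matrix.mul_assoc]

lemma inner_transpose (A B : Matrix (Fin m) (Fin n) ℝ) :
    inner ℝ Aᵀ Bᵀ = inner ℝ A B := by
  simp only [inner_eq_trace, Matrix.transpose_transpose]
  rw [← Matrix.trace_transpose, Matrix.transpose_mul, Matrix.transpose_transpose,
    Matrix.trace_mul_comm]

lemma norm_transpose_eq (A : Matrix (Fin m) (Fin n) ℝ) : ‖Aᵀ‖ = ‖A‖ :=
  Matrix.frobenius_norm_transpose A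

/-- A symmetric and an antisymmetric matrix are orthogonal. -/
lemma inner_eq_zero_of_antisymm {A S : Matrix (Fin n) (Fin n) ℝ} (hA : A + Aᵀ = 0)
    (hS : Sᵀ = S) : inner ℝ A S = 0 := by
  have h1 : inner ℝ A S = inner ℝ Aᵀ S := by
    rw [← inner_transpose, hS]
  have h2 : inner ℝ (A + Aᵀ) S = 0 := by rw [hA, inner_zero_left]
  rw [inner_add_left, ← h1] at h2
  linarith

lemma norm_le_of_sq_le {E : Type*} [NormedAddCommGroup E] [InnerProductSpace ℝ E] {a b : E}
    (h : ‖a‖ ^ 2 ≤ inner ℝ b a) : ‖a‖ ≤ ‖b‖ := by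
  have h1 := real_inner_le_norm b a
  rcases eq_or_lt_of_le (norm_nonneg a) with h0 | h0
  · rw [← h0]; exact norm_nonneg b
  · nlinarith

section Stiefel

variable {x z : Matrix (Fin m) (Fin n) ℝ}

lemma norm_stiefel_mul (hx : x ∈ stiefel m n) (B : Matrix (Fin n) (Fin p) ℝ) :
    ‖x * B‖ = ‖B‖ := by
  have h : ‖x * B‖ ^ 2 = ‖B‖ ^ 2 := by
    rw [← real_inner_self_eq_norm_sq, ← real_inner_self_eq_norm_sq, inner_mul_left,
      ← Matrix.mul_assoc, show xᵀ * x = 1 from hx, Matrix.one_mul]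
  exact (pow_left_inj₀ (norm_nonneg _) (norm_nonneg _) two_ne_zero).1 h

lemma norm_mul_stiefel_transpose (hx : x ∈ stiefel m n) (B : Matrix (Fin p) (Fin n) ℝ) :
    ‖B * xᵀ‖ = ‖B‖ := by
  rw [← norm_transpose_eq, Matrix.transpose_mul, Matrix.transpose_transpose,
    norm_stiefel_mul hx, norm_transpose_eq]

lemma norm_stiefel_transpose_mul_le (hx : x ∈ stiefel m n) (B : Matrix (Fin m) (Fin p) ℝ) :
    ‖xᵀ * B‖ ≤ ‖B‖ := by
  rw [← norm_stiefel_mul hx (xᵀ * B)]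
  refine norm_le_of_sq_le (le_of_eq ?_)
  rw [norm_stiefel_mul hx, real_inner_comm, inner_mul_left, real_inner_self_eq_norm_sq]

lemma norm_mul_stiefel_le (hx : x ∈ stiefel m n) (B : Matrix (Fin p) (Fin m) ℝ) :
    ‖B * x‖ ≤ ‖B‖ := by
  rw [← norm_transpose_eq, Matrix.transpose_mul, ← norm_transpose_eq B]
  exact norm_stiefel_transpose_mul_le hx _

lemma sub_transpose_mul_sub (hx : x ∈ stiefel m n) (hz : z ∈ stiefel m n) :
    (x - z)ᵀ * (x - z) = (2 : ℝ) • 1 - (xᵀ * z + zᵀ * x) := by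
  have h1 : xᵀ * x = 1 := hx
  have h2 : zᵀ * z = 1 := hz
  rw [Matrix.transpose_sub, Matrix.sub_mul, Matrix.mul_sub, Matrix.mul_sub, h1, h2, two_smul]
  abel

/-- For `x, z` on the Stiefel manifold and `S` symmetric, `⟨x - z, x S⟩` is of second order in
`x - z`. -/
lemma inner_sub_stiefel_mul (hx : x ∈ stiefel m n) (hz : z ∈ stiefel m n)
    {S : Matrix (Fin n) (Fin n) ℝ} (hS : Sᵀ = S) :
    inner ℝ (x - z) (x * S) = 1 / 2 * inner ℝ ((x - z)ᵀ * (x - z)) S := by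
  have h1 : xᵀ * x = 1 := hx
  have h2 : inner ℝ (zᵀ * x) S = inner ℝ (xᵀ * z) S := by
    rw [← inner_transpose, hS, Matrix.transpose_mul, Matrix.transpose_transpose]
  have h3 : inner ℝ (x - z) (x * S) = inner ℝ (1 - xᵀ * z) S := by
    rw [real_inner_comm, inner_mul_left, Matrix.mul_sub, h1, real_inner_comm]
  rw [h3, sub_transpose_mul_sub hx hz, inner_sub_left, inner_sub_left, inner_add_left, h2,
    real_inner_smul_left]
  ring

lemma norm_transpose_mul_self_le (B : Matrix (Fin m) (Fin n) ℝ) : ‖Bᵀ * B‖ ≤ ‖B‖ ^ 2 := by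
  refine (Matrix.frobenius_norm_mul _ _).trans ?_
  rw [norm_transpose_eq, sq]

end Stiefel

/-! ### The spectral norm -/

lemma specNorm_nonneg (A : Mat m n) : 0 ≤ specNorm A := norm_nonneg _

lemma norm_sq_eq_sum_col (A : Matrix (Fin m) (Fin n) ℝ) :
    ‖A‖ ^ 2 = ∑ j, ‖WithLp.toLp 2 (A.col j)‖ ^ 2 := by
  rw [Matrix.frobenius_norm_def, ← Real.sqrt_eq_rpow, Real.sq_sqrt (by positivity),
    Finset.sum_comm]
  refine Finset.sum_congr rfl fun j _ => ?_
  rw [EuclideanSpace.norm_sq_eq]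
  simp

lemma norm_mulVec_le_specNorm (A : Mat m n) (v : Fin n → ℝ) :
    ‖WithLp.toLp 2 (A *ᵥ v)‖ ≤ specNorm A * ‖WithLp.toLp 2 v‖ :=
  (LinearMap.toContinuousLinearMap (Matrix.toEuclideanLin A)).le_opNorm (WithLp.toLp 2 v)

lemma norm_mul_le_specNorm (A : Mat m n) (B : Matrix (Fin n) (Fin p) ℝ) :
    ‖A * B‖ ≤ specNorm A * ‖B‖ := by
  refine le_of_sq_le_sq ?_ (mul_nonneg (specNorm_nonneg A) (norm_nonneg _))
  rw [mul_pow, norm_sq_eq_sum_col, norm_sq_eq_sum_col, Finset.mul_sum]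
  refine Finset.sum_le_sum fun j _ => ?_
  rw [← mul_pow]
  exact pow_le_pow_left₀ (norm_nonneg _) (norm_mulVec_le_specNorm A (B.col j)) 2

/-- A matrix and its transpose have the same spectral norm; only this inequality is needed. -/
lemma norm_transpose_mul_le_specNorm (A : Mat m n) (B : Matrix (Fin m) (Fin p) ℝ) :
    ‖Aᵀ * B‖ ≤ specNorm A * ‖B‖ := by
  have h1 : ‖Aᵀ * B‖ ^ 2 = inner ℝ B (A * (Aᵀ * B)) := by
    rw [← real_inner_self_eq_norm_sq, inner_mul_left, Matrix.transpose_transpose]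
  have h2 := real_inner_le_norm B (A * (Aᵀ * B))
  have h3 := norm_mul_le_specNorm A (Aᵀ * B)
  have h4 := mul_le_mul_of_nonneg_left h3 (norm_nonneg B)
  rcases eq_or_lt_of_le (norm_nonneg (Aᵀ * B)) with h0 | h0
  · rw [← h0]; exact mul_nonneg (specNorm_nonneg A) (norm_nonneg _)
  · nlinarith

lemma norm_mul_le_specNorm_right (A : Mat m n) (B : Matrix (Fin p) (Fin m) ℝ) :
    ‖B * A‖ ≤ specNorm A * ‖B‖ := by
  rw [← norm_transpose_eq, Matrix.transpose_mul, ← norm_transpose_eq B]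
  exact norm_transpose_mul_le_specNorm A _

lemma specNorm_le_norm (A : Mat m n) : specNorm A ≤ ‖A‖ := by
  refine ContinuousLinearMap.opNorm_le_bound _ (norm_nonneg _) fun v => ?_
  have h := Matrix.frobenius_norm_mul A (Matrix.replicateCol (Fin 1) v.ofLp)
  have h1 : ∀ {k : ℕ} (w : Fin k → ℝ), ‖Matrix.replicateCol (Fin 1) w‖ = ‖WithLp.toLp 2 w‖ := by
    intro k w
    refine (pow_left_inj₀ (norm_nonneg _) (norm_nonneg _) two_ne_zero).1 ?_
    rw [norm_sq_eq_sum_col]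
    simp only [Finset.univ_unique, Finset.sum_singleton]
    rfl
  rw [← Matrix.replicateCol_mulVec, h1, h1] at h
  exact h

end Frobenius

/-! ### The tangent projection -/

section TangentProj

variable {d r : ℕ} {x z : Mat d r}

lemma tangentProj_add (x u v : Mat d r) :
    tangentProj x (u + v) = tangentProj x u + tangentProj x v := by
  simp only [tangentProj, Matrix.mul_add, Matrix.add_mul, Matrix.transpose_add, smul_add]
  abel

lemma tangentProj_smul (x : Mat d r) (c : ℝ) (v : Mat d r) :
    tangentProj x (c • v) = c • tangentProj x v := by
  simp only [tangentProj, Matrix.mul_add, Matrix.mul_smul, Matrix.smul_mul, Matrix.transpose_smul,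
    smul_add, smul_sub]
  simp only [smul_smul, mul_comm]

/-- The tangent projection as a linear map. -/
def tangentProjₗ (x : Mat d r) : Mat d r →ₗ[ℝ] Mat d r where
  toFun := tangentProj x
  map_add' := tangentProj_add x
  map_smul' := tangentProj_smul x

lemma tangentProj_sub (x u v : Mat d r) :
    tangentProj x (u - v) = tangentProj x u - tangentProj x v := (tangentProjₗ x).map_sub u v

lemma tangentProj_sum {ι : Type*} (s : Finset ι) (x : Mat d r) (v : ι → Mat d r) :
    tangentProj x (∑ i ∈ s, v i) = ∑ i ∈ s, tangentProj x (v i) := map_sum (tangentProjₗ x) v s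

/-- Tangency of `z` at `x` is expressed as the vanishing of the symmetric matrix `xᵀ z + zᵀ x`. -/
lemma tangency_symm (x z : Mat d r) : (xᵀ * z + zᵀ * x)ᵀ = xᵀ * z + zᵀ * x := by
  rw [Matrix.transpose_add, Matrix.transpose_mul, Matrix.transpose_mul,
    Matrix.transpose_transpose, Matrix.transpose_transpose, add_comm]

lemma tangentProj_tangent (hx : x ∈ stiefel d r) (z : Mat d r) :
    xᵀ * tangentProj x z + (tangentProj x z)ᵀ * x = 0 := by
  have h1 : xᵀ * x = 1 := hx
  have h2 : xᵀ * tangentProj x z = xᵀ * z - (1 / 2 : ℝ) • (xᵀ * z + zᵀ * x) := by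
    rw [tangentProj, Matrix.mul_sub, Matrix.mul_smul, ← Matrix.mul_assoc, h1, Matrix.one_mul]
  have h3 : (tangentProj x z)ᵀ * x = (xᵀ * tangentProj x z)ᵀ := by
    rw [Matrix.transpose_mul, Matrix.transpose_transpose]
  rw [h3, h2, Matrix.transpose_sub, Matrix.transpose_smul, tangency_symm, Matrix.transpose_mul,
    Matrix.transpose_transpose]
  module

lemma tangentProj_eq_self (h : xᵀ * z + zᵀ * x = 0) : tangentProj x z = z := by
  rw [tangentProj, h, Matrix.mul_zero, smul_zero, sub_zero]

/-- Tangent vectors are orthogonal to the normal vectors `x S` with `S` symmetric. -/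
lemma inner_tangent_mul (h : xᵀ * z + zᵀ * x = 0) {S : Matrix (Fin r) (Fin r) ℝ}
    (hS : Sᵀ = S) : inner ℝ z (x * S) = 0 := by
  rw [real_inner_comm, inner_mul_left, real_inner_comm]
  refine inner_eq_zero_of_antisymm ?_ hS
  rw [Matrix.transpose_mul, Matrix.transpose_transpose, h]

lemma inner_tangentProj_normal (hx : x ∈ stiefel d r) (u v : Mat d r) :
    inner ℝ (tangentProj x u) (v - tangentProj x v) = 0 := by
  have h : v - tangentProj x v = (1 / 2 : ℝ) • (x * (xᵀ * v + vᵀ * x)) := by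
    rw [tangentProj, sub_sub_cancel]
  rw [h, inner_smul_right,
    inner_tangent_mul (tangentProj_tangent hx u) (tangency_symm x v), mul_zero]

lemma inner_tangentProj_left (hx : x ∈ stiefel d r) (u v : Mat d r) :
    inner ℝ (tangentProj x u) v = inner ℝ (tangentProj x u) (tangentProj x v) := by
  have h := inner_tangentProj_normal hx u v
  rw [inner_sub_right] at h
  linarith

lemma inner_tangentProj_comm (hx : x ∈ stiefel d r) (u v : Mat d r) :
    inner ℝ (tangentProj x u) v = inner ℝ u (tangentProj x v) := by
  rw [inner_tangentProj_left hx, ← real_inner_comm, ← inner_tangentProj_left hx, real_inner_comm]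

lemma norm_tangentProj_le (hx : x ∈ stiefel d r) (z : Mat d r) : ‖tangentProj x z‖ ≤ ‖z‖ := by
  refine norm_le_of_sq_le (le_of_eq ?_)
  rw [← real_inner_self_eq_norm_sq, ← inner_tangentProj_left hx, real_inner_comm]

/-- The tangent projection depends on the base point in a Lipschitz way, with a constant given by
the spectral norm of the projected matrix. -/
lemma norm_tangentProj_sub_le {y : Mat d r} (hx : x ∈ stiefel d r) (hy : y ∈ stiefel d r)
    (z : Mat d r) : ‖tangentProj x z - tangentProj y z‖ ≤ 2 * specNorm z * ‖x - y‖ := by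
  have h : tangentProj x z - tangentProj y z = -((1 / 2 : ℝ) •
      ((x - y) * xᵀ * z + (x - y) * zᵀ * x + y * ((x - y)ᵀ * z) + y * (zᵀ * (x - y)))) := by
    simp only [tangentProj, Matrix.mul_add, Matrix.transpose_sub, Matrix.mul_sub, Matrix.sub_mul,
      Matrix.mul_assoc]
    module
  have h1 : ‖(x - y) * xᵀ * z‖ ≤ specNorm z * ‖x - y‖ := by
    refine (norm_mul_le_specNorm_right _ _).trans_eq ?_
    rw [norm_mul_stiefel_transpose hx]
  have h2 : ‖(x - y) * zᵀ * x‖ ≤ specNorm z * ‖x - y‖ := by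
    refine (norm_mul_stiefel_le hx _).trans ?_
    rw [← norm_transpose_eq, Matrix.transpose_mul, Matrix.transpose_transpose,
      ← norm_transpose_eq (x - y)]
    exact norm_mul_le_specNorm _ _
  have h3 : ‖y * ((x - y)ᵀ * z)‖ ≤ specNorm z * ‖x - y‖ := by
    rw [norm_stiefel_mul hy, ← norm_transpose_eq (x - y)]
    exact norm_mul_le_specNorm_right _ _
  have h4 : ‖y * (zᵀ * (x - y))‖ ≤ specNorm z * ‖x - y‖ := by
    rw [norm_stiefel_mul hy]
    exact norm_transpose_mul_le_specNorm _ _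
  rw [h, norm_neg, norm_smul, Real.norm_of_nonneg (by norm_num)]
  have h5 := norm_add₄_le (a := (x - y) * xᵀ * z) (b := (x - y) * zᵀ * x)
    (c := y * ((x - y)ᵀ * z)) (d := y * (zᵀ * (x - y)))
  linarith

end TangentProj

/-! ### The polar retraction -/

section Retraction

variable {d r : ℕ} {x ξ : Mat d r}

lemma posDef_one_add_transpose_mul_self (ξ : Mat d r) : (1 + ξᵀ * ξ).PosDef := by
  have h := Matrix.posSemidef_conjTranspose_mul_self ξ
  rw [Matrix.conjTranspose_eq_transpose_of_trivial] at h
  exact Matrix.PosDef.one.add_posSemidef h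

/-- The polar factor `H = (1 + ξᵀ ξ)^(1/2)` exceeds the identity by a positive semidefinite matrix
`K`, which satisfies `K² + 2 K = ξᵀ ξ`. -/
lemma exists_sqrt_eq_one_add (ξ : Mat d r) : ∃ K : Matrix (Fin r) (Fin r) ℝ,
    K.PosSemidef ∧ CFC.sqrt (1 + ξᵀ * ξ) = 1 + K ∧ IsUnit (1 + K) ∧
      K * K + (2 : ℝ) • K = ξᵀ * ξ := by
  set H := CFC.sqrt (1 + ξᵀ * ξ) with hH
  have hP := posDef_one_add_transpose_mul_self ξ
  have hnn : (0 : Matrix (Fin r) (Fin r) ℝ) ≤ 1 + ξᵀ * ξ := hP.posSemidef.nonneg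
  have hHH : H * H = 1 + ξᵀ * ξ := CFC.sqrt_mul_sqrt_self _ hnn
  have hHp : H.PosSemidef := Matrix.nonneg_iff_posSemidef.1 (CFC.sqrt_nonneg (1 + ξᵀ * ξ))
  have hunit : IsUnit H := by
    have h1 : IsUnit (H * H) := by rw [hHH]; exact hP.isUnit
    exact isUnit_of_mul_isUnit_left h1
  have hherm : (H - 1).IsHermitian := hHp.1.sub Matrix.isHermitian_one
  refine ⟨H - 1, ?_, by abel, by rwa [add_sub_cancel], ?_⟩
  · rw [hherm.posSemidef_iff_eigenvalues_nonneg]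
    intro i
    have hv := hherm.mulVec_eigenvectorBasis i
    set v : Fin r → ℝ := ⇑(hherm.eigenvectorBasis i) with hvdef
    set μ := hherm.eigenvalues i
    have hvv : v ⬝ᵥ v = 1 := by
      have h1 : ‖hherm.eigenvectorBasis i‖ = 1 := hherm.eigenvectorBasis.orthonormal.1 i
      have h2 := EuclideanSpace.real_norm_sq_eq (hherm.eigenvectorBasis i)
      rw [h1] at h2
      simp only [dotProduct, ← sq]
      rw [one_pow] at h2
      exact h2.symm
    have hHv : H *ᵥ v = (1 + μ) • v := by
      rw [Matrix.sub_mulVec, Matrix.one_mulVec] at hv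
      rw [add_smul, one_smul, ← hv]; abel
    have h1 : 0 ≤ 1 + μ := by
      have := hHp.dotProduct_mulVec_nonneg v
      rw [hHv, dotProduct_smul, star_trivial, hvv] at this
      simpa using this
    have h2 : (1 + μ) * (1 + μ) = 1 + (ξ *ᵥ v) ⬝ᵥ (ξ *ᵥ v) := by
      have h3 : v ⬝ᵥ ((H * H) *ᵥ v) = (1 + μ) * (1 + μ) := by
        rw [← Matrix.mulVec_mulVec, hHv, Matrix.mulVec_smul, hHv, dotProduct_smul, dotProduct_smul,
          hvv]
        simp
      rw [← h3, hHH, Matrix.add_mulVec, Matrix.one_mulVec, dotProduct_add, hvv,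
        ← Matrix.mulVec_mulVec, Matrix.dotProduct_mulVec, Matrix.vecMul_transpose]
    have h3 : 0 ≤ (ξ *ᵥ v) ⬝ᵥ (ξ *ᵥ v) := by
      simp only [dotProduct]
      exact Finset.sum_nonneg fun _ _ => mul_self_nonneg _
    simp only [Pi.zero_apply]
    nlinarith
  · rw [Matrix.sub_mul, Matrix.mul_sub, Matrix.mul_sub, hHH]
    simp only [Matrix.mul_one, Matrix.one_mul]
    module

/-- The polar decomposition `x + ξ = R_x(ξ) (1 + K)` of a point moved in a tangent direction. -/
lemma exists_polar (hx : x ∈ stiefel d r) (hξ : xᵀ * ξ + ξᵀ * x = 0) :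
    ∃ K : Matrix (Fin r) (Fin r) ℝ, K.PosSemidef ∧ Kᵀ = K ∧ K * K + (2 : ℝ) • K = ξᵀ * ξ ∧
      polarRetraction x ξ ∈ stiefel d r ∧
      x + ξ = polarRetraction x ξ + polarRetraction x ξ * K := by
  obtain ⟨K, hK, hsq, hu, hKK⟩ := exists_sqrt_eq_one_add ξ
  have hKt : Kᵀ = K := by
    have := hK.1
    rwa [Matrix.IsHermitian, Matrix.conjTranspose_eq_transpose_of_trivial] at this
  have hdet := (Matrix.isUnit_iff_isUnit_det _).1 hu
  have hR : polarRetraction x ξ = (x + ξ) * (1 + K)⁻¹ := by rw [polarRetraction, hsq]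
  have hgram : (x + ξ)ᵀ * (x + ξ) = (1 + K) * (1 + K) := by
    have h1 : xᵀ * x = 1 := hx
    have h2 : (x + ξ)ᵀ * (x + ξ) = 1 + (xᵀ * ξ + ξᵀ * x) + ξᵀ * ξ := by
      rw [Matrix.transpose_add, Matrix.add_mul, Matrix.mul_add, Matrix.mul_add, h1]; abel
    rw [h2, hξ, ← hKK, Matrix.add_mul, Matrix.mul_add, Matrix.mul_add]
    simp only [Matrix.mul_one, Matrix.one_mul]
    module
  refine ⟨K, hK, hKt, hKK, ?_, ?_⟩
  · rw [hR]
    change ((x + ξ) * (1 + K)⁻¹)ᵀ * ((x + ξ) * (1 + K)⁻¹) = 1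
    have h3 : ((1 + K)⁻¹)ᵀ = (1 + K)⁻¹ := by
      rw [Matrix.transpose_nonsing_inv, Matrix.transpose_add, Matrix.transpose_one, hKt]
    rw [Matrix.transpose_mul, h3, Matrix.mul_assoc, ← Matrix.mul_assoc (x + ξ)ᵀ, hgram,
      Matrix.mul_assoc, Matrix.mul_nonsing_inv _ hdet, Matrix.mul_one,
      Matrix.nonsing_inv_mul _ hdet]
  · have h4 : polarRetraction x ξ + polarRetraction x ξ * K = polarRetraction x ξ * (1 + K) := by
      rw [Matrix.mul_add, Matrix.mul_one]
    rw [h4, hR, Matrix.mul_assoc, Matrix.nonsing_inv_mul _ hdet, Matrix.mul_one]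

lemma polarRetraction_mem (hx : x ∈ stiefel d r) (hξ : xᵀ * ξ + ξᵀ * x = 0) :
    polarRetraction x ξ ∈ stiefel d r := by
  obtain ⟨K, _, _, _, h, _⟩ := exists_polar hx hξ
  exact h

/-- Retracting `x + ξ` does not increase its distance to any point of the Stiefel manifold, because
`x + ξ - R_x(ξ) = R_x(ξ) K` with `K` positive semidefinite. -/
lemma norm_polarRetraction_sub_le {z : Mat d r} (hx : x ∈ stiefel d r)
    (hξ : xᵀ * ξ + ξᵀ * x = 0) (hz : z ∈ stiefel d r) :
    ‖polarRetraction x ξ - z‖ ≤ ‖x + ξ - z‖ := by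
  obtain ⟨K, hK, hKt, _, hU, hdec⟩ := exists_polar hx hξ
  set U := polarRetraction x ξ with hUdef
  obtain ⟨B, hB⟩ := CStarAlgebra.nonneg_iff_eq_star_mul_self.1 hK.nonneg
  rw [Matrix.star_eq_conjTranspose, Matrix.conjTranspose_eq_transpose_of_trivial] at hB
  -- `⟨U - z, U K⟩ ≥ 0`: with `K = Bᵀ B` it equals `‖Bᵀ‖² - ⟨z Bᵀ, U Bᵀ⟩`.
  have hsplit : ∀ w : Mat d r, inner ℝ w (U * K) = inner ℝ (w * Bᵀ) (U * Bᵀ) := by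
    intro w
    rw [inner_mul_right, Matrix.transpose_transpose, Matrix.mul_assoc, ← hB]
  have hnonneg : 0 ≤ inner ℝ (U - z) (U * K) := by
    rw [inner_sub_left, hsplit, hsplit, real_inner_self_eq_norm_sq]
    have h1 := real_inner_le_norm (z * Bᵀ) (U * Bᵀ)
    rw [norm_stiefel_mul hz, norm_stiefel_mul hU] at h1
    rw [norm_stiefel_mul hU]
    nlinarith
  have h2 : x + ξ - z = (U - z) + U * K := by rw [hdec]; abel
  have h3 := norm_add_sq_real (U - z) (U * K)
  rw [← h2] at h3
  refine le_of_sq_le_sq ?_ (norm_nonneg _)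
  nlinarith [sq_nonneg ‖U * K‖]

lemma norm_polarRetraction_sub_self_le (hx : x ∈ stiefel d r) (hξ : xᵀ * ξ + ξᵀ * x = 0) :
    ‖polarRetraction x ξ - x‖ ≤ ‖ξ‖ := by
  have h := norm_polarRetraction_sub_le hx hξ hx
  rwa [add_sub_cancel_left] at h

/-- The polar retraction agrees with `x + ξ` up to second order. -/
lemma norm_polarRetraction_sub_add_le (hx : x ∈ stiefel d r) (hξ : xᵀ * ξ + ξᵀ * x = 0) :
    ‖polarRetraction x ξ - x - ξ‖ ≤ 1 / 2 * ‖ξ‖ ^ 2 := by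
  obtain ⟨K, hK, hKt, hKK, hU, hdec⟩ := exists_polar hx hξ
  have h1 : polarRetraction x ξ - x - ξ = -(polarRetraction x ξ * K) := by
    rw [sub_sub, hdec]; abel
  rw [h1, norm_neg, norm_stiefel_mul hU]
  have h2 : 0 ≤ inner ℝ (K * K) K := by
    have h3 := (hK.conjTranspose_mul_mul_same K).trace_nonneg
    rw [hK.1] at h3
    rw [inner_eq_trace, Matrix.transpose_mul, hKt]
    exact h3
  have h4 := norm_add_sq_real (K * K) ((2 : ℝ) • K)
  rw [inner_smul_right, hKK, norm_smul, Real.norm_of_nonneg (by norm_num)] at h4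
  have h5 : ‖K‖ * 2 ≤ ‖ξᵀ * ξ‖ := by
    refine le_of_sq_le_sq ?_ (norm_nonneg _)
    nlinarith [sq_nonneg ‖K * K‖]
  have h6 := norm_transpose_mul_self_le ξ
  linarith

end Retraction

/-! ### Averages -/

section Mean

variable {n d r : ℕ}

lemma smul_mean (hn : n ≠ 0) (x : Fin n → Mat d r) : (n : ℝ) • mean x = ∑ i, x i := by
  rw [mean, smul_smul, mul_one_div_cancel (by exact_mod_cast hn), one_smul]

lemma mean_sub (x y : Fin n → Mat d r) : mean (fun i => x i - y i) = mean x - mean y := by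
  simp only [mean, Finset.sum_sub_distrib, smul_sub]

lemma mean_add (x y : Fin n → Mat d r) : mean (fun i => x i + y i) = mean x + mean y := by
  simp only [mean, Finset.sum_add_distrib, smul_add]

lemma mean_smul (c : ℝ) (x : Fin n → Mat d r) : mean (fun i => c • x i) = c • mean x := by
  simp only [mean, ← Finset.smul_sum]
  rw [smul_comm]

lemma mean_const (hn : n ≠ 0) (z : Mat d r) : mean (fun _ : Fin n => z) = z := by
  rw [mean, Finset.sum_const, Finset.card_univ, Fintype.card_fin, ← Nat.cast_smul_eq_nsmul ℝ,
    smul_smul, one_div_mul_cancel (by exact_mod_cast hn), one_smul]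

lemma norm_mean_le (x : Fin n → Mat d r) : ‖mean x‖ ≤ (1 / (n : ℝ)) * ∑ i, ‖x i‖ := by
  rw [mean, norm_smul, Real.norm_of_nonneg (by positivity)]
  gcongr
  exact norm_sum_le _ _

lemma inner_mean (z : Mat d r) (x : Fin n → Mat d r) :
    inner ℝ z (mean x) = (1 / (n : ℝ)) * ∑ i, inner ℝ z (x i) := by
  rw [mean, inner_smul_right, inner_sum]

lemma mean_le_of_forall_le (hn : n ≠ 0) {a : Fin n → ℝ} {c : ℝ} (h : ∀ i, a i ≤ c) :
    (1 / (n : ℝ)) * ∑ i, a i ≤ c := by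
  have hn' : (0 : ℝ) < n := by exact_mod_cast Nat.pos_of_ne_zero hn
  have h1 : ∑ i, a i ≤ n * c := by
    refine (Finset.sum_le_sum fun i _ => h i).trans_eq ?_
    simp
  rw [one_div, inv_mul_le_iff₀ hn']
  exact h1

/-- The mean minimizes the sum of squared distances; the excess at another point is explicit. -/
lemma sqDist_eq_add (hn : n ≠ 0) (x : Fin n → Mat d r) (z : Mat d r) :
    sqDist x z = sqDist x (mean x) + n * ‖mean x - z‖ ^ 2 := by
  have h : ∀ i, ‖x i - z‖ ^ 2 =
      ‖x i - mean x‖ ^ 2 + 2 * inner ℝ (x i - mean x) (mean x - z) + ‖mean x - z‖ ^ 2 := by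
    intro i
    rw [← norm_add_sq_real, sub_add_sub_cancel]
  have h2 : ∑ i, (x i - mean x) = 0 := by
    rw [Finset.sum_sub_distrib, ← smul_mean hn x, Finset.sum_const, Finset.card_univ,
      Fintype.card_fin, Nat.cast_smul_eq_nsmul, sub_self]
  simp only [sqDist, h, Finset.sum_add_distrib, ← Finset.mul_sum, ← sum_inner, h2]
  simp

lemma sqDist_nonneg (x : Fin n → Mat d r) (z : Mat d r) : 0 ≤ sqDist x z :=
  Finset.sum_nonneg fun _ _ => sq_nonneg _

lemma norm_mean_sq_le (hn : n ≠ 0) (x : Fin n → Mat d r) :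
    ‖mean x‖ ^ 2 ≤ (1 / (n : ℝ)) * ∑ i, ‖x i‖ ^ 2 := by
  have hn' : (0 : ℝ) < n := by exact_mod_cast Nat.pos_of_ne_zero hn
  have h := sqDist_eq_add hn x 0
  have h1 := sqDist_nonneg x (mean x)
  simp only [sub_zero] at h
  have h2 : sqDist x 0 = ∑ i, ‖x i‖ ^ 2 := by simp [sqDist]
  rw [one_div, le_inv_mul_iff₀ hn', ← h2]
  linarith

end Mean

/-! ### Induced arithmetic means -/

section IAM

variable {n d r : ℕ} {x : Fin n → Mat d r} {xbar : Mat d r}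

/-- The mean, normalized by `1 / (2 n)`, of the Gram matrices of the deviations `xᵢ - z`. -/
def gramDefect (x : Fin n → Mat d r) (z : Mat d r) : Matrix (Fin r) (Fin r) ℝ :=
  (1 / 2 : ℝ) • mean fun i => (x i - z)ᵀ * (x i - z)

lemma gramDefect_transpose (x : Fin n → Mat d r) (z : Mat d r) :
    (gramDefect x z)ᵀ = gramDefect x z := by
  simp only [gramDefect, mean, Matrix.transpose_smul, Matrix.transpose_sum, Matrix.transpose_mul,
    Matrix.transpose_transpose]

lemma norm_gramDefect_le (x : Fin n → Mat d r) (z : Mat d r) :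
    ‖gramDefect x z‖ ≤ 1 / 2 * ((1 / (n : ℝ)) * sqDist x z) := by
  rw [gramDefect, norm_smul, Real.norm_of_nonneg (by norm_num)]
  refine mul_le_mul_of_nonneg_left ((norm_mean_le _).trans ?_) (by norm_num)
  exact mul_le_mul_of_nonneg_left (Finset.sum_le_sum fun i _ => norm_transpose_mul_self_le _)
    (by positivity)

/-- First-order optimality of an induced arithmetic mean `x̄`: the mean has no tangential component
at `x̄`. The competitor is the retraction of the tangential component itself, which the
nonexpansiveness of the retraction shows to be better unless that component vanishes. -/
lemma tangentProj_mean_eq_zero (hn : n ≠ 0) (hx : ∀ i, x i ∈ stiefel d r)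
    (h : IsIAM x xbar) : tangentProj xbar (mean x) = 0 := by
  have hn' : (0 : ℝ) < n := by exact_mod_cast Nat.pos_of_ne_zero hn
  set ξ := tangentProj xbar (mean x) with hξdef
  have hξ : xbarᵀ * ξ + ξᵀ * xbar = 0 := tangentProj_tangent h.1 _
  have h1 : sqDist x xbar ≤ ∑ i, ‖x i - (xbar + ξ)‖ ^ 2 := by
    refine (h.2 _ (polarRetraction_mem h.1 hξ)).trans (Finset.sum_le_sum fun i _ => ?_)
    have := norm_polarRetraction_sub_le h.1 hξ (hx i)
    rw [norm_sub_rev, norm_sub_rev (x i)]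
    exact pow_le_pow_left₀ (norm_nonneg _) this 2
  have h2 := sqDist_eq_add hn x xbar
  have h3 : ∑ i, ‖x i - (xbar + ξ)‖ ^ 2 = _ := sqDist_eq_add hn x (xbar + ξ)
  have h4 : ‖mean x - (xbar + ξ)‖ ^ 2 = ‖mean x - xbar‖ ^ 2 - ‖ξ‖ ^ 2 := by
    rw [← sub_sub, norm_sub_sq_real]
    have h5 : inner ℝ (mean x - xbar) ξ = ‖ξ‖ ^ 2 := by
      have h6 : inner ℝ xbar ξ = 0 := by
        have := inner_tangent_mul hξ (Matrix.transpose_one (n := Fin r) (α := ℝ))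
        rwa [Matrix.mul_one, real_inner_comm] at this
      rw [inner_sub_left, h6, sub_zero, real_inner_comm, hξdef, inner_tangentProj_left h.1,
        real_inner_self_eq_norm_sq]
    rw [h5]; ring
  have h5 : (n : ℝ) * ‖ξ‖ ^ 2 ≤ 0 := by
    rw [h4] at h3
    nlinarith
  have h6 : ‖ξ‖ ^ 2 ≤ 0 := by nlinarith
  exact norm_eq_zero.1 (pow_eq_zero_iff two_ne_zero |>.1 (le_antisymm h6 (sq_nonneg _)))

/-- The mean of points of the manifold is `x̄ (1 - F)`, with `F = gramDefect x x̄` symmetric and of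
second order. -/
lemma mean_eq_iam_mul (hn : n ≠ 0) (hx : ∀ i, x i ∈ stiefel d r) (h : IsIAM x xbar) :
    mean x = xbar - xbar * gramDefect x xbar := by
  have h1 := tangentProj_mean_eq_zero hn hx h
  have h2 : xbarᵀ * mean x + (mean x)ᵀ * xbar = mean fun i => xbarᵀ * x i + (x i)ᵀ * xbar := by
    simp only [mean, Matrix.mul_smul, Matrix.transpose_smul, Matrix.smul_mul, Matrix.mul_sum,
      Matrix.transpose_sum, Matrix.sum_mul, Finset.sum_add_distrib, smul_add]
  have h3 : (mean fun i => xbarᵀ * x i + (x i)ᵀ * xbar) =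
      (2 : ℝ) • 1 - mean fun i => (x i - xbar)ᵀ * (x i - xbar) := by
    rw [← mean_const hn ((2 : ℝ) • (1 : Matrix (Fin r) (Fin r) ℝ)), ← mean_sub]
    congr 1
    ext1 i
    rw [sub_transpose_mul_sub (hx i) h.1]
    abel
  rw [tangentProj, sub_eq_zero] at h1
  rw [h1, h2, h3, gramDefect, Matrix.mul_sub, Matrix.mul_smul, Matrix.mul_smul, Matrix.mul_one]
  module

lemma norm_mean_sub_iam_le (hn : n ≠ 0) (hx : ∀ i, x i ∈ stiefel d r) (h : IsIAM x xbar) :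
    ‖mean x - xbar‖ ≤ 1 / 2 * ((1 / (n : ℝ)) * sqDist x xbar) := by
  rw [mean_eq_iam_mul hn hx h, sub_sub_cancel_left, norm_neg, norm_stiefel_mul h.1]
  exact norm_gramDefect_le _ _

/-- Strong monotonicity of the projection onto the manifold: for `w`, `z` on the manifold and `F`
symmetric and small, `⟨w - z, w (1 - F)⟩` is bounded below by a multiple of `‖w - z‖²`. -/
lemma le_inner_sub_iam {z w : Mat d r} {F : Matrix (Fin r) (Fin r) ℝ} {ε : ℝ}
    (hw : w ∈ stiefel d r) (hz : z ∈ stiefel d r) (hF : Fᵀ = F) (hε : ‖F‖ ≤ ε) :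
    1 / 2 * (1 - ε) * ‖w - z‖ ^ 2 ≤ inner ℝ (w - z) (w - w * F) := by
  have h1 : w - w * F = w * (1 - F) := by rw [Matrix.mul_sub, Matrix.mul_one]
  have h2 : (1 - F)ᵀ = 1 - F := by rw [Matrix.transpose_sub, Matrix.transpose_one, hF]
  rw [h1, inner_sub_stiefel_mul hw hz h2, inner_sub_right]
  have h3 : inner ℝ ((w - z)ᵀ * (w - z)) 1 = ‖w - z‖ ^ 2 := by
    rw [inner_mul_left, Matrix.mul_one, Matrix.transpose_transpose, real_inner_self_eq_norm_sq]
  have h4 : inner ℝ ((w - z)ᵀ * (w - z)) F ≤ ‖w - z‖ ^ 2 * ε :=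
    (real_inner_le_norm _ _).trans
      (mul_le_mul (norm_transpose_mul_self_le _) hε (norm_nonneg _) (sq_nonneg _))
  rw [h3]
  linarith

/-- For configurations close to their induced arithmetic means, these are Lipschitz functions of the
Euclidean means: add the bounds of `le_inner_sub_iam` for the two configurations. -/
lemma norm_iam_sub_le (hn : n ≠ 0) {y : Fin n → Mat d r} {ybar : Mat d r} {E : ℝ}
    (hx : ∀ i, x i ∈ stiefel d r) (h : IsIAM x xbar)
    (hy : ∀ i, y i ∈ stiefel d r) (h' : IsIAM y ybar)
    (hE : (1 / (n : ℝ)) * sqDist x xbar ≤ E) (hE' : (1 / (n : ℝ)) * sqDist y ybar ≤ E) :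
    (1 - E / 2) * ‖xbar - ybar‖ ≤ ‖mean x - mean y‖ := by
  have h1 := le_inner_sub_iam h.1 h'.1 (gramDefect_transpose x xbar)
    (ε := E / 2) ((norm_gramDefect_le _ _).trans (by linarith))
  have h2 := le_inner_sub_iam h'.1 h.1 (gramDefect_transpose y ybar)
    (ε := E / 2) ((norm_gramDefect_le _ _).trans (by linarith))
  rw [← mean_eq_iam_mul hn hx h] at h1
  rw [← mean_eq_iam_mul hn hy h', norm_sub_rev, ← neg_sub xbar ybar, inner_neg_left] at h2
  have h3 := real_inner_le_norm (xbar - ybar) (mean x - mean y)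
  rw [inner_sub_right] at h3
  rcases eq_or_lt_of_le (norm_nonneg (xbar - ybar)) with h0 | h0
  · rw [← h0, mul_zero]; exact norm_nonneg _
  · have : ((1 - E / 2) * ‖xbar - ybar‖) * ‖xbar - ybar‖ ≤
        ‖mean x - mean y‖ * ‖xbar - ybar‖ := by nlinarith
    exact le_of_mul_le_mul_right this h0

end IAM

/-! ### Sorted eigenvalues of symmetric matrices -/

section Spectral

variable {n : ℕ} {M : Matrix (Fin n) (Fin n) ℝ}

/-- An orthonormal eigenbasis for the eigenvalues in the order used by `sortedEigenvalue`. -/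
lemma exists_sorted_eigenbasis (hM : M.IsHermitian) :
    ∃ b : OrthonormalBasis (Fin n) ℝ (EuclideanSpace ℝ (Fin n)),
      (∀ k : Fin n, M *ᵥ (b k).ofLp = sortedEigenvalue M k • (b k).ofLp) ∧
      Antitone fun k : Fin n => sortedEigenvalue M k := by
  have hval : ∀ k : Fin n, sortedEigenvalue M k =
      hM.eigenvalues₀ ((finCongr (Fintype.card_fin n)).symm k) := by
    intro k
    have hk : M.IsHermitian ∧ (k : ℕ) < Fintype.card (Fin n) := ⟨hM, by simp⟩
    rw [sortedEigenvalue, dif_pos hk]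
    rfl
  refine ⟨hM.eigenvectorBasis.reindex
    ((Fintype.equivOfCardEq (Fintype.card_fin _)).symm.trans (finCongr (Fintype.card_fin n))),
    fun k => ?_, fun k l hkl => ?_⟩
  · rw [OrthonormalBasis.reindex_apply, hM.mulVec_eigenvectorBasis, hval,
      Matrix.IsHermitian.eigenvalues]
    simp
  · simp only [hval]
    exact hM.eigenvalues₀_antitone hkl

lemma dotProduct_self_eq_norm_sq (u : Fin n → ℝ) : u ⬝ᵥ u = ‖WithLp.toLp 2 u‖ ^ 2 := by
  rw [EuclideanSpace.real_norm_sq_eq]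
  simp [dotProduct, sq]

lemma dotProduct_self_pos {u : Fin n → ℝ} (hu : u ≠ 0) : 0 < u ⬝ᵥ u := by
  have h : WithLp.toLp 2 u ≠ 0 := by simpa using hu
  rw [dotProduct_self_eq_norm_sq]
  exact pow_pos (norm_pos_iff.2 h) 2

/-- Parseval's identity for the coordinates in an orthonormal basis. -/
lemma dotProduct_eq_sum_coord (b : OrthonormalBasis (Fin n) ℝ (EuclideanSpace ℝ (Fin n)))
    (u v : Fin n → ℝ) :
    u ⬝ᵥ v = ∑ k, ((b k).ofLp ⬝ᵥ u) * ((b k).ofLp ⬝ᵥ v) := by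
  have h := b.sum_inner_mul_inner (WithLp.toLp 2 u) (WithLp.toLp 2 v)
  simp only [EuclideanSpace.inner_eq_star_dotProduct, star_trivial] at h
  rw [dotProduct_comm, ← h]
  refine Finset.sum_congr rfl fun k _ => ?_
  rw [dotProduct_comm v]

lemma dotProduct_mulVec_symm (hM : M.IsSymm) (u v : Fin n → ℝ) :
    u ⬝ᵥ (M *ᵥ v) = (M *ᵥ u) ⬝ᵥ v := by
  rw [Matrix.dotProduct_mulVec, ← Matrix.mulVec_transpose, hM.eq]

lemma isHermitian_of_isSymm (hM : M.IsSymm) : M.IsHermitian := by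
  rw [Matrix.IsHermitian, Matrix.conjTranspose_eq_transpose_of_trivial, hM.eq]

/-- If `1` is an eigenvector for the largest eigenvalue `1`, then the quadratic form on the
orthogonal complement of `1` is bounded by the second largest eigenvalue. -/
lemma dotProduct_mulVec_le_second (hn : 2 ≤ n) (hM : M.IsSymm)
    (hone : M *ᵥ (fun _ => 1) = fun _ => 1) (hle : ∀ u, u ⬝ᵥ (M *ᵥ u) ≤ u ⬝ᵥ u)
    {u : Fin n → ℝ} (hu : ∑ i, u i = 0) :
    u ⬝ᵥ (M *ᵥ u) ≤ sortedEigenvalue M 1 * (u ⬝ᵥ u) := by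
  obtain ⟨b, hb, hanti⟩ := exists_sorted_eigenbasis (isHermitian_of_isSymm hM)
  have hcoord : ∀ k v, (b k).ofLp ⬝ᵥ (M *ᵥ v) = sortedEigenvalue M k * ((b k).ofLp ⬝ᵥ v) := by
    intro k v
    rw [dotProduct_mulVec_symm hM, hb, smul_dotProduct, smul_eq_mul]
  by_cases h1 : 1 ≤ sortedEigenvalue M 1
  · have h2 : 0 ≤ u ⬝ᵥ u := by rw [dotProduct_self_eq_norm_sq]; positivity
    nlinarith [hle u]
  push Not at h1
  set i0 : Fin n := ⟨0, by omega⟩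
  have hsmall : ∀ k : Fin n, k ≠ i0 → sortedEigenvalue M k ≤ sortedEigenvalue M 1 := by
    intro k hk
    have hk0 : (k : ℕ) ≠ 0 := fun h => hk (Fin.ext h)
    exact hanti (show (⟨1, by omega⟩ : Fin n) ≤ k from Fin.le_def.2 (by simp; omega))
  -- The vector `1` is orthogonal to all eigenvectors but the top one.
  have horth : ∀ k : Fin n, k ≠ i0 → (b k).ofLp ⬝ᵥ (fun _ => (1 : ℝ)) = 0 := by
    intro k hk
    have h2 := hcoord k (fun _ => 1)
    rw [hone] at h2
    have h3 := hsmall k hk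
    have h4 : (1 - sortedEigenvalue M k) * ((b k).ofLp ⬝ᵥ (fun _ => (1 : ℝ))) = 0 := by linarith
    rcases mul_eq_zero.1 h4 with h5 | h5
    · linarith
    · exact h5
  have hu0 : (b i0).ofLp ⬝ᵥ u = 0 := by
    have h2 := dotProduct_eq_sum_coord b u (fun _ => 1)
    have h3 := dotProduct_eq_sum_coord b (fun _ => (1 : ℝ)) (fun _ => 1)
    rw [Finset.sum_eq_single_of_mem i0 (Finset.mem_univ _)
      (fun k _ hk => by rw [horth k hk, mul_zero])] at h2 h3
    have h4 : u ⬝ᵥ (fun _ => (1 : ℝ)) = 0 := by simpa [dotProduct] using hu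
    rw [h4] at h2
    have h5 : (fun _ : Fin n => (1 : ℝ)) ⬝ᵥ (fun _ => 1) = n := by simp [dotProduct]
    rw [h5] at h3
    have hn' : (0 : ℝ) < n := by exact_mod_cast (by omega : 0 < n)
    rcases mul_eq_zero.1 h2.symm with h6 | h6
    · exact h6
    · rw [h6, mul_zero] at h3; linarith
  rw [dotProduct_eq_sum_coord b u (M *ᵥ u), dotProduct_eq_sum_coord b u u, Finset.mul_sum]
  refine Finset.sum_le_sum fun k _ => ?_
  rw [hcoord]
  by_cases hk : k = i0
  · rw [hk, hu0]; simp
  · nlinarith [hsmall k hk, mul_self_nonneg ((b k).ofLp ⬝ᵥ u)]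

/-- A combination of the top two eigenvectors is orthogonal to `1`, and the quadratic form there is
at least the second largest eigenvalue. -/
lemma exists_second_le_dotProduct_mulVec (hn : 2 ≤ n) (hM : M.IsSymm) :
    ∃ u : Fin n → ℝ, u ≠ 0 ∧ ∑ i, u i = 0 ∧
      sortedEigenvalue M 1 * (u ⬝ᵥ u) ≤ u ⬝ᵥ (M *ᵥ u) := by
  obtain ⟨b, hb, hanti⟩ := exists_sorted_eigenbasis (isHermitian_of_isSymm hM)
  set i0 : Fin n := ⟨0, by omega⟩
  set i1 : Fin n := ⟨1, by omega⟩
  have h01 : sortedEigenvalue M i1 ≤ sortedEigenvalue M i0 :=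
    hanti (Fin.le_def.2 (by simp [i0, i1]))
  have hne : i0 ≠ i1 := by simp [i0, i1]
  have hbb : ∀ k l, (b k).ofLp ⬝ᵥ (b l).ofLp = if k = l then 1 else 0 := by
    intro k l
    have := orthonormal_iff_ite.1 b.orthonormal k l
    rw [EuclideanSpace.inner_eq_star_dotProduct, star_trivial] at this
    rw [dotProduct_comm]; exact this
  have hquad : ∀ p q : ℝ, ∀ u : Fin n → ℝ, u = p • (b i0).ofLp + q • (b i1).ofLp →
      u ⬝ᵥ u = p ^ 2 + q ^ 2 ∧
      u ⬝ᵥ (M *ᵥ u) = sortedEigenvalue M i0 * p ^ 2 + sortedEigenvalue M i1 * q ^ 2 := by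
    rintro p q u rfl
    constructor
    · simp only [add_dotProduct, dotProduct_add, smul_dotProduct, dotProduct_smul, hbb, hne,
        hne.symm, if_true, if_false, smul_eq_mul]
      ring
    · simp only [Matrix.mulVec_add, Matrix.mulVec_smul, hb, add_dotProduct, dotProduct_add,
        smul_dotProduct, dotProduct_smul, hbb, hne, hne.symm, if_true, if_false, smul_eq_mul]
      ring
  set a := ∑ i, (b i0).ofLp i
  set c := ∑ i, (b i1).ofLp i
  obtain ⟨p, q, hpq, hsum⟩ : ∃ p q : ℝ, p ^ 2 + q ^ 2 ≠ 0 ∧ p * a + q * c = 0 := by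
    by_cases h : a = 0 ∧ c = 0
    · exact ⟨1, 0, by norm_num, by rw [h.1, h.2]; ring⟩
    · refine ⟨c, -a, fun h2 => h ?_, by ring⟩
      constructor <;> nlinarith [sq_nonneg a, sq_nonneg c]
  obtain ⟨h1, h2⟩ := hquad p q _ rfl
  refine ⟨p • (b i0).ofLp + q • (b i1).ofLp, fun h => ?_, ?_, ?_⟩
  · rw [h] at h1
    simp at h1
    exact hpq h1.symm
  · simp only [Pi.add_apply, Pi.smul_apply, smul_eq_mul, Finset.sum_add_distrib, ← Finset.mul_sum]
    exact hsum
  · rw [h1, h2]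
    change sortedEigenvalue M i1 * _ ≤ _
    nlinarith [sq_nonneg p]

/-- Cocoercivity of `1 - M`, whose largest eigenvalue is `1 - λₙ`. -/
lemma dotProduct_sub_mulVec_le (hM : M.IsSymm) (hle : ∀ u, u ⬝ᵥ (M *ᵥ u) ≤ u ⬝ᵥ u)
    (u : Fin n → ℝ) :
    (u - M *ᵥ u) ⬝ᵥ (u - M *ᵥ u) ≤ (1 - sortedEigenvalue M (n - 1)) * (u ⬝ᵥ (u - M *ᵥ u)) := by
  obtain ⟨b, hb, hanti⟩ := exists_sorted_eigenbasis (isHermitian_of_isSymm hM)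
  have hcoord : ∀ k v, (b k).ofLp ⬝ᵥ (v - M *ᵥ v) =
      (1 - sortedEigenvalue M k) * ((b k).ofLp ⬝ᵥ v) := by
    intro k v
    rw [dotProduct_sub, dotProduct_mulVec_symm hM, hb, smul_dotProduct, smul_eq_mul]
    ring
  rw [dotProduct_eq_sum_coord b, dotProduct_eq_sum_coord b u, Finset.mul_sum]
  refine Finset.sum_le_sum fun k _ => ?_
  rw [hcoord]
  have h1 : sortedEigenvalue M k ≤ 1 := by
    have h2 := hle (b k).ofLp
    have h3 : (b k).ofLp ⬝ᵥ (b k).ofLp = 1 := by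
      rw [dotProduct_self_eq_norm_sq]
      change ‖b k‖ ^ 2 = 1
      rw [b.orthonormal.1 k, one_pow]
    rw [hb, dotProduct_smul, h3] at h2
    simpa using h2
  have h2 : sortedEigenvalue M (n - 1) ≤ sortedEigenvalue M k := by
    have hk := k.2
    exact hanti (show k ≤ (⟨n - 1, by omega⟩ : Fin n) from Fin.le_def.2 (by simp; omega))
  have h3 := mul_nonneg (sub_nonneg.2 h1) (mul_self_nonneg ((b k).ofLp ⬝ᵥ u))
  nlinarith

lemma sortedEigenvalue_last_le (hn : 2 ≤ n) (hM : M.IsSymm) :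
    sortedEigenvalue M (n - 1) ≤ sortedEigenvalue M 1 := by
  obtain ⟨b, hb, hanti⟩ := exists_sorted_eigenbasis (isHermitian_of_isSymm hM)
  exact hanti (show (⟨1, by omega⟩ : Fin n) ≤ ⟨n - 1, by omega⟩ from Fin.le_def.2 (by simp; omega))

end Spectral

/-! ### Symmetric stochastic matrices -/

/-- Symmetric entrywise nonnegative matrices with row sums `1`. -/
structure IsSymmStochastic {n : ℕ} (M : Matrix (Fin n) (Fin n) ℝ) : Prop where
  symm : M.IsSymm
  nonneg : ∀ i j, 0 ≤ M i j
  row_sum : ∀ i, ∑ j, M i j = 1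

section Stochastic

variable {n : ℕ} {M : Matrix (Fin n) (Fin n) ℝ}

lemma IsMixingMatrix.isSymmStochastic {G : SimpleGraph (Fin n)} (h : IsMixingMatrix G M) :
    IsSymmStochastic M := ⟨h.symm, h.nonneg, h.row_sum⟩

namespace IsSymmStochastic

variable (h : IsSymmStochastic M)
include h

lemma comm (i j : Fin n) : M i j = M j i := h.symm.apply j i

lemma col_sum (j : Fin n) : ∑ i, M i j = 1 := by
  rw [← h.row_sum j]
  exact Finset.sum_congr rfl fun i _ => h.comm i j

lemma mulVec_one : M *ᵥ (fun _ => 1) = fun _ => 1 := by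
  ext i
  simp [Matrix.mulVec, dotProduct, h.row_sum]

lemma pow (t : ℕ) : IsSymmStochastic (M ^ t) := by
  induction t with
  | zero =>
    refine ⟨by simp [Matrix.IsSymm], fun i j => ?_, fun i => ?_⟩
    · rw [pow_zero, Matrix.one_apply]; split_ifs <;> norm_num
    · simp [Matrix.one_apply]
  | succ k ih =>
    refine ⟨?_, fun i j => ?_, fun i => ?_⟩
    · rw [Matrix.IsSymm, Matrix.transpose_pow, h.symm.eq]
    · rw [pow_succ, Matrix.mul_apply]
      exact Finset.sum_nonneg fun l _ => mul_nonneg (ih.nonneg i l) (h.nonneg l j)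
    · simp only [pow_succ, Matrix.mul_apply]
      rw [Finset.sum_comm]
      simp only [← Finset.mul_sum, h.row_sum, mul_one, ih.row_sum]

lemma sum_mulVec (u : Fin n → ℝ) : ∑ i, (M *ᵥ u) i = ∑ i, u i := by
  simp only [Matrix.mulVec, dotProduct]
  rw [Finset.sum_comm]
  simp only [← Finset.sum_mul, h.col_sum, one_mul]

/-- The Dirichlet form of a symmetric stochastic matrix. -/
lemma dirichlet (u : Fin n → ℝ) :
    u ⬝ᵥ u - u ⬝ᵥ (M *ᵥ u) = 1 / 2 * ∑ i, ∑ j, M i j * (u i - u j) ^ 2 := by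
  have h1 : ∑ i, ∑ j, M i j * (u i - u j) ^ 2 =
      ∑ i, ∑ j, M i j * u i ^ 2 + ∑ i, ∑ j, M i j * u j ^ 2 -
        2 * ∑ i, ∑ j, M i j * (u i * u j) := by
    simp only [Finset.mul_sum, ← Finset.sum_add_distrib, ← Finset.sum_sub_distrib]
    refine Finset.sum_congr rfl fun i _ => Finset.sum_congr rfl fun j _ => ?_
    ring
  have h2 : ∑ i, ∑ j, M i j * u i ^ 2 = u ⬝ᵥ u := by
    simp only [← Finset.sum_mul, h.row_sum, one_mul, dotProduct, sq]
  have h3 : ∑ i, ∑ j, M i j * u j ^ 2 = u ⬝ᵥ u := by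
    rw [Finset.sum_comm]
    simp only [← Finset.sum_mul, h.col_sum, one_mul, dotProduct, sq]
  have h4 : ∑ i, ∑ j, M i j * (u i * u j) = u ⬝ᵥ (M *ᵥ u) := by
    simp only [Matrix.mulVec, dotProduct, Finset.mul_sum]
    refine Finset.sum_congr rfl fun i _ => Finset.sum_congr rfl fun j _ => ?_
    ring
  rw [h1, h2, h3, h4]
  ring

lemma dotProduct_mulVec_le (u : Fin n → ℝ) : u ⬝ᵥ (M *ᵥ u) ≤ u ⬝ᵥ u := by
  have h1 := h.dirichlet u
  have h2 : 0 ≤ ∑ i, ∑ j, M i j * (u i - u j) ^ 2 :=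
    Finset.sum_nonneg fun i _ => Finset.sum_nonneg fun j _ =>
      mul_nonneg (h.nonneg i j) (sq_nonneg _)
  linarith

lemma mulVec_dotProduct_mulVec (u : Fin n → ℝ) :
    (M *ᵥ u) ⬝ᵥ (M *ᵥ u) = u ⬝ᵥ ((M ^ 2) *ᵥ u) := by
  rw [sq, ← Matrix.mulVec_mulVec, dotProduct_mulVec_symm h.symm u]

lemma second_le (hn : 2 ≤ n) {c : ℝ} (hc : ∀ u : Fin n → ℝ, ∑ i, u i = 0 →
    u ⬝ᵥ (M *ᵥ u) ≤ c * (u ⬝ᵥ u)) : sortedEigenvalue M 1 ≤ c := by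
  obtain ⟨u, hu, hsum, hle⟩ := exists_second_le_dotProduct_mulVec hn h.symm
  exact le_of_mul_le_mul_right (hle.trans (hc u hsum)) (dotProduct_self_pos hu)

lemma sigma₂_eq : sigma₂ M = √(sortedEigenvalue (M ^ 2) 1) := by
  rw [sigma₂, h.symm.eq, sq]

lemma mulVec_sq_le (hn : 2 ≤ n) {u : Fin n → ℝ} (hu : ∑ i, u i = 0) :
    (M *ᵥ u) ⬝ᵥ (M *ᵥ u) ≤ sigma₂ M ^ 2 * (u ⬝ᵥ u) := by
  have h2 := h.pow 2
  rw [h.mulVec_dotProduct_mulVec, h.sigma₂_eq, Real.sq_sqrt']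
  refine (dotProduct_mulVec_le_second hn h2.symm h2.mulVec_one h2.dotProduct_mulVec_le hu).trans ?_
  exact mul_le_mul_of_nonneg_right (le_max_left _ _)
    (by rw [dotProduct_self_eq_norm_sq]; positivity)

lemma pow_mulVec_sq_le (hn : 2 ≤ n) (t : ℕ) {u : Fin n → ℝ} (hu : ∑ i, u i = 0) :
    ((M ^ t) *ᵥ u) ⬝ᵥ ((M ^ t) *ᵥ u) ≤ (sigma₂ M ^ t) ^ 2 * (u ⬝ᵥ u) := by
  induction t with
  | zero => simp
  | succ k ih =>
    rw [pow_succ', ← Matrix.mulVec_mulVec]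
    have h1 : ∑ i, ((M ^ k) *ᵥ u) i = 0 := by rw [(h.pow k).sum_mulVec, hu]
    refine (h.mulVec_sq_le hn h1).trans ?_
    calc sigma₂ M ^ 2 * _ ≤ sigma₂ M ^ 2 * ((sigma₂ M ^ k) ^ 2 * (u ⬝ᵥ u)) :=
          mul_le_mul_of_nonneg_left ih (sq_nonneg _)
      _ = _ := by ring

lemma neg_one_le_last (hn : 2 ≤ n) : -1 ≤ sortedEigenvalue M (n - 1) := by
  obtain ⟨b, hb, -⟩ := exists_sorted_eigenbasis (isHermitian_of_isSymm h.symm)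
  have h1 := hb ⟨n - 1, by omega⟩
  set v := (b ⟨n - 1, by omega⟩).ofLp
  have hv : v ⬝ᵥ v = 1 := by
    rw [dotProduct_self_eq_norm_sq]
    change ‖b _‖ ^ 2 = 1
    rw [b.orthonormal.1, one_pow]
  have h2 := (h.pow 2).dotProduct_mulVec_le v
  rw [← h.mulVec_dotProduct_mulVec, h1, smul_dotProduct, dotProduct_smul, hv] at h2
  simp only [smul_eq_mul, mul_one] at h2
  by_contra! h3
  nlinarith

end IsSymmStochastic

/-- On vectors with sum zero, a mixing matrix is a strict contraction: connectedness excludes the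
eigenvalue `1`, and the eigenvalue `-1` is excluded by assumption. -/
lemma IsMixingMatrix.mulVec_sq_lt {G : SimpleGraph (Fin n)} {W : Matrix (Fin n) (Fin n) ℝ}
    (hW : IsMixingMatrix G W) {u : Fin n → ℝ} (hu : u ≠ 0) (hsum : ∑ i, u i = 0) :
    (W *ᵥ u) ⬝ᵥ (W *ᵥ u) < u ⬝ᵥ u := by
  have h := hW.isSymmStochastic
  have h2 := h.pow 2
  by_contra! hcon
  rw [h.mulVec_dotProduct_mulVec] at hcon
  have hpsd : (1 - W ^ 2).PosSemidef := by
    refine Matrix.PosSemidef.of_dotProduct_mulVec_nonneg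
      (Matrix.isHermitian_one.sub (isHermitian_of_isSymm h2.symm)) fun v => ?_
    rw [star_trivial, Matrix.sub_mulVec, Matrix.one_mulVec, dotProduct_sub]
    linarith [h2.dotProduct_mulVec_le v]
  have hzero : (1 - W ^ 2) *ᵥ u = 0 := by
    rw [← hpsd.dotProduct_mulVec_zero_iff, star_trivial, Matrix.sub_mulVec, Matrix.one_mulVec,
      dotProduct_sub]
    linarith [h2.dotProduct_mulVec_le u]
  have hWW : W *ᵥ (W *ᵥ u) = u := by
    rw [Matrix.sub_mulVec, Matrix.one_mulVec, sq, ← Matrix.mulVec_mulVec, sub_eq_zero] at hzero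
    exact hzero.symm
  have hfix : W *ᵥ u - u = 0 := by
    by_contra hne
    have hev : Module.End.HasEigenvalue (Matrix.toLin' W) (-1) := by
      refine Module.End.hasEigenvalue_of_hasEigenvector (x := W *ᵥ u - u)
        ⟨Module.End.mem_eigenspace_iff.2 ?_, hne⟩
      rw [Matrix.toLin'_apply, Matrix.mulVec_sub, hWW]
      simp
    exact lt_irrefl _ (hW.eigenvalue_gt _ hev)
  have hdir := h.dirichlet u
  rw [sub_eq_zero.1 hfix, sub_self] at hdir
  have hnn : ∀ i j, 0 ≤ W i j * (u i - u j) ^ 2 := fun i j =>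
    mul_nonneg (h.nonneg i j) (sq_nonneg _)
  have hadj : ∀ i j, G.Adj i j → u i = u j := by
    intro i j hij
    have h3 : ∑ i, ∑ j, W i j * (u i - u j) ^ 2 = 0 := by linarith
    have h4 := (Finset.sum_eq_zero_iff_of_nonneg
      (fun i _ => Finset.sum_nonneg fun j _ => hnn i j)).1 h3 i (Finset.mem_univ _)
    have h5 := (Finset.sum_eq_zero_iff_of_nonneg (fun j _ => hnn i j)).1 h4 j (Finset.mem_univ _)
    have h6 := (hW.pos_iff_adj i j hij.ne).2 hij
    rcases mul_eq_zero.1 h5 with h7 | h7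
    · linarith
    · exact sub_eq_zero.1 (pow_eq_zero_iff two_ne_zero |>.1 h7)
  have hconst : ∀ i j, u i = u j := by
    intro i j
    obtain ⟨p⟩ := hW.connected.preconnected i j
    induction p with
    | nil => rfl
    | cons hij _ ih => exact (hadj _ _ hij).trans ih
  apply hu
  ext i
  have h7 : ∑ j, u j = n * u i := by
    rw [Finset.sum_congr rfl fun j _ => hconst j i]
    simp
  have hn0 : (n : ℝ) ≠ 0 := by
    have := i.pos
    positivity
  rw [hsum] at h7
  simpa [hn0] using h7.symm

lemma IsMixingMatrix.sigma₂_lt_one {G : SimpleGraph (Fin n)} {W : Matrix (Fin n) (Fin n) ℝ}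
    (hn : 2 ≤ n) (hW : IsMixingMatrix G W) : sigma₂ W < 1 := by
  have h := hW.isSymmStochastic
  rw [h.sigma₂_eq, Real.sqrt_lt' one_pos, one_pow]
  obtain ⟨u, hu, hsum, hle⟩ := exists_second_le_dotProduct_mulVec hn (h.pow 2).symm
  have h1 := hW.mulVec_sq_lt hu hsum
  rw [h.mulVec_dotProduct_mulVec] at h1
  have h2 := dotProduct_self_pos hu
  by_contra! h3
  nlinarith

lemma sigma₂_nonneg (W : Matrix (Fin n) (Fin n) ℝ) : 0 ≤ sigma₂ W := Real.sqrt_nonneg _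

/-- The communication rounds make the mixing factor at most `1 / (2 √n)`. -/
lemma sigma₂_pow_le {σ : ℝ} (h0 : 0 ≤ σ) (h1 : σ < 1) (hn : n ≠ 0) {t : ℕ} (ht : 1 ≤ t)
    (htlog : ⌈Real.logb σ (1 / (2 * √(n : ℝ)))⌉ ≤ (t : ℤ)) : σ ^ t ≤ 1 / (2 * √(n : ℝ)) := by
  have hn' : (0 : ℝ) < n := by exact_mod_cast Nat.pos_of_ne_zero hn
  have hpos : 0 < 1 / (2 * √(n : ℝ)) := by positivity
  -- the logarithm to the base `0` is `0`, but then `σ ^ t` vanishes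
  rcases eq_or_lt_of_le h0 with h | h
  · rw [← h, zero_pow (by omega)]; exact hpos.le
  · have h2 : Real.logb σ (1 / (2 * √(n : ℝ))) ≤ t := by exact_mod_cast Int.ceil_le.1 htlog
    calc σ ^ t = σ ^ (t : ℝ) := (Real.rpow_natCast _ _).symm
      _ ≤ σ ^ Real.logb σ (1 / (2 * √(n : ℝ))) :=
        Real.rpow_le_rpow_of_exponent_ge h h1.le h2
      _ = _ := Real.rpow_logb h h1.ne hpos

/-- Second eigenvalues of powers are bounded by powers of the second singular value. -/
lemma IsSymmStochastic.second_pow_le (hn : 2 ≤ n) (h : IsSymmStochastic M) (t : ℕ) :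
    sortedEigenvalue (M ^ t) 1 ≤ sigma₂ M ^ t := by
  refine (h.pow t).second_le hn fun u hu => ?_
  have h1 := h.pow_mulVec_sq_le hn t hu
  rw [dotProduct_self_eq_norm_sq, dotProduct_self_eq_norm_sq, ← mul_pow] at h1
  have h2 := abs_le_of_sq_le_sq' h1 (mul_nonneg (pow_nonneg (sigma₂_nonneg M) t) (norm_nonneg _))
  have h3 := real_inner_le_norm (WithLp.toLp 2 ((M ^ t) *ᵥ u)) (WithLp.toLp 2 u)
  rw [EuclideanSpace.inner_eq_star_dotProduct, star_trivial] at h3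
  rw [dotProduct_self_eq_norm_sq]
  nlinarith [norm_nonneg (WithLp.toLp 2 u), h2.2]

end Stochastic

/-! ### Mixing of matrix-valued data -/

section Mix

variable {n d r : ℕ} {M : Matrix (Fin n) (Fin n) ℝ}

/-- One application of the mixing matrix to `n` matrices. -/
def mix (M : Matrix (Fin n) (Fin n) ℝ) (x : Fin n → Mat d r) (i : Fin n) : Mat d r :=
  ∑ j, M i j • x j

lemma sum_inner_eq (x y : Fin n → Mat d r) :
    ∑ i, inner ℝ (x i) (y i) = ∑ b, ∑ a, (fun i => x i a b) ⬝ᵥ (fun i => y i a b) := by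
  simp only [inner_eq_trace, Matrix.trace, Matrix.diag, Matrix.mul_apply, Matrix.transpose_apply,
    dotProduct]
  rw [Finset.sum_comm]
  refine Finset.sum_congr rfl fun b _ => ?_
  rw [Finset.sum_comm]

lemma sum_norm_sq_eq (x : Fin n → Mat d r) :
    ∑ i, ‖x i‖ ^ 2 = ∑ b, ∑ a, (fun i => x i a b) ⬝ᵥ (fun i => x i a b) := by
  rw [← sum_inner_eq]
  simp only [real_inner_self_eq_norm_sq]

lemma mix_apply (x : Fin n → Mat d r) (a : Fin d) (b : Fin r) :
    (fun i => mix M x i a b) = M *ᵥ fun i => x i a b := by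
  ext i
  simp [mix, Matrix.sum_apply, Matrix.mulVec, dotProduct]

lemma sub_mix_apply (x : Fin n → Mat d r) (a : Fin d) (b : Fin r) :
    (fun i => (x i - mix M x i) a b) = (fun i => x i a b) - M *ᵥ fun i => x i a b := by
  rw [← mix_apply]
  rfl

lemma mix_sub (x y : Fin n → Mat d r) (i : Fin n) :
    mix M (fun j => x j - y j) i = mix M x i - mix M y i := by
  simp only [mix, smul_sub, Finset.sum_sub_distrib]

namespace IsSymmStochastic

variable (h : IsSymmStochastic M)
include h

lemma mix_const (z : Mat d r) (i : Fin n) : mix M (fun _ => z) i = z := by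
  rw [mix, ← Finset.sum_smul, h.row_sum, one_smul]

lemma sum_mix (x : Fin n → Mat d r) : ∑ i, mix M x i = ∑ i, x i := by
  simp only [mix]
  rw [Finset.sum_comm]
  simp only [← Finset.sum_smul, h.col_sum, one_smul]

lemma mean_mix (x : Fin n → Mat d r) : mean (mix M x) = mean x := by
  rw [mean, h.sum_mix, mean]

lemma sub_mix (x : Fin n → Mat d r) (i : Fin n) :
    x i - mix M x i = ∑ j, M i j • (x i - x j) := by
  simp only [smul_sub, Finset.sum_sub_distrib, ← Finset.sum_smul, h.row_sum, one_smul]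
  rfl

lemma sum_norm_mix_pow_sq_le (hn : 2 ≤ n) (t : ℕ) {x : Fin n → Mat d r} (hx : ∑ i, x i = 0) :
    ∑ i, ‖mix (M ^ t) x i‖ ^ 2 ≤ (sigma₂ M ^ t) ^ 2 * ∑ i, ‖x i‖ ^ 2 := by
  rw [sum_norm_sq_eq, sum_norm_sq_eq, Finset.mul_sum]
  refine Finset.sum_le_sum fun b _ => ?_
  rw [Finset.mul_sum]
  refine Finset.sum_le_sum fun a _ => ?_
  rw [mix_apply]
  refine h.pow_mulVec_sq_le hn t ?_
  have := congrFun (congrFun hx a) b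
  simpa [Matrix.sum_apply] using this

lemma sum_norm_sub_mix_sq_le (x : Fin n → Mat d r) :
    ∑ i, ‖x i - mix M x i‖ ^ 2 ≤
      (1 - sortedEigenvalue M (n - 1)) * ∑ i, inner ℝ (x i) (x i - mix M x i) := by
  rw [sum_norm_sq_eq, sum_inner_eq, Finset.mul_sum]
  refine Finset.sum_le_sum fun b _ => ?_
  rw [Finset.mul_sum]
  refine Finset.sum_le_sum fun a _ => ?_
  rw [sub_mix_apply]
  exact dotProduct_sub_mulVec_le h.symm h.dotProduct_mulVec_le _

lemma second_mul_sum_norm_sq_le (hn : 2 ≤ n) {x : Fin n → Mat d r} (hx : ∑ i, x i = 0) :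
    (1 - sortedEigenvalue M 1) * ∑ i, ‖x i‖ ^ 2 ≤ ∑ i, inner ℝ (x i) (x i - mix M x i) := by
  rw [sum_norm_sq_eq, sum_inner_eq, Finset.mul_sum]
  refine Finset.sum_le_sum fun b _ => ?_
  rw [Finset.mul_sum]
  refine Finset.sum_le_sum fun a _ => ?_
  rw [sub_mix_apply, dotProduct_sub]
  have h1 : ∑ i, x i a b = 0 := by
    have := congrFun (congrFun hx a) b
    simpa [Matrix.sum_apply] using this
  have h2 := dotProduct_mulVec_le_second hn h.symm h.mulVec_one h.dotProduct_mulVec_le h1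
  linarith

lemma sum_inner_sub_mix (x : Fin n → Mat d r) :
    ∑ i, inner ℝ (x i) (x i - mix M x i) = 1 / 2 * ∑ i, ∑ j, M i j * ‖x i - x j‖ ^ 2 := by
  have h1 : ∀ i, inner ℝ (x i) (x i - mix M x i) =
      ∑ j, M i j * inner ℝ (x i) (x i - x j) := by
    intro i
    rw [h.sub_mix, inner_sum]
    simp only [inner_smul_right]
  have h2 : ∑ i, ∑ j, M i j * inner ℝ (x i) (x i - x j) =
      ∑ i, ∑ j, M i j * inner ℝ (-x j) (x i - x j) := by
    rw [Finset.sum_comm]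
    refine Finset.sum_congr rfl fun i _ => Finset.sum_congr rfl fun j _ => ?_
    rw [h.comm j i, ← neg_sub (x i) (x j), inner_neg_right, inner_neg_left]
  have h3 : ∑ i, ∑ j, M i j * ‖x i - x j‖ ^ 2 =
      ∑ i, ∑ j, M i j * inner ℝ (x i) (x i - x j) +
        ∑ i, ∑ j, M i j * inner ℝ (-x j) (x i - x j) := by
    simp only [← Finset.sum_add_distrib, ← mul_add, ← inner_add_left, ← sub_eq_add_neg,
      real_inner_self_eq_norm_sq]
  simp only [h1]
  rw [h3, ← h2]
  ring

lemma sum_mul_norm_sub_sq_le (x : Fin n → Mat d r) (z : Mat d r) :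
    ∑ i, ∑ j, M i j * ‖x i - x j‖ ^ 2 ≤ 4 * sqDist x z := by
  have h1 : ∀ i j, M i j * ‖x i - x j‖ ^ 2 ≤
      2 * (M i j * ‖x i - z‖ ^ 2) + 2 * (M i j * ‖x j - z‖ ^ 2) := by
    intro i j
    have h2 : ‖x i - x j‖ ≤ ‖x i - z‖ + ‖x j - z‖ := by
      rw [norm_sub_rev (x j)]; exact norm_sub_le_norm_sub_add_norm_sub _ _ _
    have h3 : ‖x i - x j‖ ^ 2 ≤ 2 * ‖x i - z‖ ^ 2 + 2 * ‖x j - z‖ ^ 2 := by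
      nlinarith [norm_nonneg (x i - x j), sq_nonneg (‖x i - z‖ - ‖x j - z‖)]
    nlinarith [mul_le_mul_of_nonneg_left h3 (h.nonneg i j)]
  refine (Finset.sum_le_sum fun i _ => Finset.sum_le_sum fun j _ => h1 i j).trans_eq ?_
  simp only [Finset.sum_add_distrib, ← Finset.mul_sum]
  rw [Finset.sum_comm (f := fun i j => M i j * ‖x j - z‖ ^ 2)]
  simp only [← Finset.sum_mul, h.row_sum, h.col_sum, one_mul]
  rw [sqDist]
  ring

end IsSymmStochastic

end Mix

/-! ### Gradients -/

section Gradient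

variable {n d r : ℕ}

lemma inner_single (g : Mat d r) (i : Fin d) (j : Fin r) :
    inner ℝ g (Matrix.single i j 1) = g i j := by
  rw [inner_eq_trace, Matrix.trace_mul_single]
  simp

/-- The gradient of a function with an exact second-order expansion is read off its linear term. -/
lemma egrad_eq_of_quadratic {f : Mat d r → ℝ} {x g : Mat d r} {c : ℝ}
    (h : ∀ v, f (x + v) = f x + inner ℝ g v + c * ‖v‖ ^ 2) : egrad f x = g := by
  have hf : HasFDerivAt f (innerSL ℝ g : Mat d r →L[ℝ] ℝ) x := by
    rw [hasFDerivAt_iff_isLittleO_nhds_zero]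
    have h1 : (fun v => f (x + v) - f x - (innerSL ℝ g : Mat d r →L[ℝ] ℝ) v) =
        fun v => c * ‖v‖ ^ 2 := by
      ext v
      rw [h v]
      change f x + inner ℝ g v + c * ‖v‖ ^ 2 - f x - inner ℝ g v = _
      ring
    rw [h1]
    exact (Asymptotics.isLittleO_norm_pow_id one_lt_two).const_mul_left c
  ext i j
  rw [egrad, Matrix.of_apply]
  exact (DFunLike.congr_fun hf.fderiv (Matrix.single i j 1)).trans (inner_single g i j)

/-- The Euclidean gradient represents the derivative for the Frobenius inner product. -/
lemma inner_egrad (f : Mat d r → ℝ) (x v : Mat d r) :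
    inner ℝ (egrad f x) v = fderiv ℝ f x v := by
  conv_rhs => rw [Matrix.matrix_eq_sum_single v]
  conv_lhs => rw [Matrix.matrix_eq_sum_single v]
  simp only [inner_sum, map_sum]
  refine Finset.sum_congr rfl fun i _ => Finset.sum_congr rfl fun j _ => ?_
  have h : Matrix.single i j (v i j) = v i j • Matrix.single i j (1 : ℝ) := by
    rw [Matrix.smul_single, smul_eq_mul, mul_one]
  rw [h, inner_smul_right, map_smul, inner_single, egrad, Matrix.of_apply, smul_eq_mul]

/-- The block gradient of the consensus potential: the tangent projection of
`xᵢ - ∑ⱼ (Wᵗ)ᵢⱼ xⱼ`. -/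
lemma consensusGrad_eq {W : Matrix (Fin n) (Fin n) ℝ} {t : ℕ} (h : IsSymmStochastic (W ^ t))
    (x : Fin n → Mat d r) (i : Fin n) :
    consensusGrad W t x i = tangentProj (x i) (x i - mix (W ^ t) x i) := by
  rw [consensusGrad, rgrad]
  congr 1
  set δ : Fin n → ℝ := fun k => if k = i then 1 else 0 with hδ
  have hupd : ∀ v k, Function.update x i (x i + v) k = x k + δ k • v := by
    intro v k
    by_cases hk : k = i
    · subst hk
      simp [hδ]
    · simp [hδ, hk]
  have hval : ∀ v k l, (W ^ t) k l *
      ‖Function.update x i (x i + v) k - Function.update x i (x i + v) l‖ ^ 2 =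
        (W ^ t) k l * ‖x k - x l‖ ^ 2 +
        (δ k * (2 * ((W ^ t) k l * inner ℝ (x k - x l) v)) +
        δ l * (2 * ((W ^ t) l k * inner ℝ (x l - x k) v))) +
        (W ^ t) k l * (δ k - δ l) ^ 2 * ‖v‖ ^ 2 := by
    intro v k l
    have h1 : x k + δ k • v - (x l + δ l • v) = (x k - x l) + (δ k - δ l) • v := by module
    rw [hupd, hupd, h1, norm_add_sq_real, inner_smul_right, norm_smul, mul_pow, Real.norm_eq_abs,
      sq_abs, h.comm l k, ← neg_sub (x k) (x l), inner_neg_left]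
    ring
  refine egrad_eq_of_quadratic (c := 1 / 4 * ∑ k, ∑ l, (W ^ t) k l * (δ k - δ l) ^ 2) fun v => ?_
  simp only [consensusPotential, Function.update_eq_self, hval, Finset.sum_add_distrib]
  rw [h.sub_mix, sum_inner,
    Finset.sum_comm (f := fun k l => δ l * (2 * ((W ^ t) l k * inner ℝ (x l - x k) v)))]
  have hpick : ∀ F : Fin n → Fin n → ℝ, ∑ k, ∑ l, δ k * F k l = ∑ l, F i l := by
    intro F
    simp [hδ]
  rw [hpick]
  simp only [← Finset.mul_sum, ← Finset.sum_mul, real_inner_smul_left]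
  ring

end Gradient

/-! ### The consensus step -/

section Consensus

variable {n d r : ℕ} {M : Matrix (Fin n) (Fin n) ℝ} {x : Fin n → Mat d r} {z : Mat d r}

/-- The Riemannian gradient of the consensus potential, in the form `P_{xᵢ} (xᵢ - ∑ⱼ Mᵢⱼ xⱼ)`. -/
def consensusDir (M : Matrix (Fin n) (Fin n) ℝ) (x : Fin n → Mat d r) (i : Fin n) : Mat d r :=
  tangentProj (x i) (x i - mix M x i)

/-- The Dirichlet energy `∑ᵢⱼ Mᵢⱼ ‖xᵢ - xⱼ‖²`. -/
def energy (M : Matrix (Fin n) (Fin n) ℝ) (x : Fin n → Mat d r) : ℝ :=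
  ∑ i, ∑ j, M i j * ‖x i - x j‖ ^ 2

lemma tangentProj_sub_stiefel {u v : Mat d r} (hu : u ∈ stiefel d r) (hv : v ∈ stiefel d r) :
    tangentProj u (u - v) = (u - v) - u * ((1 / 2 : ℝ) • ((u - v)ᵀ * (u - v))) := by
  have h1 : uᵀ * u = 1 := hu
  have h2 : uᵀ * (u - v) + (u - v)ᵀ * u = (u - v)ᵀ * (u - v) := by
    rw [sub_transpose_mul_sub hu hv, Matrix.mul_sub, Matrix.transpose_sub, Matrix.sub_mul, h1]
    module
  rw [tangentProj, h2, Matrix.mul_smul]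

lemma consensusDir_eq_sum (h : IsSymmStochastic M) (i : Fin n) :
    consensusDir M x i = ∑ j, M i j • tangentProj (x i) (x i - x j) := by
  rw [consensusDir, h.sub_mix, tangentProj_sum]
  simp only [tangentProj_smul]

/-- The consensus direction is the Euclidean one up to normal terms of second order. -/
lemma consensusDir_eq_sub (h : IsSymmStochastic M) (hx : ∀ i, x i ∈ stiefel d r) (i : Fin n) :
    consensusDir M x i = (x i - mix M x i) -
      ∑ j, M i j • (x i * ((1 / 2 : ℝ) • ((x i - x j)ᵀ * (x i - x j)))) := by
  rw [consensusDir_eq_sum h, h.sub_mix]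
  simp only [tangentProj_sub_stiefel (hx i) (hx _), smul_sub, Finset.sum_sub_distrib]

lemma norm_consensusDir_remainder_le (h : IsSymmStochastic M) (hx : ∀ i, x i ∈ stiefel d r)
    (i : Fin n) :
    ‖∑ j, M i j • (x i * ((1 / 2 : ℝ) • ((x i - x j)ᵀ * (x i - x j))))‖ ≤
      1 / 2 * ∑ j, M i j * ‖x i - x j‖ ^ 2 := by
  rw [Finset.mul_sum]
  refine (norm_sum_le _ _).trans (Finset.sum_le_sum fun j _ => ?_)
  rw [norm_smul, Real.norm_of_nonneg (h.nonneg i j), norm_stiefel_mul (hx i), norm_smul,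
    Real.norm_of_nonneg (by norm_num)]
  have h1 := mul_le_mul_of_nonneg_left (norm_transpose_mul_self_le (x i - x j)) (h.nonneg i j)
  linarith

lemma energy_nonneg (h : IsSymmStochastic M) : 0 ≤ energy M x :=
  Finset.sum_nonneg fun i _ => Finset.sum_nonneg fun j _ =>
    mul_nonneg (h.nonneg i j) (sq_nonneg _)

lemma sum_inner_shift_sub_mix (h : IsSymmStochastic M) (z : Mat d r) :
    ∑ i, inner ℝ (x i - z) (x i - mix M x i) = 1 / 2 * energy M x := by
  have h1 := h.sum_inner_sub_mix fun i => x i - z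
  simp only [mix_sub, h.mix_const, sub_sub_sub_cancel_right] at h1
  exact h1

/-- The restricted secant inequality: the normal part of `xᵢ - xⱼ`, paired with `xᵢ - z`, is of
fourth order by `inner_sub_stiefel_mul`. -/
lemma le_sum_inner_consensusDir (h : IsSymmStochastic M) (hx : ∀ i, x i ∈ stiefel d r)
    (hz : z ∈ stiefel d r) {δ : ℝ} (hδ : ∀ i, ‖x i - z‖ ≤ δ) :
    (2 - δ ^ 2) / 4 * energy M x ≤ ∑ i, inner ℝ (x i - z) (consensusDir M x i) := by
  have hi : ∀ i, inner ℝ (x i - z) (x i - mix M x i) - δ ^ 2 / 4 * ∑ j, M i j * ‖x i - x j‖ ^ 2 ≤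
      inner ℝ (x i - z) (consensusDir M x i) := by
    intro i
    rw [consensusDir_eq_sub h hx, inner_sub_right _ (x i - mix M x i), inner_sum, Finset.mul_sum]
    refine sub_le_sub_left (Finset.sum_le_sum fun j _ => ?_) _
    have hS : ((1 / 2 : ℝ) • ((x i - x j)ᵀ * (x i - x j)))ᵀ =
        (1 / 2 : ℝ) • ((x i - x j)ᵀ * (x i - x j)) := by
      rw [Matrix.transpose_smul, Matrix.transpose_mul, Matrix.transpose_transpose]
    rw [inner_smul_right, inner_sub_stiefel_mul (hx i) hz hS, inner_smul_right]
    have h1 := real_inner_le_norm ((x i - z)ᵀ * (x i - z)) ((x i - x j)ᵀ * (x i - x j))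
    have h2 : ‖(x i - z)ᵀ * (x i - z)‖ ≤ δ ^ 2 := (norm_transpose_mul_self_le _).trans
      (pow_le_pow_left₀ (norm_nonneg _) (hδ i) 2)
    have h3 := mul_le_mul h2 (norm_transpose_mul_self_le (x i - x j)) (norm_nonneg _)
      (sq_nonneg _)
    have h4 := mul_le_mul_of_nonneg_left (h1.trans h3) (h.nonneg i j)
    linarith
  have h1 := Finset.sum_le_sum fun i (_ : i ∈ Finset.univ) => hi i
  rw [Finset.sum_sub_distrib, sum_inner_shift_sub_mix h, ← Finset.mul_sum] at h1
  change 1 / 2 * energy M x - δ ^ 2 / 4 * energy M x ≤ _ at h1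
  linarith

lemma sum_norm_consensusDir_sq_le (h : IsSymmStochastic M) (hx : ∀ i, x i ∈ stiefel d r) :
    ∑ i, ‖consensusDir M x i‖ ^ 2 ≤ (1 - sortedEigenvalue M (n - 1)) * (1 / 2 * energy M x) := by
  have h1 : ∑ i, ‖consensusDir M x i‖ ^ 2 ≤ ∑ i, ‖x i - mix M x i‖ ^ 2 :=
    Finset.sum_le_sum fun i _ =>
      pow_le_pow_left₀ (norm_nonneg _) (norm_tangentProj_le (hx i) _) 2
  have h2 := h.sum_norm_sub_mix_sq_le x
  rw [h.sum_inner_sub_mix] at h2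
  exact h1.trans h2

lemma second_mul_sqDist_mean_le (hn : 2 ≤ n) (h : IsSymmStochastic M) :
    (1 - sortedEigenvalue M 1) * sqDist x (mean x) ≤ 1 / 2 * energy M x := by
  have h1 : ∑ i, (x i - mean x) = 0 := by
    rw [Finset.sum_sub_distrib, ← smul_mean (by omega) x, Finset.sum_const, Finset.card_univ,
      Fintype.card_fin, Nat.cast_smul_eq_nsmul, sub_self]
  have h2 := h.second_mul_sum_norm_sq_le hn h1
  simp only [mix_sub, h.mix_const, sub_sub_sub_cancel_right] at h2
  rwa [sum_inner_shift_sub_mix h] at h2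

/-- One step of Riemannian gradient descent on the consensus potential contracts the distance to the
induced arithmetic mean. -/
lemma consensus_contraction (hn : 2 ≤ n) (hr : 1 ≤ r) (h : IsSymmStochastic M)
    (hx : ∀ i, x i ∈ stiefel d r) (hz : IsIAM x z) {δ₁ δ₂ α : ℝ}
    (hδ₂ : ∀ i, ‖x i - z‖ ≤ δ₂) (hδ₁ : (1 / (n : ℝ)) * sqDist x z ≤ δ₁ ^ 2)
    (hδ₂' : δ₂ ^ 2 ≤ 2)
    (hα : 0 ≤ α) (hαℓ : α * (2 * (1 - sortedEigenvalue M (n - 1))) ≤ 2 - δ₂ ^ 2)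
    (hμ : 0 ≤ 1 - sortedEigenvalue M 1) :
    ∑ i, ‖x i - α • consensusDir M x i - z‖ ^ 2 ≤
      (1 - (1 - 4 * r * δ₁ ^ 2) * (1 - δ₂ ^ 2 / 2) * (1 - sortedEigenvalue M 1) * α) *
        sqDist x z := by
  have hn' : (0 : ℝ) < n := by exact_mod_cast (by omega : 0 < n)
  have hexp : ∑ i, ‖x i - α • consensusDir M x i - z‖ ^ 2 = sqDist x z -
      2 * α * ∑ i, inner ℝ (x i - z) (consensusDir M x i) +
      α ^ 2 * ∑ i, ‖consensusDir M x i‖ ^ 2 := by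
    rw [sqDist, Finset.mul_sum, Finset.mul_sum, ← Finset.sum_sub_distrib,
      ← Finset.sum_add_distrib]
    refine Finset.sum_congr rfl fun i _ => ?_
    rw [sub_right_comm, norm_sub_sq_real, inner_smul_right, norm_smul, mul_pow, Real.norm_eq_abs,
      sq_abs]
    ring
  have h1 := le_sum_inner_consensusDir h hx hz.1 hδ₂
  have h2 := sum_norm_consensusDir_sq_le h hx
  have h3 := second_mul_sqDist_mean_le (x := x) hn h
  have h4 := sqDist_eq_add (by omega) x z
  have h5 := norm_mean_sub_iam_le (by omega) hx hz
  have hV := energy_nonneg (x := x) h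
  set V := energy M x
  set S := sqDist x z with hS
  have hS0 : 0 ≤ S := sqDist_nonneg _ _
  set ℓ := 1 - sortedEigenvalue M (n - 1)
  set μ := 1 - sortedEigenvalue M 1
  -- the Euclidean mean is almost as close to the points as the induced mean
  have h6 : (1 - 4 * r * δ₁ ^ 2) * S ≤ sqDist x (mean x) := by
    have h7 : ‖mean x - z‖ ^ 2 ≤ (1 / 2 * (1 / (n : ℝ) * S)) ^ 2 :=
      pow_le_pow_left₀ (norm_nonneg _) h5 2
    have h8 : (n : ℝ) * ‖mean x - z‖ ^ 2 ≤ 1 / 4 * δ₁ ^ 2 * S := by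
      calc (n : ℝ) * ‖mean x - z‖ ^ 2 ≤ n * (1 / 2 * (1 / (n : ℝ) * S)) ^ 2 :=
            mul_le_mul_of_nonneg_left h7 hn'.le
        _ = 1 / 4 * (1 / (n : ℝ) * S) * S := by field_simp; ring
        _ ≤ _ := by gcongr
    have hr' : (1 : ℝ) ≤ r := by exact_mod_cast hr
    have h9 : 1 / 4 * δ₁ ^ 2 * S ≤ 4 * r * δ₁ ^ 2 * S := by
      have : 0 ≤ δ₁ ^ 2 * S := by positivity
      nlinarith
    nlinarith
  have h7 : (1 - 4 * r * δ₁ ^ 2) * μ * S ≤ 1 / 2 * V := by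
    have := mul_le_mul_of_nonneg_left h6 hμ
    linarith
  have h8 : α ^ 2 * ∑ i, ‖consensusDir M x i‖ ^ 2 ≤ α * ((2 - δ₂ ^ 2) / 4 * V) := by
    have := mul_le_mul_of_nonneg_left h2 (sq_nonneg α)
    have h9 : α * V * (α * (2 * ℓ)) ≤ α * V * (2 - δ₂ ^ 2) :=
      mul_le_mul_of_nonneg_left hαℓ (by positivity)
    nlinarith
  have h9 : α * ((2 - δ₂ ^ 2) / 4 * V) ≤
      α * ∑ i, inner ℝ (x i - z) (consensusDir M x i) := mul_le_mul_of_nonneg_left h1 hα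
  have h10 : α * (2 - δ₂ ^ 2) / 2 * ((1 - 4 * r * δ₁ ^ 2) * μ * S) ≤
      α * (2 - δ₂ ^ 2) / 2 * (1 / 2 * V) :=
    mul_le_mul_of_nonneg_left h7 (by have : 0 ≤ 2 - δ₂ ^ 2 := by linarith
                                     positivity)
  rw [hexp]
  linarith

/-- The consensus directions almost cancel in the mean: their Euclidean parts sum to zero since `M`
is doubly stochastic. -/
lemma norm_mean_consensusDir_le (h : IsSymmStochastic M) (hx : ∀ i, x i ∈ stiefel d r)
    (z : Mat d r) :
    ‖mean (consensusDir M x)‖ ≤ 2 * ((1 / (n : ℝ)) * sqDist x z) := by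
  have h1 : ∑ i, consensusDir M x i =
      -∑ i, ∑ j, M i j • (x i * ((1 / 2 : ℝ) • ((x i - x j)ᵀ * (x i - x j)))) := by
    simp only [consensusDir_eq_sub h hx, Finset.sum_sub_distrib, h.sum_mix, sub_self, zero_sub]
  have h2 : ‖∑ i, consensusDir M x i‖ ≤ 2 * sqDist x z := by
    rw [h1, norm_neg]
    refine (norm_sum_le _ _).trans ?_
    refine (Finset.sum_le_sum fun i _ => norm_consensusDir_remainder_le h hx i).trans ?_
    rw [← Finset.mul_sum]
    linarith [h.sum_mul_norm_sub_sq_le x z]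
  rw [mean, norm_smul, Real.norm_of_nonneg (by positivity)]
  calc 1 / (n : ℝ) * ‖∑ i, consensusDir M x i‖ ≤ 1 / (n : ℝ) * (2 * sqDist x z) := by gcongr
    _ = _ := by ring

lemma sum_norm_consensusDir_sq_le_sqDist (h : IsSymmStochastic M) (hx : ∀ i, x i ∈ stiefel d r)
    (hℓ : 1 - sortedEigenvalue M (n - 1) ≤ 2) (z : Mat d r) :
    ∑ i, ‖consensusDir M x i‖ ^ 2 ≤ 4 * sqDist x z := by
  have h1 := sum_norm_consensusDir_sq_le h hx
  have h2 : energy M x ≤ 4 * sqDist x z := h.sum_mul_norm_sub_sq_le x z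
  have h3 := energy_nonneg (x := x) h
  nlinarith

lemma norm_sub_le_two_mul {δ : ℝ} (hδ : ∀ i, ‖x i - z‖ ≤ δ) (i j : Fin n) :
    ‖x i - x j‖ ≤ 2 * δ := by
  have h1 := norm_sub_le_norm_sub_add_norm_sub (x i) z (x j)
  rw [norm_sub_rev z] at h1
  linarith [hδ i, hδ j]

lemma norm_consensusDir_le (h : IsSymmStochastic M) (hx : ∀ i, x i ∈ stiefel d r) {δ : ℝ}
    (hδ : ∀ i, ‖x i - z‖ ≤ δ) (i : Fin n) : ‖consensusDir M x i‖ ≤ 2 * δ := by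
  refine (norm_tangentProj_le (hx i) _).trans ?_
  rw [h.sub_mix]
  refine (norm_sum_le _ _).trans ?_
  calc ∑ j, ‖M i j • (x i - x j)‖ ≤ ∑ j, M i j * (2 * δ) := by
        refine Finset.sum_le_sum fun j _ => ?_
        rw [norm_smul, Real.norm_of_nonneg (h.nonneg i j)]
        exact mul_le_mul_of_nonneg_left (norm_sub_le_two_mul hδ i j) (h.nonneg i j)
    _ = 2 * δ := by rw [← Finset.sum_mul, h.row_sum, one_mul]

/-- The blockwise distance to the induced mean after a consensus step. -/
lemma norm_consensus_step_le (h : IsSymmStochastic M) (hx : ∀ i, x i ∈ stiefel d r)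
    {δ η α : ℝ} (hδ : ∀ i, ‖x i - z‖ ≤ δ) (hα : 0 ≤ α) (hα1 : α ≤ 1) (i : Fin n)
    (hη : ‖mix M (fun j => x j - mean x) i‖ ≤ η) :
    ‖x i - α • consensusDir M x i - z‖ ≤
      (1 - α) * δ + α * (‖mean x - z‖ + η + 2 * δ ^ 2) := by
  set R := ∑ j, M i j • (x i * ((1 / 2 : ℝ) • ((x i - x j)ᵀ * (x i - x j)))) with hR
  have h1 : x i - α • consensusDir M x i - z =
      (1 - α) • (x i - z) + α • ((mean x - z) + mix M (fun j => x j - mean x) i + R) := by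
    rw [consensusDir_eq_sub h hx, mix_sub, h.mix_const]
    module
  have h2 : ‖R‖ ≤ 2 * δ ^ 2 := by
    refine (norm_consensusDir_remainder_le h hx i).trans ?_
    have h3 : ∑ j, M i j * ‖x i - x j‖ ^ 2 ≤ ∑ j, M i j * (2 * δ) ^ 2 :=
      Finset.sum_le_sum fun j _ => mul_le_mul_of_nonneg_left
        (pow_le_pow_left₀ (norm_nonneg _) (norm_sub_le_two_mul hδ i j) 2) (h.nonneg i j)
    rw [← Finset.sum_mul, h.row_sum] at h3
    linarith
  rw [h1]
  refine (norm_add_le _ _).trans ?_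
  rw [norm_smul, norm_smul, Real.norm_of_nonneg (by linarith), Real.norm_of_nonneg hα]
  have h4 := norm_add₃_le (a := mean x - z) (b := mix M (fun j => x j - mean x) i) (c := R)
  exact add_le_add (mul_le_mul_of_nonneg_left (hδ i) (by linarith))
    (mul_le_mul_of_nonneg_left (by linarith) hα)

end Consensus

/-! ### Smooth functions on the Stiefel manifold -/

section Smooth

variable {n d r : ℕ} {f : Mat d r → ℝ} {L Ln : ℝ} {x y : Mat d r}

/-- The descent inequality for a function with Lipschitz gradient. -/
lemma le_add_inner_egrad (hf : Differentiable ℝ f)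
    (hlip : ∀ x y, ‖egrad f x - egrad f y‖ ≤ L * ‖x - y‖) (x y : Mat d r) :
    f y ≤ f x + inner ℝ (egrad f x) (y - x) + L / 2 * ‖y - x‖ ^ 2 := by
  set v := y - x with hv
  set φ : ℝ → ℝ := fun τ => f (x + τ • v) - τ * inner ℝ (egrad f x) v - L / 2 * ‖v‖ ^ 2 * τ ^ 2
    with hφ
  have hline : ∀ τ : ℝ, HasDerivAt (fun τ : ℝ => x + τ • v) v τ := by
    intro τ
    have h := ((hasDerivAt_id τ).smul_const v).const_add x
    rw [one_smul] at h
    exact h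
  have hder : ∀ τ : ℝ, HasDerivAt φ (inner ℝ (egrad f (x + τ • v)) v -
      inner ℝ (egrad f x) v - L * ‖v‖ ^ 2 * τ) τ := by
    intro τ
    have h1 : HasDerivAt (fun τ : ℝ => f (x + τ • v)) (inner ℝ (egrad f (x + τ • v)) v) τ := by
      rw [inner_egrad]
      exact (hf (x + τ • v)).hasFDerivAt.comp_hasDerivAt τ (hline τ)
    have h2 := (h1.sub ((hasDerivAt_id τ).mul_const (inner ℝ (egrad f x) v))).sub
      ((hasDerivAt_pow 2 τ).const_mul (L / 2 * ‖v‖ ^ 2))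
    refine h2.congr_deriv ?_
    push_cast
    ring
  have hanti : AntitoneOn φ (Set.Icc 0 1) := by
    refine antitoneOn_of_deriv_nonpos (convex_Icc 0 1)
      (fun τ _ => (hder τ).continuousAt.continuousWithinAt)
      (fun τ _ => (hder τ).differentiableAt.differentiableWithinAt) fun τ hτ => ?_
    rw [interior_Icc] at hτ
    rw [(hder τ).deriv, ← inner_sub_left]
    have h1 := real_inner_le_norm (egrad f (x + τ • v) - egrad f x) v
    have h2 := hlip (x + τ • v) x
    rw [add_sub_cancel_left, norm_smul, Real.norm_of_nonneg hτ.1.le] at h2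
    have h3 := mul_le_mul_of_nonneg_right h2 (norm_nonneg v)
    linarith
  have h01 := hanti (Set.left_mem_Icc.2 zero_le_one) (Set.right_mem_Icc.2 zero_le_one) zero_le_one
  simp only [hφ, one_smul, zero_smul, add_zero, hv, add_sub_cancel] at h01
  linarith

/-- The descent inequality on the Stiefel manifold, with the Riemannian gradient: its normal part
costs a term of second order. -/
lemma le_add_inner_rgrad (hf : Differentiable ℝ f)
    (hlip : ∀ x y, ‖egrad f x - egrad f y‖ ≤ L * ‖x - y‖)
    (hLn : specNorm (egrad f x) ≤ Ln) (hx : x ∈ stiefel d r) (hy : y ∈ stiefel d r) :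
    f y ≤ f x + inner ℝ (rgrad f x) (y - x) + (L + 2 * Ln) / 2 * ‖y - x‖ ^ 2 := by
  have h1 := le_add_inner_egrad hf hlip x y
  set g := egrad f x with hg
  have h2 : inner ℝ g (y - x) = inner ℝ (rgrad f x) (y - x) +
      1 / 2 * inner ℝ (x * (xᵀ * g + gᵀ * x)) (y - x) := by
    rw [rgrad, tangentProj, ← hg, inner_sub_left, real_inner_smul_left]
    ring
  have h3 : inner ℝ (x * (xᵀ * g + gᵀ * x)) (y - x) =
      -(1 / 2 * inner ℝ ((x - y)ᵀ * (x - y)) (xᵀ * g + gᵀ * x)) := by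
    rw [← inner_sub_stiefel_mul hx hy (tangency_symm x g), ← neg_sub x y, inner_neg_right,
      real_inner_comm]
  have h4 := abs_le.1 (abs_real_inner_le_norm ((x - y)ᵀ * (x - y)) (xᵀ * g + gᵀ * x))
  -- `⟨(x - y)ᵀ (x - y), xᵀ g⟩ = ⟨x - y, (x - y) xᵀ g⟩` is bounded by the spectral norm of `g`.
  have h5 : -inner ℝ ((x - y)ᵀ * (x - y)) (xᵀ * g + gᵀ * x) ≤ 2 * Ln * ‖x - y‖ ^ 2 := by
    have h6 : inner ℝ ((x - y)ᵀ * (x - y)) (gᵀ * x) = inner ℝ ((x - y)ᵀ * (x - y)) (xᵀ * g) := by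
      rw [← inner_transpose, Matrix.transpose_mul, Matrix.transpose_mul,
        Matrix.transpose_transpose, Matrix.transpose_transpose]
    have h7 : inner ℝ ((x - y)ᵀ * (x - y)) (xᵀ * g) =
        inner ℝ (x - y) ((x - y) * (xᵀ * g)) := by
      rw [inner_mul_left, Matrix.transpose_transpose]
    have h8 : ‖(x - y) * (xᵀ * g)‖ ≤ Ln * ‖x - y‖ := by
      rw [← Matrix.mul_assoc]
      refine (norm_mul_le_specNorm_right _ _).trans ?_
      rw [norm_mul_stiefel_transpose hx]
      exact mul_le_mul_of_nonneg_right hLn (norm_nonneg _)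
    have h9 := (abs_le.1 (abs_real_inner_le_norm (x - y) ((x - y) * (xᵀ * g)))).1
    rw [inner_add_right, h6, h7]
    nlinarith [norm_nonneg (x - y)]
  rw [norm_sub_rev x y] at h5
  have hLn0 : 0 ≤ Ln := (specNorm_nonneg _).trans hLn
  nlinarith [sq_nonneg ‖y - x‖, mul_nonneg hLn0 (sq_nonneg ‖y - x‖)]

/-- The Riemannian gradient is Lipschitz on the Stiefel manifold. -/
lemma norm_rgrad_sub_le (hlip : ∀ x y, ‖egrad f x - egrad f y‖ ≤ L * ‖x - y‖)
    (hLn : specNorm (egrad f y) ≤ Ln) (hx : x ∈ stiefel d r) (hy : y ∈ stiefel d r) :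
    ‖rgrad f x - rgrad f y‖ ≤ (L + 2 * Ln) * ‖x - y‖ := by
  have h1 : rgrad f x - rgrad f y = tangentProj x (egrad f x - egrad f y) +
      (tangentProj x (egrad f y) - tangentProj y (egrad f y)) := by
    rw [rgrad, rgrad, tangentProj_sub]
    abel
  rw [h1]
  refine (norm_add_le _ _).trans ?_
  have h2 := (norm_tangentProj_le hx (egrad f x - egrad f y)).trans (hlip x y)
  have h3 := norm_tangentProj_sub_le hx hy (egrad f y)
  have h4 := mul_le_mul_of_nonneg_right hLn (norm_nonneg (x - y))
  linarith

lemma egrad_objective {f : Fin n → Mat d r → ℝ} (hf : ∀ i, Differentiable ℝ (f i))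
    (x : Mat d r) : egrad (objective f) x = mean fun i => egrad (f i) x := by
  ext a b
  have h1 : fderiv ℝ (objective f) x = (1 / (n : ℝ)) • ∑ i, fderiv ℝ (f i) x := by
    have h2 : HasFDerivAt (objective f) ((1 / (n : ℝ)) • ∑ i, fderiv ℝ (f i) x) x :=
      (HasFDerivAt.fun_sum fun i (_ : i ∈ Finset.univ) =>
        (hf i x).hasFDerivAt).const_mul (1 / (n : ℝ))
    exact h2.fderiv
  rw [egrad, Matrix.of_apply, h1]
  simp [mean, egrad, Matrix.sum_apply]

lemma rgrad_objective {f : Fin n → Mat d r → ℝ} (hf : ∀ i, Differentiable ℝ (f i))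
    (x : Mat d r) : rgrad (objective f) x = mean fun i => rgrad (f i) x := by
  rw [rgrad, egrad_objective hf, mean, tangentProj_smul, tangentProj_sum, mean]
  rfl

lemma bddBelow_objective {f : Fin n → Mat d r → ℝ} (hf : ∀ i, Differentiable ℝ (f i)) :
    BddBelow (objective f '' stiefel d r) := by
  have hcont : Continuous (objective f) :=
    continuous_const.mul (continuous_finsetSum _ fun i _ => (hf i).continuous)
  have hcomp : IsCompact (stiefel d r) := by
    have hclosed : IsClosed (stiefel d r) :=
      isClosed_eq (by fun_prop) continuous_const
    refine Metric.isCompact_of_isClosed_isBounded hclosed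
      (isBounded_iff_forall_norm_le.2 ⟨‖(1 : Matrix (Fin r) (Fin r) ℝ)‖, fun x hx => ?_⟩)
    have h := norm_stiefel_mul hx (1 : Matrix (Fin r) (Fin r) ℝ)
    rw [Matrix.mul_one] at h
    exact h.le
  exact (hcomp.image hcont).bddBelow

lemma optValue_le {f : Fin n → Mat d r → ℝ} (hf : ∀ i, Differentiable ℝ (f i))
    (hx : x ∈ stiefel d r) : optValue f ≤ objective f x :=
  csInf_le (bddBelow_objective hf) (Set.mem_image_of_mem _ hx)

end Smooth

/-! ### One iteration -/

section Iteration

lemma add_sq_le_div_add_div {s : ℝ} (hs : 0 < s) (hs1 : s < 1) (a b : ℝ) :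
    (a + b) ^ 2 ≤ a ^ 2 / s + b ^ 2 / (1 - s) := by
  have h1 : 0 < 1 - s := by linarith
  rw [div_add_div _ _ hs.ne' h1.ne', le_div_iff₀ (mul_pos hs h1)]
  nlinarith [sq_nonneg ((1 - s) * a - s * b)]

/-- Young's inequality for a perturbed contraction. The weights are chosen so that the contraction
factor `s²` only degrades to `s`. -/
lemma sum_norm_add_sq_le {n d r : ℕ} {a b : Fin n → Mat d r} {s q : ℝ} (hs : 0 ≤ s)
    (hs1 : s < 1) (ha : ∑ i, ‖a i‖ ^ 2 ≤ s ^ 2 * q) :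
    ∑ i, ‖a i + b i‖ ^ 2 ≤ s * q + (∑ i, ‖b i‖ ^ 2) / (1 - s) := by
  rcases eq_or_lt_of_le hs with h0 | h0
  · subst h0
    rw [zero_pow two_ne_zero, zero_mul] at ha
    have h1 := (Finset.sum_eq_zero_iff_of_nonneg (fun i _ => sq_nonneg ‖a i‖)).1
      (le_antisymm ha (Finset.sum_nonneg fun i _ => sq_nonneg ‖a i‖))
    have h2 : ∀ i, a i = 0 := fun i =>
      norm_eq_zero.1 (pow_eq_zero_iff two_ne_zero |>.1 (h1 i (Finset.mem_univ i)))
    simp [h2]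
  · have h1 : ∀ i, ‖a i + b i‖ ^ 2 ≤ ‖a i‖ ^ 2 / s + ‖b i‖ ^ 2 / (1 - s) := fun i =>
      (pow_le_pow_left₀ (norm_nonneg _) (norm_add_le _ _) 2).trans
        (add_sq_le_div_add_div h0 hs1 _ _)
    refine (Finset.sum_le_sum fun i _ => h1 i).trans ?_
    rw [Finset.sum_add_distrib, ← Finset.sum_div, ← Finset.sum_div]
    have h2 : (∑ i, ‖a i‖ ^ 2) / s ≤ s * q := by
      rw [div_le_iff₀ h0]
      linarith
    linarith

/-- Mean squared norm of `n` matrices. -/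
def meanSq {n d r : ℕ} (y : Fin n → Mat d r) : ℝ := (1 / (n : ℝ)) * ∑ i, ‖y i‖ ^ 2

/-- Mean squared distance of `n` matrices to a point. -/
def meanSqDist {n d r : ℕ} (x : Fin n → Mat d r) (z : Mat d r) : ℝ := (1 / (n : ℝ)) * sqDist x z

/-- The properties of the mixing matrix, the local functions and the parameters which drive one
iteration: `s` is the mixing factor of `M`, `ρ` the contraction factor of a consensus step in the
local region, `LG` a Lipschitz constant of the Riemannian gradients, and `D` a bound for them. -/
structure Regime {n d r : ℕ} (M : Matrix (Fin n) (Fin n) ℝ) (f : Fin n → Mat d r → ℝ)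
    (s ρ LG D δ₁ δ₂ α β : ℝ) : Prop where
  two_le : 2 ≤ n
  stoch : IsSymmStochastic M
  s_nonneg : 0 ≤ s
  s_le : s ≤ 1 / (2 * √(n : ℝ))
  mixing : ∀ x : Fin n → Mat d r, ∑ i, x i = 0 →
    ∑ i, ‖mix M x i‖ ^ 2 ≤ s ^ 2 * ∑ i, ‖x i‖ ^ 2
  lap_le : 1 - sortedEigenvalue M (n - 1) ≤ 2
  ρ_pos : 0 < ρ
  ρ_lt : ρ < 1
  contraction : ∀ (x : Fin n → Mat d r) (z : Mat d r), (∀ i, x i ∈ stiefel d r) → IsIAM x z →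
    meanSqDist x z ≤ δ₁ ^ 2 → (∀ i, ‖x i - z‖ ≤ δ₂) →
    ∑ i, ‖x i - α • consensusDir M x i - z‖ ^ 2 ≤ ρ ^ 2 * sqDist x z
  LG_pos : 0 < LG
  D_nonneg : 0 ≤ D
  bound : ∀ i, ∀ x ∈ stiefel d r, ‖rgrad (f i) x‖ ≤ D
  lipschitz : ∀ i, ∀ x ∈ stiefel d r, ∀ y ∈ stiefel d r,
    ‖rgrad (f i) x - rgrad (f i) y‖ ≤ LG * ‖x - y‖
  descent : ∀ i, ∀ x ∈ stiefel d r, ∀ y ∈ stiefel d r,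
    f i y ≤ f i x + inner ℝ (rgrad (f i) x) (y - x) + LG / 2 * ‖y - x‖ ^ 2
  δ₁_pos : 0 < δ₁
  δ₁_le : 5 * δ₁ ≤ δ₂
  δ₂_le : δ₂ ≤ 1 / 6
  α_pos : 0 < α
  α_le : α ≤ 1
  β_pos : 0 < β
  β_le_ρ : β * (LG + 2 * D) ≤ (1 - ρ) * δ₁
  β_le_α : β * (LG + 2 * D) ≤ α * δ₁ / 5
  β_le_LG : β * LG ≤ 1 / 8

/-- The invariants of the iteration: the points lie in the local region around their induced mean,
the trackers are bounded, and the mean of the trackers is the mean of the gradients. -/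
structure Invariant {n d r : ℕ} (f : Fin n → Mat d r → ℝ) (LG D δ₁ δ₂ : ℝ)
    (x y : Fin n → Mat d r) (xbar : Mat d r) : Prop where
  mem : ∀ i, x i ∈ stiefel d r
  iam : IsIAM x xbar
  meanSqDist_le : meanSqDist x xbar ≤ δ₁ ^ 2
  dist_le : ∀ i, ‖x i - xbar‖ ≤ δ₂
  tracker_le : ∀ i, ‖y i‖ ≤ LG + 2 * D
  mean_tracker : mean y = mean fun i => rgrad (f i) (x i)

variable {n d r : ℕ} {M : Matrix (Fin n) (Fin n) ℝ} {f : Fin n → Mat d r → ℝ}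
  {s ρ LG D δ₁ δ₂ α β : ℝ} {x y : Fin n → Mat d r} {xbar xbar' : Mat d r}

/-- The tangent vector along which the `i`-th point moves. -/
def moveDir (M : Matrix (Fin n) (Fin n) ℝ) (α β : ℝ) (x y : Fin n → Mat d r) (i : Fin n) :
    Mat d r :=
  -(α • consensusDir M x i) - β • tangentProj (x i) (y i)

/-- The points after one iteration. -/
def nextPoint (M : Matrix (Fin n) (Fin n) ℝ) (α β : ℝ) (x y : Fin n → Mat d r) (i : Fin n) :
    Mat d r :=
  polarRetraction (x i) (moveDir M α β x y i)

/-- The trackers after one iteration. -/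
def nextTracker (M : Matrix (Fin n) (Fin n) ℝ) (f : Fin n → Mat d r → ℝ) (α β : ℝ)
    (x y : Fin n → Mat d r) (i : Fin n) : Mat d r :=
  mix M y i + rgrad (f i) (nextPoint M α β x y i) - rgrad (f i) (x i)

lemma meanSq_nonneg (y : Fin n → Mat d r) : 0 ≤ meanSq y :=
  mul_nonneg (by positivity) (Finset.sum_nonneg fun _ _ => sq_nonneg _)

lemma meanSqDist_nonneg (x : Fin n → Mat d r) (z : Mat d r) : 0 ≤ meanSqDist x z :=
  mul_nonneg (by positivity) (sqDist_nonneg _ _)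

lemma moveDir_tangent (hx : ∀ i, x i ∈ stiefel d r) (i : Fin n) :
    (x i)ᵀ * moveDir M α β x y i + (moveDir M α β x y i)ᵀ * x i = 0 := by
  have h : moveDir M α β x y i =
      tangentProj (x i) (-(α • (x i - mix M x i)) - β • y i) := by
    rw [tangentProj_sub, tangentProj_smul, ← neg_smul, tangentProj_smul, neg_smul]
    rfl
  rw [h]
  exact tangentProj_tangent (hx i) _

lemma nextPoint_mem (hx : ∀ i, x i ∈ stiefel d r) (i : Fin n) :
    nextPoint M α β x y i ∈ stiefel d r :=
  polarRetraction_mem (hx i) (moveDir_tangent hx i)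

lemma norm_nextPoint_sub_le (hx : ∀ i, x i ∈ stiefel d r) (i : Fin n) :
    ‖nextPoint M α β x y i - x i‖ ≤ ‖moveDir M α β x y i‖ :=
  norm_polarRetraction_sub_self_le (hx i) (moveDir_tangent hx i)

/-- The gradient-tracking property: the mean of the trackers is the mean of the gradients. -/
lemma mean_nextTracker (h : IsSymmStochastic M)
    (hy : mean y = mean fun i => rgrad (f i) (x i)) :
    mean (nextTracker M f α β x y) =
      mean fun i => rgrad (f i) (nextPoint M α β x y i) := by
  have h1 : mean (nextTracker M f α β x y) =
      mean (fun i => mix M y i + rgrad (f i) (nextPoint M α β x y i)) -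
        mean fun i => rgrad (f i) (x i) := mean_sub _ _
  rw [h1, mean_add, h.mean_mix, hy]
  abel

/-- The means move by the mean of the tangent vectors, up to second order. -/
lemma norm_mean_nextPoint_sub_le (hx : ∀ i, x i ∈ stiefel d r) :
    ‖mean (nextPoint M α β x y) - mean x - mean (moveDir M α β x y)‖ ≤
      1 / 2 * meanSq (moveDir M α β x y) := by
  rw [← mean_sub, ← mean_sub]
  refine (norm_mean_le _).trans ?_
  have h1 : ∑ i, ‖nextPoint M α β x y i - x i - moveDir M α β x y i‖ ≤
      1 / 2 * ∑ i, ‖moveDir M α β x y i‖ ^ 2 := by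
    rw [Finset.mul_sum]
    exact Finset.sum_le_sum fun i _ =>
      norm_polarRetraction_sub_add_le (hx i) (moveDir_tangent hx i)
  have h2 := mul_le_mul_of_nonneg_left h1 (show 0 ≤ 1 / (n : ℝ) by positivity)
  rw [meanSq]
  linarith

lemma mean_moveDir :
    mean (moveDir M α β x y) = -(α • mean (consensusDir M x)) -
      β • mean fun i => tangentProj (x i) (y i) := by
  have h1 : moveDir M α β x y = fun i =>
      (-α) • consensusDir M x i - β • tangentProj (x i) (y i) := by
    ext1 i; rw [moveDir, neg_smul]
  rw [h1, mean_sub, mean_smul, mean_smul, neg_smul]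

namespace Regime

variable (H : Regime M f s ρ LG D δ₁ δ₂ α β)
include H

lemma n_pos : (0 : ℝ) < n := by
  have := H.two_le
  exact_mod_cast (by omega : 0 < n)

lemma n_ne_zero : n ≠ 0 := by
  have := H.two_le
  omega

lemma s_sq_le : s ^ 2 * (4 * n) ≤ 1 := by
  have hn := H.n_pos
  have h1 := pow_le_pow_left₀ H.s_nonneg H.s_le 2
  have h2 : (1 / (2 * √(n : ℝ))) ^ 2 = 1 / (4 * n) := by
    rw [div_pow, mul_pow, Real.sq_sqrt hn.le]
    norm_num
  rw [h2, le_div_iff₀ (by positivity)] at h1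
  exact h1

/-- Since `n ≥ 2`, the mixing factor satisfies `s² ≤ 1/8`. -/
lemma s_le_two_fifths : s ≤ 2 / 5 := by
  have h1 := H.s_sq_le
  have h2 : (2 : ℝ) ≤ n := by exact_mod_cast H.two_le
  nlinarith [sq_nonneg s, H.s_nonneg]

lemma δ₁_le' : δ₁ ≤ 1 / 30 := by
  have := H.δ₁_le
  have := H.δ₂_le
  linarith

lemma meanSq_moveDir_le (hx : ∀ i, x i ∈ stiefel d r) (z : Mat d r) :
    meanSq (moveDir M α β x y) ≤ 8 * α ^ 2 * meanSqDist x z + 2 * β ^ 2 * meanSq y := by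
  have h1 : ∀ i, ‖moveDir M α β x y i‖ ^ 2 ≤
      2 * α ^ 2 * ‖consensusDir M x i‖ ^ 2 + 2 * β ^ 2 * ‖y i‖ ^ 2 := by
    intro i
    have h2 : ‖moveDir M α β x y i‖ ≤ α * ‖consensusDir M x i‖ + β * ‖y i‖ := by
      refine (norm_sub_le _ _).trans ?_
      rw [norm_neg, norm_smul, norm_smul, Real.norm_of_nonneg H.α_pos.le,
        Real.norm_of_nonneg H.β_pos.le]
      have := mul_le_mul_of_nonneg_left (norm_tangentProj_le (hx i) (y i)) H.β_pos.le
      linarith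
    have h3 := pow_le_pow_left₀ (norm_nonneg _) h2 2
    nlinarith [sq_nonneg (α * ‖consensusDir M x i‖ - β * ‖y i‖)]
  have h2 := Finset.sum_le_sum fun i (_ : i ∈ Finset.univ) => h1 i
  rw [Finset.sum_add_distrib, ← Finset.mul_sum, ← Finset.mul_sum] at h2
  have h3 := sum_norm_consensusDir_sq_le_sqDist H.stoch hx H.lap_le z
  have h4 : ∑ i, ‖moveDir M α β x y i‖ ^ 2 ≤
      8 * α ^ 2 * sqDist x z + 2 * β ^ 2 * ∑ i, ‖y i‖ ^ 2 := by
    nlinarith [mul_le_mul_of_nonneg_left h3 (sq_nonneg α)]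
  have h5 := mul_le_mul_of_nonneg_left h4 (show 0 ≤ 1 / (n : ℝ) by positivity)
  rw [meanSq, meanSq, meanSqDist]
  linarith

/-- The consensus error contracts up to the size of the trackers. -/
lemma meanSqDist_nextPoint_le (hI : Invariant f LG D δ₁ δ₂ x y xbar)
    (hI' : IsIAM (nextPoint M α β x y) xbar') :
    meanSqDist (nextPoint M α β x y) xbar' ≤
      ρ * meanSqDist x xbar + β ^ 2 * meanSq y / (1 - ρ) := by
  have h1 : sqDist (nextPoint M α β x y) xbar' ≤
      ∑ i, ‖(x i - α • consensusDir M x i - xbar) + -(β • tangentProj (x i) (y i))‖ ^ 2 := by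
    refine (hI'.2 xbar hI.iam.1).trans (Finset.sum_le_sum fun i _ => ?_)
    have h2 := norm_polarRetraction_sub_le (hI.mem i)
      (moveDir_tangent (M := M) (α := α) (β := β) (y := y) hI.mem i) hI.iam.1
    have h3 : x i + moveDir M α β x y i - xbar =
        (x i - α • consensusDir M x i - xbar) + -(β • tangentProj (x i) (y i)) := by
      rw [moveDir]; abel
    rw [h3] at h2
    exact pow_le_pow_left₀ (norm_nonneg _) h2 2
  have h2 := sum_norm_add_sq_le (b := fun i => -(β • tangentProj (x i) (y i))) H.ρ_pos.le H.ρ_lt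
    (H.contraction x xbar hI.mem hI.iam hI.meanSqDist_le hI.dist_le)
  have h3 : ∑ i, ‖-(β • tangentProj (x i) (y i))‖ ^ 2 ≤ β ^ 2 * ∑ i, ‖y i‖ ^ 2 := by
    rw [Finset.mul_sum]
    refine Finset.sum_le_sum fun i _ => ?_
    rw [norm_neg, norm_smul, mul_pow, Real.norm_eq_abs, sq_abs]
    exact mul_le_mul_of_nonneg_left
      (pow_le_pow_left₀ (norm_nonneg _) (norm_tangentProj_le (hI.mem i) _) 2) (sq_nonneg β)
  have h4 : (∑ i, ‖-(β • tangentProj (x i) (y i))‖ ^ 2) / (1 - ρ) ≤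
      β ^ 2 * (∑ i, ‖y i‖ ^ 2) / (1 - ρ) :=
    div_le_div_of_nonneg_right h3 (by linarith [H.ρ_lt])
  have h5 := mul_le_mul_of_nonneg_left (h1.trans (h2.trans (add_le_add le_rfl h4)))
    (show 0 ≤ 1 / (n : ℝ) by positivity)
  refine h5.trans_eq ?_
  rw [meanSq, meanSqDist]
  ring

lemma meanSq_tracker_le (hI : Invariant f LG D δ₁ δ₂ x y xbar) :
    meanSq y ≤ (LG + 2 * D) ^ 2 :=
  mean_le_of_forall_le H.n_ne_zero fun i =>
    pow_le_pow_left₀ (norm_nonneg _) (hI.tracker_le i) 2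

lemma sq_mul_meanSq_tracker_le (hI : Invariant f LG D δ₁ δ₂ x y xbar) :
    β ^ 2 * meanSq y ≤ (β * (LG + 2 * D)) ^ 2 := by
  rw [mul_pow]
  exact mul_le_mul_of_nonneg_left (H.meanSq_tracker_le hI) (sq_nonneg β)

lemma step_nonneg : 0 ≤ β * (LG + 2 * D) := by
  have h1 := H.β_pos
  have h2 := H.LG_pos
  have h3 := H.D_nonneg
  positivity

/-- The gradient-tracking error contracts up to the size of the moves. -/
lemma tracking_le (hx : ∀ i, x i ∈ stiefel d r) :
    meanSqDist (nextTracker M f α β x y) (mean (nextTracker M f α β x y)) ≤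
      s * meanSqDist y (mean y) + LG ^ 2 * meanSq (moveDir M α β x y) / (1 - s) := by
  set Δ : Fin n → Mat d r := fun i =>
    rgrad (f i) (nextPoint M α β x y i) - rgrad (f i) (x i) with hΔ
  have hs1 : s < 1 := by linarith [H.s_le_two_fifths]
  have h1 : ∀ i, nextTracker M f α β x y i = mix M y i + Δ i := fun i => add_sub_assoc _ _ _
  have h2 : mean (nextTracker M f α β x y) = mean y + mean Δ := by
    rw [funext h1, mean_add, H.stoch.mean_mix]
  have h3 : ∀ i, nextTracker M f α β x y i - mean (nextTracker M f α β x y) =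
      mix M (fun j => y j - mean y) i + (Δ i - mean Δ) := by
    intro i
    rw [h1, h2, mix_sub, H.stoch.mix_const]
    abel
  have h4 : ∑ i, (y i - mean y) = 0 := by
    rw [Finset.sum_sub_distrib, ← smul_mean H.n_ne_zero y, Finset.sum_const, Finset.card_univ,
      Fintype.card_fin, Nat.cast_smul_eq_nsmul, sub_self]
  have h5 := sum_norm_add_sq_le (b := fun i => Δ i - mean Δ) H.s_nonneg hs1
    (H.mixing _ h4)
  have h6 : ∑ i, ‖Δ i - mean Δ‖ ^ 2 ≤ LG ^ 2 * ∑ i, ‖moveDir M α β x y i‖ ^ 2 := by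
    have h7 := sqDist_eq_add H.n_ne_zero Δ 0
    have h8 : sqDist Δ 0 ≤ LG ^ 2 * ∑ i, ‖moveDir M α β x y i‖ ^ 2 := by
      rw [Finset.mul_sum]
      refine Finset.sum_le_sum fun i _ => ?_
      rw [sub_zero, ← mul_pow]
      refine pow_le_pow_left₀ (norm_nonneg _) ?_ 2
      exact (H.lipschitz i _ (nextPoint_mem hx i) _ (hx i)).trans
        (mul_le_mul_of_nonneg_left (norm_nextPoint_sub_le hx i) H.LG_pos.le)
    have h9 : 0 ≤ (n : ℝ) * ‖mean Δ - 0‖ ^ 2 := by positivity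
    change sqDist Δ (mean Δ) ≤ _
    linarith
  have h7 : (∑ i, ‖Δ i - mean Δ‖ ^ 2) / (1 - s) ≤
      LG ^ 2 * (∑ i, ‖moveDir M α β x y i‖ ^ 2) / (1 - s) :=
    div_le_div_of_nonneg_right h6 (by linarith)
  have h8 : sqDist (nextTracker M f α β x y) (mean (nextTracker M f α β x y)) ≤
      s * sqDist y (mean y) + LG ^ 2 * (∑ i, ‖moveDir M α β x y i‖ ^ 2) / (1 - s) := by
    rw [sqDist]
    simp only [h3]
    refine h5.trans ?_
    rw [sqDist]
    linarith
  have h9 := mul_le_mul_of_nonneg_left h8 (show 0 ≤ 1 / (n : ℝ) by positivity)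
  refine h9.trans_eq ?_
  rw [meanSq, meanSqDist]
  ring

end Regime

end Iteration

/-! ### Invariance of the local region -/

section Invariance

variable {n d r : ℕ} {M : Matrix (Fin n) (Fin n) ℝ} {f : Fin n → Mat d r → ℝ}
  {s ρ LG D δ₁ δ₂ α β : ℝ} {x y : Fin n → Mat d r} {xbar xbar' : Mat d r}

namespace Regime

variable (H : Regime M f s ρ LG D δ₁ δ₂ α β)
include H

lemma meanSqDist_nextPoint_le_sq (hI : Invariant f LG D δ₁ δ₂ x y xbar)
    (hI' : IsIAM (nextPoint M α β x y) xbar') :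
    meanSqDist (nextPoint M α β x y) xbar' ≤ δ₁ ^ 2 := by
  have h1 := H.meanSqDist_nextPoint_le hI hI'
  have h2 := H.sq_mul_meanSq_tracker_le hI
  have hρ : 0 < 1 - ρ := by linarith [H.ρ_lt]
  have h3 : (β * (LG + 2 * D)) ^ 2 ≤ ((1 - ρ) * δ₁) ^ 2 :=
    pow_le_pow_left₀ H.step_nonneg H.β_le_ρ 2
  have h4 : β ^ 2 * meanSq y / (1 - ρ) ≤ (1 - ρ) * δ₁ ^ 2 := by
    rw [div_le_iff₀ hρ]
    linarith
  have h5 := mul_le_mul_of_nonneg_left hI.meanSqDist_le H.ρ_pos.le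
  linarith

/-- The moves are of size at most a multiple of `α δ₁` in quadratic mean. -/
lemma meanSq_moveDir_le' (hI : Invariant f LG D δ₁ δ₂ x y xbar) :
    meanSq (moveDir M α β x y) ≤ 9 * (α * δ₁) ^ 2 := by
  have h1 := H.meanSq_moveDir_le (y := y) hI.mem xbar
  have h2 := H.sq_mul_meanSq_tracker_le hI
  have h3 := pow_le_pow_left₀ H.step_nonneg H.β_le_α 2
  have h4 := mul_le_mul_of_nonneg_left hI.meanSqDist_le (sq_nonneg α)
  nlinarith [sq_nonneg (α * δ₁)]

lemma norm_mean_tangentProj_le (hI : Invariant f LG D δ₁ δ₂ x y xbar) :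
    ‖mean fun i => tangentProj (x i) (y i)‖ ≤ LG + 2 * D :=
  (norm_mean_le _).trans (mean_le_of_forall_le H.n_ne_zero fun i =>
    (norm_tangentProj_le (hI.mem i) _).trans (hI.tracker_le i))

lemma norm_mean_nextPoint_sub_mean_le (hI : Invariant f LG D δ₁ δ₂ x y xbar) :
    ‖mean (nextPoint M α β x y) - mean x‖ ≤ 9 / 20 * (α * δ₁) := by
  have h1 := norm_mean_nextPoint_sub_le (M := M) (α := α) (β := β) (y := y) hI.mem
  have h2 := H.meanSq_moveDir_le' hI
  have h3 := norm_mean_consensusDir_le H.stoch hI.mem xbar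
  have h4 := H.norm_mean_tangentProj_le hI
  have hα := H.α_pos
  have hβ := H.β_pos
  have hδ := H.δ₁_pos
  have h5 : ‖mean (moveDir M α β x y)‖ ≤ α * (2 * δ₁ ^ 2) + β * (LG + 2 * D) := by
    rw [mean_moveDir]
    refine (norm_sub_le _ _).trans ?_
    rw [norm_neg, norm_smul, norm_smul, Real.norm_of_nonneg hα.le, Real.norm_of_nonneg hβ.le]
    have h6 : ‖mean (consensusDir M x)‖ ≤ 2 * δ₁ ^ 2 :=
      h3.trans (mul_le_mul_of_nonneg_left hI.meanSqDist_le (by norm_num))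
    exact add_le_add (mul_le_mul_of_nonneg_left h6 hα.le) (mul_le_mul_of_nonneg_left h4 hβ.le)
  have h6 : ‖mean (nextPoint M α β x y) - mean x‖ ≤
      1 / 2 * meanSq (moveDir M α β x y) + ‖mean (moveDir M α β x y)‖ := by
    have := norm_add_le (mean (nextPoint M α β x y) - mean x - mean (moveDir M α β x y))
      (mean (moveDir M α β x y))
    rw [sub_add_cancel] at this
    linarith
  have h7 := H.δ₁_le'
  have h8 : (α * δ₁) ^ 2 ≤ α * δ₁ * (1 / 30) := by
    have h9 : α * δ₁ ≤ 1 * (1 / 30) := mul_le_mul H.α_le h7 hδ.le zero_le_one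
    nlinarith [mul_pos hα hδ]
  have h9 : α * δ₁ ^ 2 ≤ α * δ₁ * (1 / 30) := by
    rw [sq, ← mul_assoc]
    exact mul_le_mul_of_nonneg_left h7 (by positivity)
  have h10 := H.β_le_α
  have h11 := mul_pos hα hδ
  linarith

/-- The induced mean inherits Lipschitz dependence from the Euclidean mean; the factor is
`1 - δ₁² / 2` with `δ₁ ≤ 1/30`. -/
lemma norm_iam_sub_le_mean (hI : Invariant f LG D δ₁ δ₂ x y xbar)
    (hI' : IsIAM (nextPoint M α β x y) xbar') :
    1799 / 1800 * ‖xbar' - xbar‖ ≤ ‖mean (nextPoint M α β x y) - mean x‖ := by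
  have h1 := norm_iam_sub_le H.n_ne_zero (nextPoint_mem hI.mem) hI' hI.mem hI.iam
    (H.meanSqDist_nextPoint_le_sq hI hI') hI.meanSqDist_le
  refine le_trans (mul_le_mul_of_nonneg_right ?_ (norm_nonneg _)) h1
  have h7 := H.δ₁_le'
  have hδ := H.δ₁_pos
  nlinarith

lemma norm_iam_move_le (hI : Invariant f LG D δ₁ δ₂ x y xbar)
    (hI' : IsIAM (nextPoint M α β x y) xbar') : ‖xbar' - xbar‖ ≤ 1 / 2 * (α * δ₁) := by
  have h1 := H.norm_iam_sub_le_mean hI hI'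
  have h2 := H.norm_mean_nextPoint_sub_mean_le hI
  have h3 := mul_pos H.α_pos H.δ₁_pos
  linarith

/-- Each block of the mixed deviations is small: this is where the number of communication rounds
enters. -/
lemma norm_mix_dev_le (z : Mat d r) {v : Fin n → Mat d r} {c : ℝ} (hc : 0 ≤ c)
    (hv : meanSqDist v z ≤ c ^ 2) (i : Fin n) :
    ‖mix M (fun j => v j - mean v) i‖ ≤ c / 2 := by
  have h4 : ∑ i, (v i - mean v) = 0 := by
    rw [Finset.sum_sub_distrib, ← smul_mean H.n_ne_zero v, Finset.sum_const, Finset.card_univ,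
      Fintype.card_fin, Nat.cast_smul_eq_nsmul, sub_self]
  have h1 := H.mixing _ h4
  have h2 : ‖mix M (fun j => v j - mean v) i‖ ^ 2 ≤
      ∑ i, ‖mix M (fun j => v j - mean v) i‖ ^ 2 :=
    Finset.single_le_sum (f := fun i => ‖mix M (fun j => v j - mean v) i‖ ^ 2)
      (fun i _ => sq_nonneg _) (Finset.mem_univ i)
  have hn := H.n_pos
  have h5 : sqDist v (mean v) ≤ n * c ^ 2 := by
    have h6 := sqDist_eq_add H.n_ne_zero v z
    have h7 : 0 ≤ (n : ℝ) * ‖mean v - z‖ ^ 2 := by positivity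
    have h8 : sqDist v z ≤ n * c ^ 2 := by
      rw [meanSqDist, one_div, inv_mul_le_iff₀ hn] at hv
      exact hv
    linarith
  have h6 := mul_le_mul_of_nonneg_left h5 (sq_nonneg s)
  have h7 := mul_le_mul_of_nonneg_right H.s_sq_le (sq_nonneg c)
  refine le_of_sq_le_sq ?_ (by positivity)
  change _ ≤ s ^ 2 * sqDist v (mean v) at h1
  nlinarith

lemma norm_nextPoint_sub_iam_le (hI : Invariant f LG D δ₁ δ₂ x y xbar)
    (hI' : IsIAM (nextPoint M α β x y) xbar') (i : Fin n) :
    ‖nextPoint M α β x y i - xbar'‖ ≤ δ₂ := by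
  have hα := H.α_pos
  have hδ := H.δ₁_pos
  have h1 := norm_polarRetraction_sub_le (hI.mem i)
    (moveDir_tangent (M := M) (α := α) (β := β) (y := y) hI.mem i) hI.iam.1
  have h2 : x i + moveDir M α β x y i - xbar =
      (x i - α • consensusDir M x i - xbar) - β • tangentProj (x i) (y i) := by
    rw [moveDir]; abel
  have h3 := norm_sub_le (x i - α • consensusDir M x i - xbar) (β • tangentProj (x i) (y i))
  have h4 : ‖β • tangentProj (x i) (y i)‖ ≤ α * δ₁ / 5 := by
    rw [norm_smul, Real.norm_of_nonneg H.β_pos.le]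
    exact (mul_le_mul_of_nonneg_left ((norm_tangentProj_le (hI.mem i) _).trans (hI.tracker_le i))
      H.β_pos.le).trans H.β_le_α
  have h5 := norm_consensus_step_le H.stoch hI.mem hI.dist_le hα.le H.α_le i
    (H.norm_mix_dev_le xbar hδ.le hI.meanSqDist_le i)
  have h6 : ‖mean x - xbar‖ ≤ 1 / 2 * δ₁ ^ 2 :=
    (norm_mean_sub_iam_le H.n_ne_zero hI.mem hI.iam).trans
      (mul_le_mul_of_nonneg_left hI.meanSqDist_le (by norm_num))
  have h7 := H.norm_iam_move_le hI hI'
  have h8 : ‖nextPoint M α β x y i - xbar'‖ ≤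
      ‖nextPoint M α β x y i - xbar‖ + ‖xbar' - xbar‖ := by
    rw [norm_sub_rev xbar']
    exact norm_sub_le_norm_sub_add_norm_sub _ _ _
  rw [h2] at h1
  change ‖nextPoint M α β x y i - xbar‖ ≤ _ at h1
  have hδ₂ : 0 < δ₂ := by linarith [H.δ₁_le]
  -- the weight `α` of the consensus step pays for the perturbations, which are multiples of `α`
  have h9 : ‖mean x - xbar‖ + δ₁ / 2 + 2 * δ₂ ^ 2 + δ₁ / 5 + 1 / 2 * δ₁ ≤ δ₂ := by
    have h10 := H.δ₁_le
    have h11 := H.δ₁_le'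
    have h12 := H.δ₂_le
    nlinarith
  have h10 := mul_le_mul_of_nonneg_left h9 hα.le
  nlinarith

lemma norm_moveDir_le (hI : Invariant f LG D δ₁ δ₂ x y xbar) (i : Fin n) :
    ‖moveDir M α β x y i‖ ≤ 1 / 2 := by
  have h1 := norm_sub_le (-(α • consensusDir M x i)) (β • tangentProj (x i) (y i))
  have hα := H.α_pos
  have hδ := H.δ₁_pos
  rw [norm_neg, norm_smul, norm_smul, Real.norm_of_nonneg hα.le,
    Real.norm_of_nonneg H.β_pos.le] at h1
  have h2 := (mul_le_mul_of_nonneg_left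
    ((norm_tangentProj_le (hI.mem i) _).trans (hI.tracker_le i)) H.β_pos.le).trans H.β_le_α
  have h3 := norm_consensusDir_le H.stoch hI.mem hI.dist_le i
  have h4 : α * ‖consensusDir M x i‖ ≤ 1 * (2 * δ₂) :=
    mul_le_mul H.α_le h3 (norm_nonneg _) zero_le_one
  have h5 : α * δ₁ ≤ 1 * (1 / 30) := mul_le_mul H.α_le H.δ₁_le' hδ.le zero_le_one
  have h6 := H.δ₂_le
  change ‖moveDir M α β x y i‖ ≤ _ at h1
  linarith

lemma norm_nextTracker_le (hI : Invariant f LG D δ₁ δ₂ x y xbar) (i : Fin n) :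
    ‖nextTracker M f α β x y i‖ ≤ LG + 2 * D := by
  have hLG := H.LG_pos
  have hD := H.D_nonneg
  have h1 : nextTracker M f α β x y i = mix M (fun j => y j - mean y) i + mean y +
      (rgrad (f i) (nextPoint M α β x y i) - rgrad (f i) (x i)) := by
    rw [mix_sub, H.stoch.mix_const, nextTracker]
    abel
  have h2 : ‖mix M (fun j => y j - mean y) i‖ ≤ (LG + 2 * D) / 2 := by
    refine H.norm_mix_dev_le 0 (by linarith) ?_ i
    have h3 : meanSqDist y 0 = meanSq y := by simp [meanSqDist, meanSq, sqDist]
    rw [h3]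
    exact H.meanSq_tracker_le hI
  have h3 : ‖mean y‖ ≤ D := by
    rw [hI.mean_tracker]
    exact (norm_mean_le _).trans
      (mean_le_of_forall_le H.n_ne_zero fun i => H.bound i _ (hI.mem i))
  have h4 : ‖rgrad (f i) (nextPoint M α β x y i) - rgrad (f i) (x i)‖ ≤ LG * (1 / 2) :=
    (H.lipschitz i _ (nextPoint_mem hI.mem i) _ (hI.mem i)).trans
      (mul_le_mul_of_nonneg_left
        ((norm_nextPoint_sub_le hI.mem i).trans (H.norm_moveDir_le hI i)) hLG.le)
  rw [h1]
  refine norm_add₃_le.trans ?_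
  linarith

/-- The invariants are preserved by an iteration. -/
lemma invariant_next (hI : Invariant f LG D δ₁ δ₂ x y xbar)
    (hI' : IsIAM (nextPoint M α β x y) xbar') :
    Invariant f LG D δ₁ δ₂ (nextPoint M α β x y) (nextTracker M f α β x y) xbar' where
  mem := nextPoint_mem hI.mem
  iam := hI'
  meanSqDist_le := H.meanSqDist_nextPoint_le_sq hI hI'
  dist_le := H.norm_nextPoint_sub_iam_le hI hI'
  tracker_le := H.norm_nextTracker_le hI
  mean_tracker := mean_nextTracker H.stoch hI.mean_tracker

end Regime

end Invariance

/-! ### Descent of the objective -/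

section Descent

variable {n d r : ℕ} {M : Matrix (Fin n) (Fin n) ℝ} {f : Fin n → Mat d r → ℝ}
  {s ρ LG D δ₁ δ₂ α β : ℝ} {x y : Fin n → Mat d r} {xbar xbar' : Mat d r}

lemma meanSq_eq_add (hn : n ≠ 0) (y : Fin n → Mat d r) :
    meanSq y = meanSqDist y (mean y) + ‖mean y‖ ^ 2 := by
  have h1 := sqDist_eq_add hn y 0
  have h2 : meanSq y = 1 / (n : ℝ) * sqDist y 0 := by simp [meanSq, sqDist]
  have hn' : (n : ℝ) ≠ 0 := by exact_mod_cast hn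
  rw [h2, h1, meanSqDist, sub_zero]
  field_simp

namespace Regime

variable (H : Regime M f s ρ LG D δ₁ δ₂ α β)
include H

/-- Projecting the trackers onto the tangent spaces at the `xᵢ` instead of the one at `x̄` costs a
term of first order in the consensus error. -/
lemma inner_mean_tracker_le (hI : Invariant f LG D δ₁ δ₂ x y xbar) {g : Mat d r}
    (hg : tangentProj xbar g = g) (hgD : ‖g‖ ≤ D) :
    β * (inner ℝ g (mean y) - inner ℝ g (mean fun i => tangentProj (x i) (y i))) ≤
      LG * (β ^ 2 * meanSq y) + D ^ 2 / LG * meanSqDist x xbar := by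
  have hLG := H.LG_pos
  have hD := H.D_nonneg
  have hβ := H.β_pos
  have hi : ∀ i, β * (inner ℝ g (y i) - inner ℝ g (tangentProj (x i) (y i))) ≤
      LG * β ^ 2 * ‖y i‖ ^ 2 + D ^ 2 / LG * ‖x i - xbar‖ ^ 2 := by
    intro i
    have h1 : inner ℝ g (y i) - inner ℝ g (tangentProj (x i) (y i)) =
        inner ℝ (tangentProj xbar g - tangentProj (x i) g) (y i) := by
      rw [← inner_tangentProj_comm (hI.mem i), ← inner_sub_left, hg]
    have h2 := real_inner_le_norm (tangentProj xbar g - tangentProj (x i) g) (y i)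
    have h3 : ‖tangentProj xbar g - tangentProj (x i) g‖ ≤ 2 * D * ‖x i - xbar‖ := by
      rw [norm_sub_rev (x i)]
      refine (norm_tangentProj_sub_le hI.iam.1 (hI.mem i) g).trans ?_
      exact mul_le_mul_of_nonneg_right
        (mul_le_mul_of_nonneg_left ((specNorm_le_norm g).trans hgD) (by norm_num)) (norm_nonneg _)
    have h4 := mul_le_mul_of_nonneg_right h3 (norm_nonneg (y i))
    have h5 := mul_le_mul_of_nonneg_left (h2.trans h4) hβ.le
    rw [h1]
    refine h5.trans ?_
    have h6 := sq_nonneg (LG * β * ‖y i‖ - D * ‖x i - xbar‖)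
    have h7 : LG * β ^ 2 * ‖y i‖ ^ 2 + D ^ 2 / LG * ‖x i - xbar‖ ^ 2 =
        ((LG * β * ‖y i‖) ^ 2 + (D * ‖x i - xbar‖) ^ 2) / LG := by
      field_simp
    rw [h7, le_div_iff₀ hLG]
    nlinarith
  have h1 := Finset.sum_le_sum fun i (_ : i ∈ Finset.univ) => hi i
  rw [← Finset.mul_sum, Finset.sum_sub_distrib, Finset.sum_add_distrib, ← Finset.mul_sum,
    ← Finset.mul_sum] at h1
  have h2 := mul_le_mul_of_nonneg_left h1 (show 0 ≤ 1 / (n : ℝ) by positivity)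
  rw [inner_mean, inner_mean, meanSq, meanSqDist, sqDist]
  linarith

lemma objective_le_add_inner (hx : xbar ∈ stiefel d r) (hx' : xbar' ∈ stiefel d r) :
    objective f xbar' ≤ objective f xbar +
      inner ℝ (mean fun i => rgrad (f i) xbar) (xbar' - xbar) + LG / 2 * ‖xbar' - xbar‖ ^ 2 := by
  have h1 := Finset.sum_le_sum fun i (_ : i ∈ Finset.univ) => H.descent i xbar hx xbar' hx'
  rw [Finset.sum_add_distrib, Finset.sum_add_distrib, Finset.sum_const, Finset.card_univ,
    Fintype.card_fin, nsmul_eq_mul] at h1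
  have h2 := mul_le_mul_of_nonneg_left h1 (show 0 ≤ 1 / (n : ℝ) by positivity)
  have hn := H.n_pos
  have h3 : 1 / (n : ℝ) * ((n : ℝ) * (LG / 2 * ‖xbar' - xbar‖ ^ 2)) =
      LG / 2 * ‖xbar' - xbar‖ ^ 2 := by field_simp
  have h4 : inner ℝ (mean fun i => rgrad (f i) xbar) (xbar' - xbar) =
      1 / (n : ℝ) * ∑ i, inner ℝ (rgrad (f i) xbar) (xbar' - xbar) := by
    rw [real_inner_comm, inner_mean]
    congr 1
    exact Finset.sum_congr rfl fun i _ => real_inner_comm _ _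
  rw [mul_add, mul_add, h3] at h2
  rw [h4]
  exact h2

lemma norm_mean_rgrad_le (hx : xbar ∈ stiefel d r) :
    ‖mean fun i => rgrad (f i) xbar‖ ≤ D :=
  (norm_mean_le _).trans (mean_le_of_forall_le H.n_ne_zero fun i => H.bound i _ hx)

lemma norm_iam_move_sq_le (hI : Invariant f LG D δ₁ δ₂ x y xbar)
    (hI' : IsIAM (nextPoint M α β x y) xbar') :
    ‖xbar' - xbar‖ ^ 2 ≤ 11 / 10 * meanSq (moveDir M α β x y) := by
  have h1 := H.norm_iam_sub_le_mean hI hI'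
  have h2 : ‖mean (nextPoint M α β x y) - mean x‖ ^ 2 ≤ meanSq (moveDir M α β x y) := by
    rw [← mean_sub]
    refine (norm_mean_sq_le H.n_ne_zero _).trans ?_
    refine mul_le_mul_of_nonneg_left (Finset.sum_le_sum fun i _ => ?_) (by positivity)
    exact pow_le_pow_left₀ (norm_nonneg _) (norm_nextPoint_sub_le hI.mem i) 2
  have h3 := pow_le_pow_left₀ (by positivity) h1 2
  rw [mul_pow] at h3
  have h4 := sq_nonneg ‖xbar' - xbar‖
  linarith

/-- The displacement of the induced mean, tested against a tangent vector `g`, is at most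
`-β ⟨g, ŷ⟩` with `ŷ` the mean of the trackers, up to terms of second order: the induced means are replaced by
Euclidean means and the retraction is linearized. -/
lemma inner_iam_move_le (hI : Invariant f LG D δ₁ δ₂ x y xbar)
    (hI' : IsIAM (nextPoint M α β x y) xbar') {g : Mat d r}
    (hg : tangentProj xbar g = g) (hgD : ‖g‖ ≤ D) :
    inner ℝ g (xbar' - xbar) ≤
      D * (1 / 2 * meanSqDist (nextPoint M α β x y) xbar') + D * (5 / 2 * meanSqDist x xbar)
        + D * (1 / 2 * meanSq (moveDir M α β x y)) - β * inner ℝ g (mean y)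
        + (LG * (β ^ 2 * meanSq y) + D ^ 2 / LG * meanSqDist x xbar) := by
  have hD := H.D_nonneg
  have hα := H.α_pos
  have hE0 : 0 ≤ meanSqDist x xbar := meanSqDist_nonneg _ _
  set P : Mat d r := mean fun i => tangentProj (x i) (y i) with hP
  set w := mean (nextPoint M α β x y) - mean x - mean (moveDir M α β x y) with hw
  have hsplit : xbar' - xbar = -(mean (nextPoint M α β x y) - xbar') + (mean x - xbar) + w
      - α • mean (consensusDir M x) - β • P := by
    rw [hw, mean_moveDir]
    abel
  have hbd : ∀ v : Mat d r, ∀ c, ‖v‖ ≤ c → |inner ℝ g v| ≤ D * c := fun v c hv =>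
    (abs_real_inner_le_norm g v).trans (mul_le_mul hgD hv (norm_nonneg _) hD)
  have h1 : |inner ℝ g (mean (nextPoint M α β x y) - xbar')| ≤
      D * (1 / 2 * meanSqDist (nextPoint M α β x y) xbar') :=
    hbd _ _ (norm_mean_sub_iam_le H.n_ne_zero (nextPoint_mem hI.mem) hI')
  have h2 : |inner ℝ g (mean x - xbar)| ≤ D * (1 / 2 * meanSqDist x xbar) :=
    hbd _ _ (norm_mean_sub_iam_le H.n_ne_zero hI.mem hI.iam)
  have h3 : |inner ℝ g w| ≤ D * (1 / 2 * meanSq (moveDir M α β x y)) :=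
    hbd _ _ (norm_mean_nextPoint_sub_le hI.mem)
  have h4 : |inner ℝ g (mean (consensusDir M x))| ≤ D * (2 * meanSqDist x xbar) :=
    hbd _ _ (norm_mean_consensusDir_le H.stoch hI.mem xbar)
  have h5 := H.inner_mean_tracker_le hI hg hgD
  rw [← hP] at h5
  have h6 : -(α * inner ℝ g (mean (consensusDir M x))) ≤ D * (2 * meanSqDist x xbar) := by
    have h8 : -inner ℝ g (mean (consensusDir M x)) ≤ D * (2 * meanSqDist x xbar) :=
      neg_le.1 (abs_le.1 h4).1
    have h9 : α * (D * (2 * meanSqDist x xbar)) ≤ 1 * (D * (2 * meanSqDist x xbar)) :=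
      mul_le_mul_of_nonneg_right H.α_le (by positivity)
    have h10 := mul_le_mul_of_nonneg_left h8 hα.le
    linarith
  rw [hsplit, inner_sub_right, inner_sub_right, inner_add_right, inner_add_right,
    inner_neg_right, inner_smul_right, inner_smul_right]
  have h7 := (abs_le.1 h1).1
  have h8 := (abs_le.1 h2).2
  have h9 := (abs_le.1 h3).2
  linarith

lemma norm_mean_rgrad_sub_sq_le (hI : Invariant f LG D δ₁ δ₂ x y xbar) :
    ‖(mean fun i => rgrad (f i) xbar) - mean y‖ ^ 2 ≤ LG ^ 2 * meanSqDist x xbar := by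
  rw [hI.mean_tracker, ← mean_sub]
  refine (norm_mean_sq_le H.n_ne_zero _).trans ?_
  have h6 : ∑ i, ‖rgrad (f i) xbar - rgrad (f i) (x i)‖ ^ 2 ≤ LG ^ 2 * sqDist x xbar := by
    rw [sqDist, Finset.mul_sum]
    refine Finset.sum_le_sum fun i _ => ?_
    rw [← mul_pow, norm_sub_rev (x i)]
    exact pow_le_pow_left₀ (norm_nonneg _) (H.lipschitz i _ hI.iam.1 _ (hI.mem i)) 2
  have h7 := mul_le_mul_of_nonneg_left h6 (show 0 ≤ 1 / (n : ℝ) by positivity)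
  rw [meanSqDist]
  linarith

/-- The descent of the objective along the induced means in one iteration. -/
lemma objective_le (hI : Invariant f LG D δ₁ δ₂ x y xbar)
    (hI' : IsIAM (nextPoint M α β x y) xbar') :
    objective f xbar' ≤ objective f xbar
      - β / 2 * ‖mean fun i => rgrad (f i) xbar‖ ^ 2
      - β / 2 * meanSq y + β / 2 * meanSqDist y (mean y)
      + 1 / 2 * D * meanSqDist (nextPoint M α β x y) xbar'
      + (13 / 2 * D + D ^ 2 / LG + 6 * LG) * meanSqDist x xbar
      + (D + 9 / 4 * LG) * (β ^ 2 * meanSq y) := by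
  have hLG := H.LG_pos
  have hD := H.D_nonneg
  have hβ := H.β_pos
  have hα := H.α_pos
  have hgt : tangentProj xbar (mean fun i => rgrad (f i) xbar) =
      mean fun i => rgrad (f i) xbar := by
    have h1 : (mean fun i => rgrad (f i) xbar) =
        tangentProj xbar (mean fun i => egrad (f i) xbar) := by
      rw [mean, mean, tangentProj_smul, tangentProj_sum]
      rfl
    rw [h1]
    exact tangentProj_eq_self (tangentProj_tangent hI.iam.1 _)
  have hdesc := H.objective_le_add_inner hI.iam.1 hI'.1
  have hlin := H.inner_iam_move_le hI hI' hgt (H.norm_mean_rgrad_le hI.iam.1)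
  have hquad := H.norm_iam_move_sq_le hI hI'
  have hpol := H.norm_mean_rgrad_sub_sq_le hI
  have hXle := H.meanSq_moveDir_le (y := y) hI.mem xbar
  have hYQ := meanSq_eq_add H.n_ne_zero y
  have hE0 : 0 ≤ meanSqDist x xbar := meanSqDist_nonneg _ _
  have hY0 : 0 ≤ meanSq y := meanSq_nonneg _
  have hinner := norm_sub_sq_real (mean fun i => rgrad (f i) xbar) (mean y)
  generalize (mean fun i => rgrad (f i) xbar) = g at *
  generalize meanSqDist (nextPoint M α β x y) xbar' = E' at *
  generalize meanSq (moveDir M α β x y) = X at *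
  generalize meanSqDist x xbar = E at *
  generalize meanSqDist y (mean y) = Q at *
  generalize meanSq y = Y at *
  generalize ‖mean y‖ = N at *
  generalize ‖xbar' - xbar‖ = T at *
  generalize inner ℝ g (xbar' - xbar) = I₁ at *
  generalize inner ℝ g (mean y) = I₂ at *
  generalize ‖g - mean y‖ = R at *
  generalize ‖g‖ = G at *
  have hX : X ≤ 8 * E + 2 * (β ^ 2 * Y) := by
    have h2 := mul_le_mul_of_nonneg_right (pow_le_one₀ (n := 2) hα.le H.α_le) hE0
    linarith
  have hβE : β / 2 * (LG ^ 2 * E) ≤ LG / 16 * E := by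
    have := mul_le_mul_of_nonneg_right H.β_le_LG (mul_nonneg hLG.le hE0)
    linarith
  have hpol' := mul_le_mul_of_nonneg_left hpol (show 0 ≤ β / 2 by positivity)
  have hDX := mul_le_mul_of_nonneg_left hX (show 0 ≤ D / 2 by positivity)
  have hLX := mul_le_mul_of_nonneg_left hX (show 0 ≤ LG / 2 * (11 / 10) by positivity)
  have hLq := mul_le_mul_of_nonneg_left hquad (show 0 ≤ LG / 2 by positivity)
  have hLE : 0 ≤ LG * E := by positivity
  have hLY : 0 ≤ LG * (β ^ 2 * Y) := by positivity
  -- polarization of `⟨g, ŷ⟩`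
  have hgy : -(β * I₂) ≤ -(β / 2 * G ^ 2) - β / 2 * Y + β / 2 * Q + LG / 16 * E := by
    have h6 : β * I₂ = β / 2 * (G ^ 2 + N ^ 2 - R ^ 2) := by
      rw [hinner]; ring
    have h7 : N ^ 2 = Y - Q := by rw [hYQ]; ring
    rw [h6, h7]
    linarith
  linarith

end Regime

end Descent

/-! ### Summation over the iterations -/

section Summation

/-- Sum of a perturbed geometric recursion. -/
lemma sum_le_of_contraction {u w : ℕ → ℝ} {ρ : ℝ} (hρ : 0 ≤ ρ) (hu : ∀ k, 0 ≤ u k)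
    (h : ∀ k, u (k + 1) ≤ ρ * u k + w k) (K : ℕ) :
    (1 - ρ) * ∑ k ∈ Finset.range (K + 1), u k ≤ u 0 + ∑ k ∈ Finset.range K, w k := by
  have h1 := Finset.sum_le_sum fun k (_ : k ∈ Finset.range K) => h k
  rw [Finset.sum_add_distrib, ← Finset.mul_sum] at h1
  have h2 := Finset.sum_range_succ' u K
  have h3 := Finset.sum_range_succ u K
  have h4 := mul_nonneg hρ (hu K)
  nlinarith

lemma inf'_range_le_div {a : ℕ → ℝ} {K : ℕ} (hK : 1 ≤ K) {T : ℝ}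
    (hT : ∑ k ∈ Finset.range K, a k ≤ T) :
    (Finset.range (K + 1)).inf' Finset.nonempty_range_add_one a ≤ T / K := by
  have hK' : (0 : ℝ) < K := by exact_mod_cast hK
  rw [le_div_iff₀ hK']
  refine le_trans ?_ hT
  have h1 : ∀ k ∈ Finset.range K,
      (Finset.range (K + 1)).inf' Finset.nonempty_range_add_one a ≤ a k := fun k hk =>
    Finset.inf'_le _ (Finset.mem_range.2 (by have := Finset.mem_range.1 hk; omega))
  have h2 := Finset.card_nsmul_le_sum _ _ _ h1
  rw [Finset.card_range, nsmul_eq_mul] at h2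
  linarith

variable {n d r : ℕ} {M : Matrix (Fin n) (Fin n) ℝ} {f : Fin n → Mat d r → ℝ}
  {s ρ LG D δ₁ δ₂ α β : ℝ} {x y : ℕ → Fin n → Mat d r} {xbar : ℕ → Mat d r}

lemma Ct₀_nonneg (ρ : ℝ) : 0 ≤ Ct₀ ρ := by unfold Ct₀; positivity

lemma Ct₂_nonneg (s : ℝ) : 0 ≤ Ct₂ s := by unfold Ct₂; positivity

/-- Since `1 - ρ² = (1 - ρ) (1 + ρ) ≤ 2 (1 - ρ)`, the constant `C̃₁` dominates `e / (1 - ρ)`; the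
same holds for `C̃₃`, which is `C̃₁` in terms of `s` and `q`. -/
lemma div_one_sub_le_Ct₁ {ρ e : ℝ} (h0 : 0 ≤ ρ) (h1 : ρ < 1) (he : 0 ≤ e) :
    e / (1 - ρ) ≤ Ct₁ ρ e := by
  have h2 : 0 < 1 - ρ := by linarith
  have h3 : 1 - ρ ^ 2 = (1 - ρ) * (1 + ρ) := by ring
  rw [Ct₁, h3, div_mul_eq_mul_div, div_le_div_iff₀ h2 (by positivity)]
  have : 0 ≤ e * (1 - ρ) * (1 - ρ) := by positivity
  nlinarith

/-- The constants `𝒢₃` and `𝒢₄` dominate the coefficients which the descent inequality produces. -/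
lemma coefficients_le {r : ℕ} {ρ e LG D δ₁ α : ℝ} (hr : 1 ≤ r)
    (hρ0 : 0 < ρ) (hρ1 : ρ < 1) (he : 0 ≤ e) (hLG : 0 < LG) (hD : 0 ≤ D) (hα0 : 0 < α) :
    (7 * D + D ^ 2 / LG + 6 * LG) * Ct₀ ρ + (D + 9 / 4 * LG) ≤
        LG * G₃ r LG D (1 / (1 - ρ) ^ 2) α δ₁ ρ ∧
      (7 * D + D ^ 2 / LG + 6 * LG) * Ct₁ ρ e ≤
        G₄ r LG D (1 / (1 - ρ) ^ 2) α δ₁ ρ e * LG := by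
  have hρ' : 0 < 1 - ρ := by linarith
  set κ := 1 / (1 - ρ) ^ 2 with hκ
  have hκ1 : 1 ≤ κ := by
    rw [hκ, le_div_iff₀ (by positivity), one_mul]
    exact pow_le_one₀ hρ'.le (by linarith)
  have hr' : (1 : ℝ) ≤ r := by exact_mod_cast hr
  have hrκ : 1 ≤ (r : ℝ) * κ := one_le_mul_of_one_le_of_one_le hr' hκ1
  have hc0' : 0 ≤ Ct₀ ρ := Ct₀_nonneg ρ
  have hC1 : 0 ≤ Ct₁ ρ e := (div_nonneg he hρ'.le).trans (div_one_sub_le_Ct₁ hρ0.le hρ1 he)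
  obtain ⟨u, hu⟩ : ∃ u, u = D / LG := ⟨_, rfl⟩
  have hu0 : 0 ≤ u := by rw [hu]; positivity
  have hDu : D = u * LG := by rw [hu]; field_simp
  have hA : 7 * D + D ^ 2 / LG + 6 * LG = (6 + 7 * u + u ^ 2) * LG := by
    rw [hDu]; field_simp; ring
  have hg0 : 4 * (1 + 2 * u) ^ 2 ≤ G₀ r LG D κ := by
    have h1 : G₀ r LG D κ = 4 * r * (1 + 2 * u) ^ 2 * κ := by
      rw [G₀, hDu]; field_simp
    rw [h1]
    have h3 := mul_le_mul_of_nonneg_left hrκ (show 0 ≤ 4 * (1 + 2 * u) ^ 2 by positivity)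
    linarith
  have hg1 : 1 + G₀ r LG D κ ≤ G₁ r LG D κ α δ₁ := by
    have h1 : 0 ≤ (2 * D * α + 8 * D * α ^ 2) / LG := by positivity
    have h2 : 0 ≤ 13 * κ * δ₁ ^ 2 * α ^ 4 := by positivity
    rw [G₁]
    linarith
  have h3 : G₃ r LG D κ α δ₁ ρ =
      (G₁ r LG D κ α δ₁ + G₀ r LG D κ) * Ct₀ ρ + (2 * u + δ₁ ^ 2 / 2 + 5) := by
    rw [G₃, G₂, hu]; ring
  have h4 : G₄ r LG D κ α δ₁ ρ e = G₀ r LG D κ * Ct₀ ρ * δ₁ ^ 2 * α ^ 2 / 25 +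
      Ct₁ ρ e * (G₁ r LG D κ α δ₁ + 4 * r * κ) := rfl
  rw [h3, h4, hA]
  generalize G₁ r LG D κ α δ₁ = g1 at *
  generalize G₀ r LG D κ = g0 at *
  generalize Ct₀ ρ = c0 at *
  generalize Ct₁ ρ e = c1 at *
  have hsq := sq_nonneg u
  constructor
  · have h5 : 6 + 7 * u + u ^ 2 ≤ g1 + g0 := by linarith
    have h6 := mul_le_mul_of_nonneg_right h5 hc0'
    have h7 : (6 + 7 * u + u ^ 2) * c0 + (u + 9 / 4) ≤
        (g1 + g0) * c0 + (2 * u + δ₁ ^ 2 / 2 + 5) := by linarith [sq_nonneg δ₁]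
    have h8 := mul_le_mul_of_nonneg_left h7 hLG.le
    rw [hDu]
    linarith
  · have h5 : 6 + 7 * u + u ^ 2 ≤ g1 + 4 * r * κ := by linarith
    have h6 := mul_le_mul_of_nonneg_left h5 hC1
    have h7 : 0 ≤ g0 := le_trans (by positivity) hg0
    have h8 : 0 ≤ g0 * c0 * δ₁ ^ 2 * α ^ 2 / 25 := by positivity
    have h9 := mul_le_mul_of_nonneg_right (h6.trans (le_add_of_nonneg_left h8)) hLG.le
    linarith

/-- Under the step size conditions, the trackers' own descent dominates every error term they
cause. The part fed back through the consensus error is controlled by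
`(β LG)² C̃₀ ≤ 2 δ₁²`, the rest by the definition of `𝒢₃`. -/
lemma tracker_coefficient_le {ρ s g LG D δ₁ α β c : ℝ}
    (hρ1 : ρ < 1) (hs1 : s ≤ 2 / 5)
    (hLG : 0 < LG) (hD : 0 ≤ D) (hδ0 : 0 < δ₁) (hδ1 : δ₁ ≤ 1 / 30) (hα0 : 0 < α) (hα1 : α ≤ 1)
    (hβ : 0 < β) (hβρ : β * (LG + 2 * D) ≤ (1 - ρ) * δ₁) (hβα : β * (LG + 2 * D) ≤ α * δ₁ / 5)
    (hg : 0 < g) (hc : c ≤ LG * g)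
    (hβG : β ≤ 1 / (4 * LG * (2 * g + (8 * Ct₀ ρ + 1 / 2 * Ct₂ s) * α * δ₁))) :
    β * c + β ^ 2 * (Ct₂ s * LG ^ 2 * (4 * α ^ 2 * Ct₀ ρ + 1)) ≤ 1 / 4 := by
  have hρ' : 0 < 1 - ρ := by linarith
  have hC2 : Ct₂ s ≤ 50 / 9 := by
    have h1 : (3 / 5 : ℝ) ^ 2 ≤ (1 - s) ^ 2 := pow_le_pow_left₀ (by norm_num) (by linarith) 2
    rw [Ct₂, div_le_iff₀ (by linarith)]
    linarith
  have hC2' : 0 ≤ Ct₂ s := Ct₂_nonneg s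
  have hc0' : 0 ≤ Ct₀ ρ := Ct₀_nonneg ρ
  have hβD := mul_nonneg hβ.le hD
  have hbρ : β * LG ≤ (1 - ρ) * δ₁ := by linarith
  have hbc : (β * LG) ^ 2 * Ct₀ ρ ≤ 1 / 450 := by
    have h1 := pow_le_pow_left₀ (by positivity) hbρ 2
    have h2 := mul_le_mul_of_nonneg_right h1 hc0'
    have h3 : ((1 - ρ) * δ₁) ^ 2 * Ct₀ ρ = 2 * δ₁ ^ 2 := by
      rw [Ct₀]; field_simp
    have h4 := pow_le_pow_left₀ hδ0.le hδ1 2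
    linarith
  generalize Ct₀ ρ = c0 at *
  generalize Ct₂ s = c2 at *
  have hbG : β * LG * g ≤ 1 / 8 := by
    have h1 : 0 ≤ (8 * c0 + 1 / 2 * c2) * α * δ₁ := by positivity
    rw [le_div_iff₀ (by positivity)] at hβG
    have h2 : 0 ≤ β * (4 * LG * ((8 * c0 + 1 / 2 * c2) * α * δ₁)) := by positivity
    linarith
  have hbα : β * LG ≤ 1 / 150 := by
    have h2 : α * δ₁ ≤ 1 * (1 / 30) := mul_le_mul hα1 hδ1 hδ0.le zero_le_one
    linarith
  have h2 := mul_le_mul_of_nonneg_left hc hβ.le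
  have h3 : β ^ 2 * (c2 * LG ^ 2 * (4 * α ^ 2 * c0 + 1)) =
      c2 * (4 * α ^ 2 * ((β * LG) ^ 2 * c0) + (β * LG) ^ 2) := by ring
  have h4 : α ^ 2 ≤ 1 := pow_le_one₀ hα0.le hα1
  have h5 : 4 * α ^ 2 * ((β * LG) ^ 2 * c0) ≤ 4 * 1 * (1 / 450) :=
    mul_le_mul (by linarith) hbc (by positivity) (by norm_num)
  have h6 : (β * LG) ^ 2 ≤ (1 / 150) ^ 2 := pow_le_pow_left₀ (by positivity) hbα 2
  have h7 : c2 * (4 * α ^ 2 * ((β * LG) ^ 2 * c0) + (β * LG) ^ 2) ≤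
      50 / 9 * (4 * 1 * (1 / 450) + (1 / 150) ^ 2) :=
    mul_le_mul hC2 (add_le_add h5 h6) (by positivity) (by norm_num)
  rw [h3]
  linarith

/-- The elementary estimate behind the summation: `SE`, `SQ`, `SG`, `SY` stand for the sums of the
consensus errors, the tracking errors, the squared gradients and the squared trackers. -/
lemma summed_descent {r : ℕ} {ρ s e q F₀ F SE SQ SG SY LG D δ₁ α β : ℝ} (hr : 1 ≤ r)
    (hρ0 : 0 < ρ) (hρ1 : ρ < 1) (hs1 : s ≤ 2 / 5) (he : 0 ≤ e)
    (hLG : 0 < LG) (hD : 0 ≤ D) (hδ0 : 0 < δ₁) (hδ1 : δ₁ ≤ 1 / 30) (hα0 : 0 < α) (hα1 : α ≤ 1)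
    (hβ : 0 < β) (hβρ : β * (LG + 2 * D) ≤ (1 - ρ) * δ₁) (hβα : β * (LG + 2 * D) ≤ α * δ₁ / 5)
    (hβG : β ≤ 1 / (4 * LG * (2 * G₃ r LG D (1 / (1 - ρ) ^ 2) α δ₁ ρ +
      (8 * Ct₀ ρ + 1 / 2 * Ct₂ s) * α * δ₁)))
    (hSY : 0 ≤ SY)
    (hSE : SE ≤ Ct₁ ρ e + Ct₀ ρ * (β ^ 2 * SY))
    (hSQ : SQ ≤ Ct₃ s q + Ct₂ s * LG ^ 2 * (8 * α ^ 2 * SE + 2 * (β ^ 2 * SY)))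
    (hF : F ≤ F₀ - β / 2 * SG - β / 2 * SY + β / 2 * SQ +
      (7 * D + D ^ 2 / LG + 6 * LG) * SE + (D + 9 / 4 * LG) * (β ^ 2 * SY)) :
    β / 2 * SG + β / 4 * SY ≤ F₀ - F + Ct₄ ρ s e q α β LG +
      G₄ r LG D (1 / (1 - ρ) ^ 2) α δ₁ ρ e * LG := by
  obtain ⟨hG3, hG4⟩ := coefficients_le (δ₁ := δ₁) hr hρ0 hρ1 he hLG hD hα0
  have hA0 : 0 ≤ 7 * D + D ^ 2 / LG + 6 * LG := by positivity
  have hc0 : 0 ≤ Ct₀ ρ := Ct₀_nonneg ρ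
  have hc2 : 0 ≤ Ct₂ s := Ct₂_nonneg s
  have hg3 : 0 < G₃ r LG D (1 / (1 - ρ) ^ 2) α δ₁ ρ := by
    refine pos_of_mul_pos_right (lt_of_lt_of_le ?_ hG3) hLG.le
    positivity
  have hcoef := tracker_coefficient_le hρ1 hs1 hLG hD hδ0 hδ1 hα0 hα1 hβ hβρ hβα hg3 hG3 hβG
  rw [Ct₄]
  generalize 7 * D + D ^ 2 / LG + 6 * LG = A at *
  generalize D + 9 / 4 * LG = B at *
  generalize Ct₀ ρ = c0 at *
  generalize Ct₁ ρ e = c1 at *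
  generalize Ct₂ s = c2 at *
  generalize Ct₃ s q = c3 at *
  generalize G₄ r LG D (1 / (1 - ρ) ^ 2) α δ₁ ρ e * LG = g4 at *
  have hASE := mul_le_mul_of_nonneg_left hSE hA0
  have hSQ' : β / 2 * SQ ≤ β / 2 * (c3 + c2 * LG ^ 2 *
      (8 * α ^ 2 * (c1 + c0 * (β ^ 2 * SY)) + 2 * (β ^ 2 * SY))) := by
    refine mul_le_mul_of_nonneg_left (hSQ.trans ?_) (by positivity)
    gcongr
  have hfin := mul_le_mul_of_nonneg_right hcoef (show 0 ≤ β * SY by positivity)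
  linarith

variable (H : Regime M f s ρ LG D δ₁ δ₂ α β)
  (hx : ∀ k, x (k + 1) = nextPoint M α β (x k) (y k))
  (hy : ∀ k, y (k + 1) = nextTracker M f α β (x k) (y k))
  (hbar : ∀ k, IsIAM (x k) (xbar k))
  (h0 : Invariant f LG D δ₁ δ₂ (x 0) (y 0) (xbar 0))
include H hx hy hbar h0

lemma invariant_all (k : ℕ) : Invariant f LG D δ₁ δ₂ (x k) (y k) (xbar k) := by
  induction k with
  | zero => exact h0
  | succ k ih =>
    have h1 := hbar (k + 1)
    rw [hx] at h1
    rw [hx, hy]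
    exact H.invariant_next ih h1

lemma sum_meanSqDist_le (K : ℕ) :
    ∑ k ∈ Finset.range (K + 1), meanSqDist (x k) (xbar k) ≤
      Ct₁ ρ (meanSqDist (x 0) (xbar 0)) +
        Ct₀ ρ * (β ^ 2 * ∑ k ∈ Finset.range K, meanSq (y k)) := by
  have hI := invariant_all H hx hy hbar h0
  have hρ : 0 < 1 - ρ := by linarith [H.ρ_lt]
  have h1 := sum_le_of_contraction (u := fun k => meanSqDist (x k) (xbar k))
    (w := fun k => β ^ 2 * meanSq (y k) / (1 - ρ)) H.ρ_pos.le
    (fun k => meanSqDist_nonneg _ _) (fun k => by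
      have h2 := hbar (k + 1)
      rw [hx] at h2
      have h3 := H.meanSqDist_nextPoint_le (hI k) h2
      rwa [← hx] at h3) K
  rw [← Finset.sum_div, ← Finset.mul_sum] at h1
  have h2 := div_one_sub_le_Ct₁ H.ρ_pos.le H.ρ_lt (meanSqDist_nonneg (x 0) (xbar 0))
  set T := ∑ k ∈ Finset.range K, meanSq (y k)
  have hT : 0 ≤ T := Finset.sum_nonneg fun k _ => meanSq_nonneg _
  rw [mul_comm, ← le_div_iff₀ hρ, add_div] at h1
  have h3 : β ^ 2 * T / (1 - ρ) / (1 - ρ) ≤ Ct₀ ρ * (β ^ 2 * T) := by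
    have h4 : Ct₀ ρ * (β ^ 2 * T) = 2 * (β ^ 2 * T / (1 - ρ) / (1 - ρ)) := by
      rw [Ct₀]; field_simp
    have h5 : 0 ≤ β ^ 2 * T / (1 - ρ) / (1 - ρ) := by positivity
    linarith
  linarith

lemma sum_tracking_le (K : ℕ) :
    ∑ k ∈ Finset.range K, meanSqDist (y k) (mean (y k)) ≤
      Ct₃ s (meanSqDist (y 0) (mean (y 0))) + Ct₂ s * LG ^ 2 *
        (8 * α ^ 2 * ∑ k ∈ Finset.range (K + 1), meanSqDist (x k) (xbar k) +
          2 * (β ^ 2 * ∑ k ∈ Finset.range K, meanSq (y k))) := by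
  have hI := invariant_all H hx hy hbar h0
  have hs1 : 0 < 1 - s := by linarith [H.s_le_two_fifths]
  have h1 := sum_le_of_contraction (u := fun k => meanSqDist (y k) (mean (y k)))
    (w := fun k => LG ^ 2 * meanSq (moveDir M α β (x k) (y k)) / (1 - s)) H.s_nonneg
    (fun k => meanSqDist_nonneg _ _) (fun k => by
      have h3 := H.tracking_le (y := y k) (hI k).mem
      rwa [← hy] at h3) K
  rw [← Finset.sum_div, ← Finset.mul_sum, mul_comm, ← le_div_iff₀ hs1, add_div] at h1
  have h2 := div_one_sub_le_Ct₁ H.s_nonneg (by linarith) (meanSqDist_nonneg (y 0) (mean (y 0)))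
  change _ ≤ Ct₃ s _ at h2
  have h3 : ∑ k ∈ Finset.range K, meanSq (moveDir M α β (x k) (y k)) ≤
      8 * α ^ 2 * ∑ k ∈ Finset.range (K + 1), meanSqDist (x k) (xbar k) +
          2 * (β ^ 2 * ∑ k ∈ Finset.range K, meanSq (y k)) := by
    have h4 := Finset.sum_le_sum fun k (_ : k ∈ Finset.range K) =>
      H.meanSq_moveDir_le (y := y k) (hI k).mem (xbar k)
    rw [Finset.sum_add_distrib, ← Finset.mul_sum, ← Finset.mul_sum] at h4
    rw [Finset.sum_range_succ]
    have h5 : 0 ≤ 8 * α ^ 2 * meanSqDist (x K) (xbar K) :=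
      mul_nonneg (by positivity) (meanSqDist_nonneg _ _)
    linarith
  set X := ∑ k ∈ Finset.range K, meanSq (moveDir M α β (x k) (y k)) with hX
  have hX0 : 0 ≤ X := Finset.sum_nonneg fun k _ => meanSq_nonneg _
  have h4 : LG ^ 2 * X / (1 - s) / (1 - s) ≤ Ct₂ s * LG ^ 2 * X := by
    have h5 : Ct₂ s * LG ^ 2 * X = 2 * (LG ^ 2 * X / (1 - s) / (1 - s)) := by
      rw [Ct₂]; field_simp
    have h6 : 0 ≤ LG ^ 2 * X / (1 - s) / (1 - s) := by positivity
    linarith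
  have h5 := mul_le_mul_of_nonneg_left h3
    (mul_nonneg (Ct₂_nonneg s) (sq_nonneg LG))
  have h6 := meanSqDist_nonneg (y K) (mean (y K))
  rw [Finset.sum_range_succ] at h1
  linarith

lemma objective_sum_le (K : ℕ) :
    objective f (xbar K) ≤ objective f (xbar 0)
      - β / 2 * ∑ k ∈ Finset.range K, ‖mean fun i => rgrad (f i) (xbar k)‖ ^ 2
      - β / 2 * ∑ k ∈ Finset.range K, meanSq (y k)
      + β / 2 * ∑ k ∈ Finset.range K, meanSqDist (y k) (mean (y k))
      + (7 * D + D ^ 2 / LG + 6 * LG) *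
          ∑ k ∈ Finset.range (K + 1), meanSqDist (x k) (xbar k)
      + (D + 9 / 4 * LG) * (β ^ 2 * ∑ k ∈ Finset.range K, meanSq (y k)) := by
  have hI := invariant_all H hx hy hbar h0
  have hstep : ∀ k, objective f (xbar (k + 1)) - objective f (xbar k) ≤
      - (β / 2 * ‖mean fun i => rgrad (f i) (xbar k)‖ ^ 2)
      - β / 2 * meanSq (y k) + β / 2 * meanSqDist (y k) (mean (y k))
      + 1 / 2 * D * meanSqDist (x (k + 1)) (xbar (k + 1))
      + (13 / 2 * D + D ^ 2 / LG + 6 * LG) * meanSqDist (x k) (xbar k)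
      + (D + 9 / 4 * LG) * (β ^ 2 * meanSq (y k)) := by
    intro k
    have h2 := hbar (k + 1)
    rw [hx] at h2
    have h3 := H.objective_le (hI k) h2
    rw [← hx] at h3
    linarith
  have h1 := Finset.sum_le_sum fun k (_ : k ∈ Finset.range K) => hstep k
  rw [Finset.sum_range_sub (fun k => objective f (xbar k))] at h1
  simp only [Finset.sum_add_distrib, Finset.sum_sub_distrib, Finset.sum_neg_distrib,
    ← Finset.mul_sum] at h1
  have h2 := Finset.sum_range_succ' (fun k => meanSqDist (x k) (xbar k)) K
  have h3 := Finset.sum_range_succ (fun k => meanSqDist (x k) (xbar k)) K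
  have h4 : 0 ≤ 1 / 2 * D * meanSqDist (x 0) (xbar 0) :=
    mul_nonneg (by linarith [H.D_nonneg]) (meanSqDist_nonneg _ _)
  have h5 : 0 ≤ (13 / 2 * D + D ^ 2 / LG + 6 * LG) * meanSqDist (x K) (xbar K) := by
    have := H.D_nonneg
    have := H.LG_pos
    exact mul_nonneg (by positivity) (meanSqDist_nonneg _ _)
  have h6 : (7 * D + D ^ 2 / LG + 6 * LG) *
      ∑ k ∈ Finset.range (K + 1), meanSqDist (x k) (xbar k) =
      1 / 2 * D * (∑ k ∈ Finset.range K, meanSqDist (x (k + 1)) (xbar (k + 1)) +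
        meanSqDist (x 0) (xbar 0)) +
      (13 / 2 * D + D ^ 2 / LG + 6 * LG) * (∑ k ∈ Finset.range K, meanSqDist (x k) (xbar k) +
        meanSqDist (x K) (xbar K)) := by
    rw [← h2, ← h3]; ring
  rw [h6]
  linarith

/-- What the telescoped descent inequality gives for the sums along the iteration. -/
lemma sum_bounds (hr : 1 ≤ r) (hdiff : ∀ i, Differentiable ℝ (f i)) {S e q : ℝ}
    (he : e = meanSqDist (x 0) (xbar 0)) (hq : q = meanSqDist (y 0) (mean (y 0)))
    (hβG : β ≤ 1 / (4 * LG * (2 * G₃ r LG D (1 / (1 - ρ) ^ 2) α δ₁ ρ +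
      (8 * Ct₀ ρ + 1 / 2 * Ct₂ s) * α * δ₁)))
    (hS : S = objective f (xbar 0) - optValue f + Ct₄ ρ s e q α β LG +
      G₄ r LG D (1 / (1 - ρ) ^ 2) α δ₁ ρ e * LG) (K : ℕ) :
    ∑ k ∈ Finset.range K, ‖rgrad (objective f) (xbar k)‖ ^ 2 ≤
        ((16 + α ^ 2 * δ₁ ^ 2 * Ct₀ ρ) * S + Ct₁ ρ e * LG) / β ∧
      ∑ k ∈ Finset.range K, meanSqDist (x k) (xbar k) ≤
        8 * β * S * Ct₀ ρ + Ct₁ ρ e := by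
  have hSE := sum_meanSqDist_le H hx hy hbar h0 K
  have hSQ := sum_tracking_le H hx hy hbar h0 K
  have hF := objective_sum_le H hx hy hbar h0 K
  rw [← he] at hSE
  rw [← hq] at hSQ
  have he0 : 0 ≤ e := he ▸ meanSqDist_nonneg _ _
  have hSY0 : 0 ≤ ∑ k ∈ Finset.range K, meanSq (y k) :=
    Finset.sum_nonneg fun k _ => meanSq_nonneg _
  have hmain := summed_descent hr H.ρ_pos H.ρ_lt H.s_le_two_fifths he0 H.LG_pos H.D_nonneg
    H.δ₁_pos H.δ₁_le' H.α_pos H.α_le H.β_pos H.β_le_ρ H.β_le_α hβG hSY0 hSE hSQ hF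
  have hopt := optValue_le hdiff (hbar K).1
  have hSG0 : 0 ≤ ∑ k ∈ Finset.range K, ‖mean fun i => rgrad (f i) (xbar k)‖ ^ 2 :=
    Finset.sum_nonneg fun k _ => sq_nonneg _
  have hmain' := hmain.trans (show _ ≤ S by rw [hS]; linarith)
  have hc0 := Ct₀_nonneg ρ
  have hc1 : 0 ≤ Ct₁ ρ e :=
    (div_nonneg he0 (by linarith [H.ρ_lt])).trans (div_one_sub_le_Ct₁ H.ρ_pos.le H.ρ_lt he0)
  have hSK := meanSqDist_nonneg (x K) (xbar K)
  rw [Finset.sum_range_succ] at hSE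
  simp only [rgrad_objective hdiff]
  have hLG0 := H.LG_pos
  have hβ := H.β_pos
  clear hSQ hF hmain hopt hS hβG h0 hbar hx hy H
  generalize ∑ k ∈ Finset.range K, ‖mean fun i => rgrad (f i) (xbar k)‖ ^ 2 = SG at *
  generalize ∑ k ∈ Finset.range K, meanSq (y k) = SY at *
  generalize ∑ k ∈ Finset.range K, meanSqDist (x k) (xbar k) = SE at *
  generalize meanSqDist (x K) (xbar K) = eK at *
  generalize Ct₀ ρ = c0 at *
  generalize Ct₁ ρ e = c1 at *
  have hβG0 : 0 ≤ β / 2 * SG := by positivity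
  have hβY0 : 0 ≤ β / 4 * SY := by positivity
  have hS0 : 0 ≤ S := by linarith
  constructor
  · rw [le_div_iff₀ hβ]
    have h1 : 0 ≤ α ^ 2 * δ₁ ^ 2 * c0 * S := by positivity
    have h2 : 0 ≤ c1 * LG := by positivity
    linarith
  · have h2 : c0 * (β ^ 2 * SY) ≤ c0 * (4 * β * S) := by
      refine mul_le_mul_of_nonneg_left ?_ hc0
      have h3 : β / 4 * SY ≤ S := by linarith
      have h4 := mul_le_mul_of_nonneg_left h3 (show 0 ≤ 4 * β by positivity)
      linarith
    have h3 : 0 ≤ β * S * c0 := by positivity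
    linarith

end Summation

/-! ### The algorithm -/

section Algorithm

variable {n d r : ℕ} {W : Matrix (Fin n) (Fin n) ℝ} {f : Fin n → Mat d r → ℝ} {t : ℕ}

lemma step_eq (h : IsSymmStochastic (W ^ t)) (α β : ℝ)
    (p : (Fin n → Mat d r) × (Fin n → Mat d r)) :
    step W t α β f p =
      (nextPoint (W ^ t) α β p.1 p.2, nextTracker (W ^ t) f α β p.1 p.2) := by
  have h1 : ∀ i, polarRetraction (p.1 i)
      (-(α • consensusGrad W t p.1 i) - β • tangentProj (p.1 i) (p.2 i)) =
        nextPoint (W ^ t) α β p.1 p.2 i := by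
    intro i
    rw [consensusGrad_eq h]
    rfl
  simp only [step, h1]
  rfl

/-- The hypotheses on the network, the functions and the parameters provide the properties which
drive one iteration. -/
lemma regime_of_hypotheses {G : SimpleGraph (Fin n)} {L Ln D δ₁ δ₂ α β : ℝ} (hn : 2 ≤ n)
    (hr : 1 ≤ r) (hne : (stiefel d r).Nonempty)
    (hW : IsMixingMatrix G W) (hL : 0 < L) (hdiff : ∀ i, Differentiable ℝ (f i))
    (hlip : ∀ i x y, ‖egrad (f i) x - egrad (f i) y‖ ≤ L * ‖x - y‖)
    (hLn : ∀ i, ∀ x ∈ stiefel d r, specNorm (egrad (f i) x) ≤ Ln)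
    (hD : ∀ i, ∀ x ∈ stiefel d r, ‖rgrad (f i) x‖ ≤ D)
    (hδ₁ : 0 < δ₁) (hδ₁₂ : δ₁ ≤ δ₂ / (5 * √(r : ℝ))) (hδ₂ : δ₂ ≤ 1 / 6) (ht : 1 ≤ t)
    (htlog : ⌈Real.logb (sigma₂ W) (1 / (2 * √(n : ℝ)))⌉ ≤ (t : ℤ))
    (hα : 0 < α) (hα' : α ≤ min (Phi δ₂ / (2 * Lt W t)) 1) (hβ : 0 < β)
    (hβρ : β ≤ (1 - rhoT W t r δ₁ δ₂ α) * δ₁ / (L + 2 * Ln + 2 * D))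
    (hβα : β ≤ α * δ₁ / (5 * (L + 2 * Ln + 2 * D))) (hβL : β ≤ 1 / (8 * (L + 2 * Ln))) :
    Regime (W ^ t) f (sigma₂ W ^ t) (rhoT W t r δ₁ δ₂ α) (L + 2 * Ln) D δ₁ δ₂ α β := by
  obtain ⟨z, hz⟩ := hne
  have hst := hW.isSymmStochastic
  have hstt := hst.pow t
  have i0 : Fin n := ⟨0, by omega⟩
  have hLn0 : 0 ≤ Ln := (specNorm_nonneg _).trans (hLn i0 z hz)
  have hD0 : 0 ≤ D := (norm_nonneg _).trans (hD i0 z hz)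
  have hLG : 0 < L + 2 * Ln := by linarith
  have hs := sigma₂_pow_le (sigma₂_nonneg W) (hW.sigma₂_lt_one hn) (by omega : n ≠ 0) ht htlog
  -- the radii
  have hr' : (1 : ℝ) ≤ √(r : ℝ) := Real.one_le_sqrt.2 (by exact_mod_cast hr)
  have hδ₁₂' : 5 * √(r : ℝ) * δ₁ ≤ δ₂ := by
    rw [le_div_iff₀ (by positivity)] at hδ₁₂
    linarith
  have hδ₅ : 5 * δ₁ ≤ δ₂ := by
    have := mul_le_mul_of_nonneg_right hr' hδ₁.le
    linarith
  have hδ₂0 : 0 < δ₂ := by linarith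
  have hκ : 4 * r * δ₁ ^ 2 < 1 := by
    have h1 := pow_le_pow_left₀ (by positivity) hδ₁₂' 2
    rw [mul_pow, mul_pow, Real.sq_sqrt (Nat.cast_nonneg r)] at h1
    have h2 := pow_le_pow_left₀ hδ₂0.le hδ₂ 2
    have h3 : 0 ≤ (r : ℝ) * δ₁ ^ 2 := by positivity
    linarith
  have hδ₂sq : δ₂ ^ 2 ≤ 1 / 36 := by
    have := pow_le_pow_left₀ hδ₂0.le hδ₂ 2
    linarith
  -- the spectral gap
  have hs1 : sigma₂ W ^ t < 1 :=
    pow_lt_one₀ (sigma₂_nonneg W) (hW.sigma₂_lt_one hn) (by omega)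
  have hμ : 0 < 1 - sortedEigenvalue (W ^ t) 1 := by
    linarith [hst.second_pow_le hn t]
  have hμℓ : 1 - sortedEigenvalue (W ^ t) 1 ≤ 1 - sortedEigenvalue (W ^ t) (n - 1) := by
    linarith [sortedEigenvalue_last_le hn hstt.symm]
  have hℓ2 : 1 - sortedEigenvalue (W ^ t) (n - 1) ≤ 2 := by
    linarith [hstt.neg_one_le_last hn]
  have hαℓ : α * (2 * (1 - sortedEigenvalue (W ^ t) (n - 1))) ≤ 2 - δ₂ ^ 2 := by
    have h1 := hα'.trans (min_le_left _ _)
    rw [Lt, Phi, le_div_iff₀ (by linarith)] at h1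
    exact h1
  -- the contraction factor
  set γ := gammaT W t r δ₁ δ₂ with hγ
  have hγ0 : 0 < γ * α := by
    rw [hγ, gammaT]
    have h1 : 0 < 1 - 4 * r * δ₁ ^ 2 := by linarith
    have h2 : 0 < 1 - δ₂ ^ 2 / 2 := by linarith
    positivity
  have hγ1 : γ * α < 1 := by
    have h0 : 0 ≤ 4 * r * δ₁ ^ 2 := by positivity
    have h2 : 0 < 1 - δ₂ ^ 2 / 2 := by linarith
    have h3 : (1 - sortedEigenvalue (W ^ t) 1) * α ≤ 1 - δ₂ ^ 2 / 2 := by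
      have := mul_le_mul_of_nonneg_left hμℓ hα.le
      linarith
    have h4 : (1 - δ₂ ^ 2 / 2) * ((1 - sortedEigenvalue (W ^ t) 1) * α) < 1 := by
      have h5 : 0 < δ₂ ^ 2 := by positivity
      have := mul_le_mul_of_nonneg_left h3 h2.le
      nlinarith
    have h5 : 0 ≤ (1 - δ₂ ^ 2 / 2) * ((1 - sortedEigenvalue (W ^ t) 1) * α) := by positivity
    have h6 := mul_le_mul_of_nonneg_right (by linarith : 1 - 4 * (r : ℝ) * δ₁ ^ 2 ≤ 1) h5
    calc γ * α = (1 - 4 * r * δ₁ ^ 2) *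
          ((1 - δ₂ ^ 2 / 2) * ((1 - sortedEigenvalue (W ^ t) 1) * α)) := by
            rw [hγ, gammaT]; ring
      _ ≤ _ := h6
      _ < 1 := by linarith
  have hρsq : rhoT W t r δ₁ δ₂ α ^ 2 = 1 - γ * α := Real.sq_sqrt (by linarith)
  exact
  { two_le := hn
    stoch := hstt
    s_nonneg := pow_nonneg (sigma₂_nonneg W) t
    s_le := hs
    mixing := fun x hx => hst.sum_norm_mix_pow_sq_le hn t hx
    lap_le := hℓ2
    ρ_pos := Real.sqrt_pos.2 (by linarith)
    ρ_lt := by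
      rw [rhoT, Real.sqrt_lt' one_pos]
      linarith
    contraction := fun x z hx hz h1 h2 => by
      have h3 := consensus_contraction hn hr hstt hx hz h2 h1 (by linarith) hα.le hαℓ hμ.le
      rw [hρsq]
      exact h3
    LG_pos := hLG
    D_nonneg := hD0
    bound := hD
    lipschitz := fun i x hx y hy => norm_rgrad_sub_le (hlip i) (hLn i y hy) hx hy
    descent := fun i x hx y hy => le_add_inner_rgrad (hdiff i) (hlip i) (hLn i x hx) hx hy
    δ₁_pos := hδ₁
    δ₁_le := hδ₅
    δ₂_le := hδ₂
    α_pos := hα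
    α_le := hα'.trans (min_le_right _ _)
    β_pos := hβ
    β_le_ρ := (le_div_iff₀ (by linarith)).1 hβρ
    β_le_α := by
      rw [le_div_iff₀ (by linarith)] at hβα
      linarith
    β_le_LG := by
      rw [le_div_iff₀ (by linarith)] at hβL
      linarith }

end Algorithm

end DRGTA

end

theorem mainTheorem2 :
    ∃ c : ℝ, 0 < c ∧
    ∀ (n d r : ℕ) (_hn : 2 ≤ n)
      -- the network
      (G : SimpleGraph (Fin n)) (W : Matrix (Fin n) (Fin n) ℝ) (_hW : DRGTA.IsMixingMatrix G W)
      -- the local functions and their constants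
      (f : Fin n → DRGTA.Mat d r → ℝ) (L Ln D : ℝ) (_hL : 0 < L)
      (_hdiff : ∀ i, Differentiable ℝ (f i))
      (_hlip : ∀ i x y, ‖DRGTA.egrad (f i) x - DRGTA.egrad (f i) y‖ ≤ L * ‖x - y‖)
      (_hLn : ∀ i, ∀ x ∈ DRGTA.stiefel d r, DRGTA.specNorm (DRGTA.egrad (f i) x) ≤ Ln)
      (_hD : ∀ i, ∀ x ∈ DRGTA.stiefel d r, ‖DRGTA.rgrad (f i) x‖ ≤ D)
      -- the local region, the number of communication rounds and the stepsizes
      (δ₁ δ₂ : ℝ) (_hδ₁ : 0 < δ₁) (_hδ₁₂ : δ₁ ≤ δ₂ / (5 * √(r : ℝ))) (_hδ₂ : δ₂ ≤ 1 / 6)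
      (t : ℕ) (_ht : 1 ≤ t)
      (_htlog : ⌈Real.logb (DRGTA.sigma₂ W) (1 / (2 * √(n : ℝ)))⌉ ≤ (t : ℤ))
      (α β : ℝ) (_hα : 0 < α) (_hα' : α ≤ min (DRGTA.Phi δ₂ / (2 * DRGTA.Lt W t)) 1)
      (_hβ : 0 < β)
      -- the iterates and their induced arithmetic means
      (x₀ : Fin n → DRGTA.Mat d r) (x y : ℕ → Fin n → DRGTA.Mat d r) (xbar : ℕ → DRGTA.Mat d r)
      (_hx : ∀ k, x k = (DRGTA.iterate W t α β f x₀ k).1)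
      (_hy : ∀ k, y k = (DRGTA.iterate W t α β f x₀ k).2)
      (_hxbar : ∀ k, DRGTA.IsIAM (x k) (xbar k))
      (_hx₀ : DRGTA.InRegion δ₁ δ₂ (x 0) (xbar 0))
      -- the derived constants
      (LG ρ s e q C₁ S : ℝ)
      (_hLG : LG = L + 2 * Ln)
      (_hρ : ρ = DRGTA.rhoT W t r δ₁ δ₂ α)
      (_hs : s = DRGTA.sigma₂ W ^ t)
      (_he : e = (1 / (n : ℝ)) * DRGTA.sqDist (x 0) (xbar 0))
      (_hq : q = (1 / (n : ℝ)) *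
        DRGTA.sqDist (y 0) (DRGTA.mean fun i => DRGTA.rgrad (f i) (x 0 i)))
      (_hC₁ : C₁ = c / (1 - ρ) ^ 2)
      (_hS : S = DRGTA.objective f (xbar 0) - DRGTA.optValue f
        + DRGTA.Ct₄ ρ s e q α β LG + DRGTA.G₄ r LG D C₁ α δ₁ ρ e * LG)
      (_hβ' : β ≤ DRGTA.betaMax r LG D C₁ α δ₁ ρ s)
      (K : ℕ) (_hK : 1 ≤ K),
      (Finset.range (K + 1)).inf' Finset.nonempty_range_add_one
          (fun k => ‖DRGTA.rgrad (DRGTA.objective f) (xbar k)‖ ^ 2)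
        ≤ ((16 + α ^ 2 * δ₁ ^ 2 * DRGTA.Ct₀ ρ) * S + DRGTA.Ct₁ ρ e * LG) / (β * K) ∧
      (Finset.range (K + 1)).inf' Finset.nonempty_range_add_one
          (fun k => (1 / (n : ℝ)) * DRGTA.sqDist (x k) (xbar k))
        ≤ (8 * β * S * DRGTA.Ct₀ ρ + DRGTA.Ct₁ ρ e) / K := by
  refine ⟨1, one_pos, ?_⟩
  intro n d r hn G W hW f L Ln D hL hdiff hlip hLn hD δ₁ δ₂ hδ₁ hδ₁₂ hδ₂ t ht htlog α β hα hα' hβ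
    x₀ x y xbar hx hy hxbar hx₀ LG ρ s e q C₁ S hLG hρ hs he hq hC₁ hS hβ' K hK
  -- for `r = 0` the condition on `δ₁` reads `δ₁ ≤ 0`, as its right-hand side is a quotient by zero
  have hr : 1 ≤ r := by
    rcases Nat.eq_zero_or_pos r with h | h
    · subst h
      simp at hδ₁₂
      linarith
    · exact h
  have hβ₁ := hβ'.trans (min_le_left _ _)
  have hβ₂ := hβ'.trans (min_le_right _ _)
  have H : DRGTA.Regime (W ^ t) f s ρ LG D δ₁ δ₂ α β := by
    have hβρ := hβ₁.trans (min_le_left _ _)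
    have hβα := hβ₁.trans (min_le_right _ _)
    have hβL := hβ₂.trans (min_le_left _ _)
    rw [hLG, hρ] at hβρ
    rw [hLG] at hβα hβL
    rw [hLG, hρ, hs]
    exact DRGTA.regime_of_hypotheses hn hr ⟨_, (hxbar 0).1⟩ hW hL hdiff hlip hLn hD hδ₁ hδ₁₂ hδ₂ ht
      htlog hα hα' hβ hβρ hβα hβL
  have hβG := hβ₂.trans (min_le_right _ _)
  have hstep : ∀ k, (x (k + 1), y (k + 1)) = (DRGTA.nextPoint (W ^ t) α β (x k) (y k),
      DRGTA.nextTracker (W ^ t) f α β (x k) (y k)) := by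
    intro k
    rw [hx (k + 1), hy (k + 1), DRGTA.iterate, DRGTA.step_eq H.stoch, ← hx, ← hy]
  have hxs : ∀ k, x (k + 1) = DRGTA.nextPoint (W ^ t) α β (x k) (y k) := fun k =>
    congrArg Prod.fst (hstep k)
  have hys : ∀ k, y (k + 1) = DRGTA.nextTracker (W ^ t) f α β (x k) (y k) := fun k =>
    congrArg Prod.snd (hstep k)
  have hy0 : y 0 = fun i => DRGTA.rgrad (f i) (x 0 i) := by
    rw [hy, hx]
    rfl
  have h0 : DRGTA.Invariant f LG D δ₁ δ₂ (x 0) (y 0) (xbar 0) :=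
    { mem := hx₀.1
      iam := hxbar 0
      meanSqDist_le := by
        rw [DRGTA.meanSqDist, one_div, inv_mul_le_iff₀ H.n_pos]
        exact hx₀.2.1
      dist_le := hx₀.2.2
      tracker_le := fun i => by
        rw [hy0]
        linarith [hD i _ (hx₀.1 i), H.LG_pos, H.D_nonneg]
      mean_tracker := by rw [hy0] }
  have hq' : q = DRGTA.meanSqDist (y 0) (DRGTA.mean (y 0)) := by
    rw [hq, h0.mean_tracker]
    rfl
  rw [hC₁] at hβG hS
  obtain ⟨hSG, hSE⟩ := DRGTA.sum_bounds H hxs hys hxbar h0 hr hdiff he hq' hβG hS K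
  refine ⟨?_, DRGTA.inf'_range_le_div hK hSE⟩
  rw [← div_div]
  exact DRGTA.inf'_range_le_div hK hSG
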